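/- Let $n\ge 1$, $H>0$, and let $\eta=\operatorname{diag}(-1,1,\dots,1)$ be the flat metric on $\mathbb R^n$, with $X\cdot Y=\eta_{\mu\nu}X^\mu Y^\nu$, $\mu,\nu=0,\dots,n-1$. Embed the Poincaré patch of $n$-dimensional de Sitter spacetime, with coordinates $z=(t,\vec x)\in\mathbb R\times\mathbb R^{n-1}$, into $\mathbb R^{1,n}$ by $$X^0=\tfrac1H\sinh(Ht)+\tfrac H2 e^{Ht}\vec x^2,\qquad X^a=e^{Ht}x^a,\qquad X^n=\tfrac1H\cosh(Ht)-\tfrac H2 e^{Ht}\vec x^2 ,$$ and let $Z(z)=(X^0,X^a)\in\mathbb R^n$. Functions $f$ on the patch (complex-valued) are considered together with an extension to $\mathbb R^{1,n}$ that is independent of $X^n$, i.e. a function, again denoted $f$, of $X=(X^0,X^a)\in\mathbb R^n$ such that $f(Z(z))=f(z)$ for all $z$. For a real skew-symmetric $n\times n$ matrix $\Theta$ put $(\Theta X)^\mu=\Theta^{\mu\nu}\eta_{\nu\lambda}X^\lambda$. Let $S^m_{\rho,\delta}(\mathbb R^n\times\mathbb R^n)$ be the set of smooth $b(x,y)$ such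 that for every compact $K$ and all multi-indices $\alpha,\beta$ there is $C$ with $|\partial_x^\beta\partial_y^\alpha b(x,y)|\le C(1+|y|)^{m-\rho|\alpha|+\delta|\beta|}$ for $x\in K$, $y\in\mathbb R^n$. Two functions $f,g$ form a symbol pair if there are $m\in\mathbb R$, $0<\rho\le1$, $0\le\delta<1$ such that for every $Z\in\mathbb R^n$ the function $(x,y)\mapsto f(Z+\Theta x)\,g(Z+y)$ is in $S^m_{\rho,\delta}(\mathbb R^n\times\mathbb R^n)$. The domain $\mathcal D$ is the largest set of functions any two of which (in either order, and including a function with itself) form a symbol pair, i.e. the set of all $f$ that form a symbol pair with themselves. The deformed product of $f$ and $g$ is $$(f\times_\Theta g)(Z)=(2\pi)^{-n}\lim_{\epsilon\to0^+}\iint\chi(\epsilon X,\epsilon Y)\,f(Z+\Theta X)\,g(Z+Y)\,e^{\mathrm i X\cdot Y}\,d^nX\,d^nY ,$$ where $\chi\in\mathscr S(\mathbb R^{2n})$ is arbitrary with $\chi(0,0)=1$; it is understood as existing if the integrals converge absolutely for all $\epsilon>0$ and the limit exists and is the same for all such $\chi$. On the patch, $(f\times_\Theta g)(z)=(f\times_\Theta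 g)(Z(z))$, and $Z\mapsto (f\times_\Theta g)(Z)$ is the extension of this function. Then, for every skew-symmetric $\Theta$ and all $f,g,h\in\mathcal D$: the product $f\times_\Theta g$ exists at all points and belongs to $\mathcal D$, and $$(f\times_\Theta g)\times_\Theta h=f\times_\Theta(g\times_\Theta h),$$ both on the patch and on the embedding space. Moreover: (i) $f\times_{\Theta'}g$ exists for every skew-symmetric $\Theta'$, and $\lim_{\Theta'\to0}f\times_{\Theta'}g=fg$, where $\Theta'$ ranges over the skew-symmetric matrices and the convergence is locally uniform on the embedding space and on the patch; (ii) the constant function $1$ is in $\mathcal D$, and $f\times_\Theta1=1\times_\Theta f=f$. -/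

import Mathlib

open Filter Topology MeasureTheory
open scoped ContDiff SchwartzMap

noncomputable section

namespace DeSitterDeformation

/-! Throughout, `n = d + 1` is the spacetime dimension and `d` the number of spatial directions. -/

/-- The space `ℝⁿ` of the first `n` embedding coordinates `X^μ = (X^0, X^a)`, `μ = 0, …, n - 1`. -/
abbrev Emb (d : ℕ) : Type := EuclideanSpace ℝ (Fin (d + 1))

/-- The Poincaré patch of `n`-dimensional de Sitter spacetime, in its global coordinates
`(t, x^1, …, x^(n-1))`. -/
abbrev Patch (d : ℕ) : Type := ℝ × EuclideanSpace ℝ (Fin d)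

/-- The diagonal entries of the flat metric `η = diag(-1, 1, …, 1)`. -/
def eta {d : ℕ} (μ : Fin (d + 1)) : ℝ := if μ = 0 then -1 else 1

/-- The Minkowski product `X · Y = - X^0 Y^0 + ∑ a, X^a Y^a`. -/
def mdot {d : ℕ} (X Y : Emb d) : ℝ := ∑ μ, eta μ * X μ * Y μ

/-- `(Θ X)^μ = Θ^{μν} X_ν`, where `X_ν = η_{νλ} X^λ`. -/
def act {d : ℕ} (Θ : Matrix (Fin (d + 1)) (Fin (d + 1)) ℝ) (X : Emb d) : Emb d :=
  WithLp.toLp 2 (fun μ => ∑ ν, Θ μ ν * (eta ν * X ν))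

/-- The flat parametrization of the Poincaré patch as a subset of the hyperboloid
`X · X + (X^n)^2 = H^(-2)` in `ℝ^{1,n}`; the value is the pair `((X^0, X^a), X^n)`. -/
def embed {d : ℕ} (H : ℝ) (z : Patch d) : Emb d × ℝ :=
  (WithLp.toLp 2 (Fin.cons
      (1 / H * Real.sinh (H * z.1) + H / 2 * Real.exp (H * z.1) * ‖z.2‖ ^ 2)
      (fun a => Real.exp (H * z.1) * z.2 a)),
    1 / H * Real.cosh (H * z.1) - H / 2 * Real.exp (H * z.1) * ‖z.2‖ ^ 2)

/-- A complex function on the Poincaré patch together with its extension to the embedding space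
`ℝ^{1,n}`. The extension does not depend on `X^n`, hence is a function of `(X^0, X^a)`, and it
agrees with the original function on the patch. -/
@[ext]
structure ExtFun (d : ℕ) (H : ℝ) where
  /-- the function on the patch -/
  toFun : Patch d → ℂ
  /-- the extension to the embedding space -/
  extension : Emb d → ℂ
  /-- the extension restricts to the function on the patch -/
  extension_embed : ∀ z, extension (embed H z).1 = toFun z

/-- The symbol class `S^m_{ρ,δ}(V × W)`: smooth functions `b(x, y)` such that
`|∂_x^β ∂_y^α b(x, y)| ≤ C (1 + |y|)^(m - ρ |α| + δ |β|)` for all `y` and all `x` in a compact set,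
for each compact set and all orders `|α| = i`, `|β| = j`. -/
def IsSymbol {V W : Type*} [NormedAddCommGroup V] [NormedSpace ℝ V] [NormedAddCommGroup W]
    [NormedSpace ℝ W] (m ρ δ : ℝ) (b : V → W → ℂ) : Prop :=
  ContDiff ℝ ∞ (fun p : V × W => b p.1 p.2) ∧
    ∀ K : Set V, IsCompact K → ∀ i j : ℕ, ∃ C : ℝ, ∀ x ∈ K, ∀ y : W,
      ‖iteratedFDeriv ℝ j (fun x' => iteratedFDeriv ℝ i (b x') y) x‖
        ≤ C * (1 + ‖y‖) ^ (m - ρ * i + δ * j)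

/-- `τ_{Θx}(F) τ_y(G) ∈ S^m_{ρ,δ}` for some order `m` and some type `ρ, δ`, where `τ` is the
translation action: at every point `Z`, the function `(x, y) ↦ F(Z + Θx) G(Z + y)` is a symbol. -/
def SymbolPair {d : ℕ} (Θ : Matrix (Fin (d + 1)) (Fin (d + 1)) ℝ) (F G : Emb d → ℂ) : Prop :=
  ∃ m ρ δ : ℝ, 0 < ρ ∧ ρ ≤ 1 ∧ 0 ≤ δ ∧ δ < 1 ∧
    ∀ Z : Emb d, IsSymbol m ρ δ (fun x y => F (Z + act Θ x) * G (Z + y))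

/-- The domain `𝒟`: the largest set of functions any two of which form a symbol pair, namely the set
of all functions that do so with themselves (see `symbolPair_of_mem_domain`). -/
def domain {d : ℕ} (Θ : Matrix (Fin (d + 1)) (Fin (d + 1)) ℝ) : Set (Emb d → ℂ) :=
  {F | SymbolPair Θ F F}

theorem rpow_peetre {V : Type*} [NormedAddCommGroup V] (s : ℝ) (a y : V) :
    (1 + ‖y‖) ^ s ≤ (1 + ‖a‖) ^ |s| * (1 + ‖a + y‖) ^ s := by
  have h1 : (1 + ‖y‖) ≤ (1 + ‖a‖) * (1 + ‖a + y‖) := by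
    have := norm_sub_le (a + y) a
    rw [add_sub_cancel_left] at this
    nlinarith [norm_nonneg a, norm_nonneg (a + y)]
  have h2 : (1 + ‖a + y‖) ≤ (1 + ‖a‖) * (1 + ‖y‖) := by
    nlinarith [norm_nonneg a, norm_nonneg y, norm_add_le a y]
  rcases le_total 0 s with hs | hs
  · rw [abs_of_nonneg hs, ← Real.mul_rpow (by positivity) (by positivity)]
    exact Real.rpow_le_rpow (by positivity) h1 hs
  · have h3 := Real.rpow_le_rpow (by positivity) h2 (neg_nonneg.2 hs)
    rw [Real.mul_rpow (by positivity) (by positivity), Real.rpow_neg (by positivity),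
      Real.rpow_neg (x := 1 + ‖y‖) (by positivity)] at h3
    rw [abs_of_nonpos hs]
    have p1 : 0 < (1 + ‖y‖) ^ s := by positivity
    have p2 : 0 < (1 + ‖a + y‖) ^ s := by positivity
    rw [inv_eq_one_div, div_le_iff₀ p2] at h3
    calc (1 + ‖y‖) ^ s = (1 + ‖y‖) ^ s * 1 := by ring
      _ ≤ (1 + ‖y‖) ^ s * ((1 + ‖a‖) ^ (-s) * ((1 + ‖y‖) ^ s)⁻¹ * (1 + ‖a + y‖) ^ s) := by gcongr
      _ = _ := by field_simp

theorem contDiff_act {d : ℕ} (Θ : Matrix (Fin (d + 1)) (Fin (d + 1)) ℝ) :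
    ContDiff ℝ ∞ (act Θ) := by
  unfold act
  rw [contDiff_euclidean]
  intro i
  fun_prop

theorem iteratedFDeriv_mul_shift {d : ℕ} {G : Emb d → ℂ} (hG : ContDiff ℝ ∞ G) (c : ℂ)
    (Z y : Emb d) (i : ℕ) :
    iteratedFDeriv ℝ i (fun y => c * G (Z + y)) y = c • iteratedFDeriv ℝ i G (Z + y) := by
  have h : ContDiff ℝ ∞ (fun y => G (Z + y)) := hG.comp (contDiff_const.add contDiff_id)
  have := iteratedFDeriv_const_smul_apply (𝕜 := ℝ) (i := i) (a := c) (f := fun y => G (Z + y))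
    (x := y) (h.contDiffAt.of_le (by exact_mod_cast le_top))
  rw [iteratedFDeriv_comp_add_left] at this
  exact this

theorem symbol_of_mem_domain {d : ℕ} {Θ : Matrix (Fin (d + 1)) (Fin (d + 1)) ℝ} {F : Emb d → ℂ}
    (hF : F ∈ domain Θ) : ∃ m ρ : ℝ, 0 < ρ ∧ ρ ≤ 1 ∧ ContDiff ℝ ∞ F ∧
      ∀ i : ℕ, ∃ C : ℝ, ∀ y, ‖iteratedFDeriv ℝ i F y‖ ≤ C * (1 + ‖y‖) ^ (m - ρ * i) := by
  obtain ⟨m, ρ, δ, h0, h1, -, -, h⟩ := hF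
  refine ⟨m, ρ, h0, h1, ?_⟩
  by_cases hz : ∃ Z, F Z ≠ 0
  · obtain ⟨Z, hZ⟩ := hz
    obtain ⟨hc, hb⟩ := h Z
    have a0 : act Θ 0 = 0 := by ext i; simp [act]
    have hs : ContDiff ℝ ∞ F := by
      have h2 : ContDiff ℝ ∞ (fun y : Emb d => ((0 : Emb d), y - Z)) := by fun_prop
      have h3 := contDiff_const (c := (F Z)⁻¹) |>.mul (hc.comp h2)
      have e : F = fun y => (F Z)⁻¹ * (F (Z + act Θ 0) * F (Z + (y - Z))) := by
        funext y
        simp [a0, hZ]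
      rw [e]
      exact h3
    refine ⟨hs, fun i => ?_⟩
    obtain ⟨C, hC⟩ := hb {0} isCompact_singleton i 0
    refine ⟨‖F Z‖⁻¹ * (C * (1 + ‖Z‖) ^ |m - ρ * i|), fun y => ?_⟩
    have h2 := hC 0 rfl (y - Z)
    have hpos : 0 < ‖F Z‖ := norm_pos_iff.2 hZ
    rw [norm_iteratedFDeriv_zero, iteratedFDeriv_mul_shift hs, norm_smul, a0] at h2
    simp only [add_zero, add_sub_cancel, Nat.cast_zero, mul_zero] at h2
    have hC0 : 0 ≤ C := by
      by_contra hn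
      have : C * (1 + ‖y - Z‖) ^ (m - ρ * i) < 0 :=
        mul_neg_of_neg_of_pos (not_le.1 hn) (by positivity)
      have : 0 ≤ ‖F Z‖ * ‖iteratedFDeriv ℝ i F y‖ := by positivity
      linarith
    have h3 := rpow_peetre (m - ρ * i) Z (y - Z)
    rw [add_sub_cancel] at h3
    rw [mul_assoc, ← div_eq_inv_mul, le_div_iff₀ hpos, mul_comm]
    calc _ ≤ _ := h2
      _ ≤ C * _ := mul_le_mul_of_nonneg_left h3 hC0
      _ = _ := by ring
  · push Not at hz
    obtain rfl : F = fun _ => 0 := funext hz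
    exact ⟨contDiff_const, fun i => ⟨0, fun y => by simp⟩⟩

/-- Any two members of the domain form a symbol pair, for each deformation matrix. -/
theorem symbolPair_of_mem_domain {d : ℕ} {Θ : Matrix (Fin (d + 1)) (Fin (d + 1)) ℝ}
    {F G : Emb d → ℂ} (hF : F ∈ domain Θ) (hG : G ∈ domain Θ)
    (Θ' : Matrix (Fin (d + 1)) (Fin (d + 1)) ℝ) : SymbolPair Θ' F G := by
  obtain ⟨-, -, -, -, hFs, -⟩ := symbol_of_mem_domain hF
  obtain ⟨m, ρ, h0, h1, hGs, hGb⟩ := symbol_of_mem_domain hG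
  refine ⟨m, ρ, 0, h0, h1, le_rfl, zero_lt_one, fun Z => ⟨?_, fun K hK i j => ?_⟩⟩
  · exact (hFs.comp (contDiff_const.add ((contDiff_act Θ').comp contDiff_fst))).mul
      (hGs.comp (contDiff_const.add contDiff_snd))
  · have hA : ContDiff ℝ ∞ (fun x => F (Z + act Θ' x)) :=
      hFs.comp (contDiff_const.add (contDiff_act Θ'))
    obtain ⟨A, hAb⟩ := hK.exists_bound_of_continuousOn
      (hA.continuous_iteratedFDeriv (m := j) (by exact_mod_cast le_top)).continuousOn
    obtain ⟨C, hC⟩ := hGb i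
    refine ⟨A * (C * (1 + ‖Z‖) ^ |m - ρ * i|), fun x hx y => ?_⟩
    simp_rw [iteratedFDeriv_mul_shift hGs]
    set T := iteratedFDeriv ℝ i G (Z + y) with hT
    have hL := ContinuousLinearMap.norm_iteratedFDeriv_comp_left (𝕜 := ℝ) (n := j) (N := ∞)
      ((ContinuousLinearMap.id ℝ ℂ).smulRight T) (f := fun x => F (Z + act Θ' x)) (x := x)
      hA.contDiffAt (by exact_mod_cast le_top)
    have hA0 : 0 ≤ A := (norm_nonneg _).trans (hAb x hx)
    have hLn : ‖(ContinuousLinearMap.id ℝ ℂ).smulRight T‖ ≤ ‖T‖ := by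
      refine ContinuousLinearMap.opNorm_le_bound _ (norm_nonneg _) fun c => ?_
      simp [norm_smul, mul_comm]
    have hCT := hC (Z + y)
    have hp := rpow_peetre (m - ρ * i) (-Z) (Z + y)
    rw [neg_add_cancel_left, norm_neg] at hp
    have hC0 : 0 ≤ C := by
      by_contra hn
      have : C * (1 + ‖Z + y‖) ^ (m - ρ * i) < 0 :=
        mul_neg_of_neg_of_pos (not_le.1 hn) (by positivity)
      linarith [norm_nonneg (iteratedFDeriv ℝ i G (Z + y))]
    have e : m - ρ * i + 0 * (j : ℝ) = m - ρ * i := by ring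
    rw [e]
    calc _ ≤ ‖(ContinuousLinearMap.id ℝ ℂ).smulRight T‖ *
            ‖iteratedFDeriv ℝ j (fun x => F (Z + act Θ' x)) x‖ := hL
      _ ≤ ‖T‖ * A := mul_le_mul hLn (hAb x hx) (norm_nonneg _) (norm_nonneg _)
      _ ≤ (C * (1 + ‖Z + y‖) ^ (m - ρ * i)) * A := mul_le_mul_of_nonneg_right hCT hA0
      _ ≤ (C * ((1 + ‖Z‖) ^ |m - ρ * i| * (1 + ‖y‖) ^ (m - ρ * i))) * A := by gcongr
      _ = _ := by ring

/-- The integrand of the deformed product at `Z`, with cut-off function `χ` and parameter `ε`. -/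
def integrand {d : ℕ} (Θ : Matrix (Fin (d + 1)) (Fin (d + 1)) ℝ) (F G : Emb d → ℂ)
    (χ : 𝓢(Emb d × Emb d, ℂ)) (Z : Emb d) (ε : ℝ) (p : Emb d × Emb d) : ℂ :=
  χ (ε • p.1, ε • p.2) * F (Z + act Θ p.1) * G (Z + p.2) *
    Complex.exp (Complex.I * (mdot p.1 p.2 : ℂ))

/-- `c` is the value at `Z` of the oscillatory integral defining `F ×_Θ G`: for every Schwartz
cut-off function `χ` with `χ(0, 0) = 1`, the cut-off integrals exist and
`(2π)^(-n) ∬ χ(εX, εY) F(Z + ΘX) G(Z + Y) e^(i X·Y) dX dY → c` as `ε → 0⁺`. -/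
def HasProd {d : ℕ} (Θ : Matrix (Fin (d + 1)) (Fin (d + 1)) ℝ) (F G : Emb d → ℂ)
    (Z : Emb d) (c : ℂ) : Prop :=
  ∀ χ : 𝓢(Emb d × Emb d, ℂ), χ (0, 0) = 1 →
    (∀ ε : ℝ, 0 < ε → Integrable (integrand Θ F G χ Z ε)) ∧
      Tendsto (fun ε : ℝ => ((2 * Real.pi : ℂ) ^ (d + 1))⁻¹ * ∫ p, integrand Θ F G χ Z ε p)
        (𝓝[>] 0) (𝓝 c)

open Classical in
/-- The deformed product `F ×_Θ G` of functions on the embedding space (with value `0` where the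
oscillatory integral does not exist). -/
def dprod {d : ℕ} (Θ : Matrix (Fin (d + 1)) (Fin (d + 1)) ℝ) (F G : Emb d → ℂ) : Emb d → ℂ :=
  fun Z => if h : ∃ c, HasProd Θ F G Z c then h.choose else 0

namespace ExtFun

variable {d : ℕ} {H : ℝ}

/-- The function with extension `F`. -/
def ofExt (F : Emb d → ℂ) : ExtFun d H := ⟨fun z => F (embed H z).1, F, fun _ => rfl⟩

/-- The deformed product: `(f ×_Θ g)(z)` is the value at the embedding point `Z` of `z` of the
deformed product of the extensions. -/
def prod (Θ : Matrix (Fin (d + 1)) (Fin (d + 1)) ℝ) (f g : ExtFun d H) : ExtFun d H :=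
  ofExt (dprod Θ f.extension g.extension)

/-- The oscillatory integral defining `f ×_Θ g` exists at every point. -/
def ProdExists (Θ : Matrix (Fin (d + 1)) (Fin (d + 1)) ℝ) (f g : ExtFun d H) : Prop :=
  ∀ Z : Emb d, ∃ c, HasProd Θ f.extension g.extension Z c

/-- The constant function `1`. -/
def one : ExtFun d H := ⟨fun _ => 1, fun _ => 1, fun _ => rfl⟩

/-- The domain `𝒟`, as a set of extended functions. -/
def dom (H : ℝ) (Θ : Matrix (Fin (d + 1)) (Fin (d + 1)) ℝ) : Set (ExtFun d H) :=
  {f | f.extension ∈ domain Θ}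

end ExtFun

end DeSitterDeformation

end

noncomputable section

namespace DeSitterDeformation

section

/-! ### Families of amplitudes -/

section Amplitudes

variable {V W F T S : Type*} [NormedAddCommGroup V] [NormedSpace ℝ V]
  [NormedAddCommGroup W] [NormedSpace ℝ W] [NormedAddCommGroup F] [NormedSpace ℝ F]

/-! Setting `x = 0` in the symbol estimate, at a point where the function does not vanish, shows
that the members of `𝒟` are exactly the symbols in one variable: every derivative lowers the order
`m` by some `ρ > 0` (`exists_hasSymbolType_of_mem_domain`, `HasSymbolType.mem_domain`). In
particular `𝒟` does not depend on `Θ`.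

The product at `Z` is an oscillatory integral with amplitude `F(Z + ΘX) G(Z + Y)` and phase `X · Y`,
whose gradient grows linearly and vanishes only at the origin. The operator `Phase.L` comes from
integration by parts against `exp(iφ)`. Each application gains one power of decay, even if the
derivatives of the amplitude do not decay. After `k` applications the integral converges absolutely,
and dominated convergence shows that it is the limit for every cut-off (`Phase.hasOsc_regInt`). Two
properties of the resulting functional carry the rest: it is bounded by the symbol constants
(`Phase.osc_norm_le`), and it tends to zero along bounded families of amplitudes all of whose
derivatives tend to zero pointwise (`Phase.osc_tendsto_zero`).

The first property, with Taylor's formula, allows differentiation under the integral. Since `Z`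
enters by translation only, the product obeys the Leibniz rule (`fderiv_dprod_apply`), so each
derivative of a product also lowers the order by `ρ` and `𝒟` is closed. The second property gives
Fubini's theorem (`osc_prod`). Both iterated products thus become one integral over four variables,
and a linear substitution preserving the phase maps one amplitude to the other (`dprod_assoc`).

An amplitude depending on `Y` alone integrates to `(2π)^n` times its value at `0`, by Fourier
inversion (`osc_comp_snd`); this gives the unit. As `(Θ, Z) → (0, Z₀)`, the amplitude tends to
`F(Z₀) G(Z₀ + Y)`, and convergence jointly in `Θ` and `Z` is locally uniform convergence
(`tendsto_dprod_zero`). -/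

/-- A family of smooth functions all of whose derivatives are bounded by a multiple of the
weight `wt`, uniformly along the filter `l`. -/
def Bdd (l : Filter T) (wt : T → V → ℝ) (a : T → V → F) : Prop :=
  (∀ t, ContDiff ℝ ∞ (a t)) ∧
    ∀ i : ℕ, ∃ C : ℝ, 0 ≤ C ∧ ∀ᶠ t in l, ∀ p, ‖iteratedFDeriv ℝ i (a t) p‖ ≤ C * wt t p

/-- A smooth function all of whose derivatives are bounded by a multiple of the weight `wt`. -/
def Sym (wt : V → ℝ) (a : V → F) : Prop :=
  ContDiff ℝ ∞ a ∧ ∀ i : ℕ, ∃ C : ℝ, 0 ≤ C ∧ ∀ p, ‖iteratedFDeriv ℝ i a p‖ ≤ C * wt p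

/-- All derivatives of the family converge to zero pointwise. -/
def Null (l : Filter T) (a : T → V → F) : Prop :=
  ∀ (i : ℕ) (p : V), Tendsto (fun t => iteratedFDeriv ℝ i (a t) p) l (𝓝 0)

theorem Sym.bdd {wt : V → ℝ} {a : V → F} (h : Sym wt a) (l : Filter T) :
    Bdd l (fun _ => wt) (fun _ => a) :=
  ⟨fun _ => h.1, fun i => by
    obtain ⟨C, h0, hC⟩ := h.2 i
    exact ⟨C, h0, Eventually.of_forall fun _ => hC⟩⟩

/-- A one-point parameter space makes `Sym` a special case of `Bdd`. Closure properties are proved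
for families and read off for single functions. -/
theorem Bdd.sym {wt : V → ℝ} {a : V → F} (h : Bdd (⊤ : Filter Unit) (fun _ => wt) (fun _ => a)) :
    Sym wt a :=
  ⟨h.1 (), fun i => by
    obtain ⟨C, h0, hC⟩ := h.2 i
    exact ⟨C, h0, (eventually_top.1 hC) ()⟩⟩

theorem Bdd.mono {l : Filter T} {wt wt' : T → V → ℝ} {a : T → V → F} (h : Bdd l wt a) (C : ℝ)
    (hC : ∀ᶠ t in l, ∀ p, wt t p ≤ C * wt' t p) (h0 : 0 ≤ C) : Bdd l wt' a := by
  refine ⟨h.1, fun i => ?_⟩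
  obtain ⟨D, hD0, hD⟩ := h.2 i
  refine ⟨D * C, by positivity, ?_⟩
  filter_upwards [hD, hC] with t h1 h2 p
  calc _ ≤ _ := h1 p
    _ ≤ D * (C * wt' t p) := mul_le_mul_of_nonneg_left (h2 p) hD0
    _ = _ := by ring

theorem Sym.mono {wt wt' : V → ℝ} {a : V → F} (h : Sym wt a) (C : ℝ)
    (hC : ∀ p, wt p ≤ C * wt' p) (h0 : 0 ≤ C) : Sym wt' a :=
  ((h.bdd (⊤ : Filter Unit)).mono (wt' := fun _ => wt') C (Eventually.of_forall fun _ => hC) h0).sym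

theorem Bdd.add {l : Filter T} {wt : T → V → ℝ} {a b : T → V → F} (ha : Bdd l wt a)
    (hb : Bdd l wt b) : Bdd l wt (fun t p => a t p + b t p) := by
  refine ⟨fun t => (ha.1 t).add (hb.1 t), fun i => ?_⟩
  obtain ⟨A, hA0, hA⟩ := ha.2 i
  obtain ⟨B, hB0, hB⟩ := hb.2 i
  refine ⟨A + B, by positivity, ?_⟩
  filter_upwards [hA, hB] with t h1 h2 p
  have := iteratedFDeriv_add_apply (𝕜 := ℝ) (i := i) (x := p)
    ((ha.1 t).contDiffAt.of_le (by exact_mod_cast le_top))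
    ((hb.1 t).contDiffAt.of_le (by exact_mod_cast le_top))
  change ‖iteratedFDeriv ℝ i (a t + b t) p‖ ≤ _
  rw [this, add_mul]
  exact (norm_add_le _ _).trans (add_le_add (h1 p) (h2 p))

theorem Bdd.clm_comp {G : Type*} [NormedAddCommGroup G] [NormedSpace ℝ G] {l : Filter T}
    {wt : T → V → ℝ} {a : T → V → F} (ha : Bdd l wt a) (A : F →L[ℝ] G) :
    Bdd l wt (fun t p => A (a t p)) := by
  refine ⟨fun t => A.contDiff.comp (ha.1 t), fun i => ?_⟩
  obtain ⟨C, h0, hC⟩ := ha.2 i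
  refine ⟨‖A‖ * C, by positivity, ?_⟩
  filter_upwards [hC] with t h p
  have := A.norm_iteratedFDeriv_comp_left (x := p) (n := i) (N := ∞) (ha.1 t).contDiffAt
    (by exact_mod_cast le_top)
  calc _ ≤ _ := this
    _ ≤ ‖A‖ * (C * wt t p) := by gcongr; exact h p
    _ = _ := by ring

theorem Sym.clm_comp {G : Type*} [NormedAddCommGroup G] [NormedSpace ℝ G]
    {wt : V → ℝ} {a : V → F} (ha : Sym wt a) (A : F →L[ℝ] G) : Sym wt (fun p => A (a p)) :=
  ((ha.bdd (⊤ : Filter Unit)).clm_comp A).sym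

theorem Bdd.const_mul {l : Filter T} {wt : T → V → ℝ} {a : T → V → ℂ} (ha : Bdd l wt a) (c : ℂ) :
    Bdd l wt (fun t p => c * a t p) :=
  ha.clm_comp (c • ContinuousLinearMap.id ℝ ℂ)

theorem Sym.const_mul {wt : V → ℝ} {a : V → ℂ} (ha : Sym wt a) (c : ℂ) :
    Sym wt (fun p => c * a p) :=
  ha.clm_comp (c • ContinuousLinearMap.id ℝ ℂ)

theorem Bdd.sub {l : Filter T} {wt : T → V → ℝ} {a b : T → V → ℂ} (ha : Bdd l wt a)
    (hb : Bdd l wt b) : Bdd l wt (fun t p => a t p - b t p) := by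
  have := ha.add (hb.const_mul (-1))
  simpa [sub_eq_add_neg] using this

theorem Sym.sub {wt : V → ℝ} {a b : V → ℂ} (ha : Sym wt a) (hb : Sym wt b) :
    Sym wt (fun p => a p - b p) :=
  ((ha.bdd (⊤ : Filter Unit)).sub (hb.bdd _)).sym

theorem Bdd.mul {l : Filter T} {wt wt' : T → V → ℝ} {a b : T → V → ℂ} (ha : Bdd l wt a)
    (hb : Bdd l wt' b) : Bdd l (fun t p => wt t p * wt' t p) (fun t p => a t p * b t p) := by
  refine ⟨fun t => (ha.1 t).mul (hb.1 t), fun i => ?_⟩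
  choose A hA0 hA using ha.2
  choose B hB0 hB using hb.2
  refine ⟨∑ k ∈ Finset.range (i + 1), (i.choose k : ℝ) * A k * B (i - k),
    Finset.sum_nonneg fun k _ => by have := hA0 k; have := hB0 (i - k); positivity, ?_⟩
  -- The eventual set depends on the order of the derivative, but only the finitely many orders `k ≤
  -- i` enter the Leibniz bound, so the sets can be intersected.
  have h1 : ∀ᶠ t in l, ∀ k ∈ Finset.range (i + 1), ∀ p,
      ‖iteratedFDeriv ℝ k (a t) p‖ ≤ A k * wt t p := by
    rw [Finset.eventually_all]
    exact fun k _ => hA k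
  have h2 : ∀ᶠ t in l, ∀ k ∈ Finset.range (i + 1), ∀ p,
      ‖iteratedFDeriv ℝ (i - k) (b t) p‖ ≤ B (i - k) * wt' t p := by
    rw [Finset.eventually_all]
    exact fun k _ => hB _
  filter_upwards [h1, h2] with t h1 h2 p
  refine (norm_iteratedFDeriv_mul_le (ha.1 t) (hb.1 t) p (n := i)
    (by exact_mod_cast le_top)).trans ?_
  rw [Finset.sum_mul]
  refine Finset.sum_le_sum fun k hk => ?_
  calc _ = (i.choose k : ℝ) * (‖iteratedFDeriv ℝ k (a t) p‖ * ‖iteratedFDeriv ℝ (i - k) (b t) p‖) :=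
        by ring
    _ ≤ (i.choose k : ℝ) * ((A k * wt t p) * (B (i - k) * wt' t p)) := by
        gcongr
        · exact (norm_nonneg _).trans (h1 k hk p)
        · exact h1 k hk p
        · exact h2 k hk p
    _ = _ := by ring

theorem Sym.mul {wt wt' : V → ℝ} {a b : V → ℂ} (ha : Sym wt a) (hb : Sym wt' b) :
    Sym (fun p => wt p * wt' p) (fun p => a p * b p) :=
  ((ha.bdd (⊤ : Filter Unit)).mul (hb.bdd _)).sym

theorem norm_iteratedFDeriv_fderiv_apply_le {f : V → F} (hf : ContDiff ℝ ∞ f) (i : ℕ) (v p : V) :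
    ‖iteratedFDeriv ℝ i (fun q => fderiv ℝ f q v) p‖ ≤ ‖v‖ * ‖iteratedFDeriv ℝ (i + 1) f p‖ := by
  have h : ContDiff ℝ ∞ (fderiv ℝ f) := hf.fderiv_right (by simp)
  have := norm_iteratedFDeriv_clm_apply_const (c := v) (x := p) (n := i) h.contDiffAt
    (by exact_mod_cast le_top)
  rwa [norm_iteratedFDeriv_fderiv] at this

theorem contDiff_fderiv_apply {f : V → F} (hf : ContDiff ℝ ∞ f) (v : V) :
    ContDiff ℝ ∞ (fun q => fderiv ℝ f q v) :=
  (hf.fderiv_right (by simp)).clm_apply contDiff_const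

theorem Bdd.fderiv_apply {l : Filter T} {wt : T → V → ℝ} {a : T → V → F} (ha : Bdd l wt a) (v : V) :
    Bdd l wt (fun t p => fderiv ℝ (a t) p v) := by
  refine ⟨fun t => contDiff_fderiv_apply (ha.1 t) v, fun i => ?_⟩
  obtain ⟨C, h0, hC⟩ := ha.2 (i + 1)
  refine ⟨‖v‖ * C, by positivity, ?_⟩
  filter_upwards [hC] with t h p
  calc _ ≤ _ := norm_iteratedFDeriv_fderiv_apply_le (ha.1 t) i v p
    _ ≤ ‖v‖ * (C * wt t p) := by gcongr; exact h p
    _ = _ := by ring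

theorem Sym.fderiv_apply {wt : V → ℝ} {a : V → F} (ha : Sym wt a) (v : V) :
    Sym wt (fun p => fderiv ℝ a p v) :=
  ((ha.bdd (⊤ : Filter Unit)).fderiv_apply v).sym

theorem iteratedFDeriv_comp_affine {f : V → F} (hf : ContDiff ℝ ∞ f) (z : V) (B : W →L[ℝ] V)
    (i : ℕ) (p : W) :
    iteratedFDeriv ℝ i (fun p => f (z + B p)) p =
      (iteratedFDeriv ℝ i f (z + B p)).compContinuousLinearMap fun _ => B := by
  have h : ContDiff ℝ ∞ (fun y => f (z + y)) := hf.comp (contDiff_const.add contDiff_id)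
  have := B.iteratedFDeriv_comp_right h p (i := i) (by exact_mod_cast le_top)
  rw [iteratedFDeriv_comp_add_left] at this
  exact this

theorem norm_iteratedFDeriv_comp_affine_le {f : V → F} (hf : ContDiff ℝ ∞ f) (z : V)
    (B : W →L[ℝ] V) (i : ℕ) (p : W) :
    ‖iteratedFDeriv ℝ i (fun p => f (z + B p)) p‖ ≤ ‖iteratedFDeriv ℝ i f (z + B p)‖ * ‖B‖ ^ i := by
  rw [iteratedFDeriv_comp_affine hf]
  simpa using (iteratedFDeriv ℝ i f (z + B p)).norm_compContinuousLinearMap_le fun _ => B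

theorem contDiff_comp_affine {f : V → F} (hf : ContDiff ℝ ∞ f) (z : V) (B : W →L[ℝ] V) :
    ContDiff ℝ ∞ (fun p => f (z + B p)) :=
  hf.comp (contDiff_const.add B.contDiff)

theorem Bdd.comp_affine {l : Filter T} {l' : Filter S} {wt : T → V → ℝ} {a : T → V → F}
    (ha : Bdd l wt a) {τ : S → T} (hτ : Tendsto τ l' l) (z : S → V) (B : S → W →L[ℝ] V) {M : ℝ}
    (hB : ∀ᶠ s in l', ‖B s‖ ≤ M) :
    Bdd l' (fun s p => wt (τ s) (z s + B s p)) (fun s p => a (τ s) (z s + B s p)) := by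
  refine ⟨fun s => contDiff_comp_affine (ha.1 _) _ _, fun i => ?_⟩
  obtain ⟨C, h0, hC⟩ := ha.2 i
  refine ⟨C * |M| ^ i, by positivity, ?_⟩
  filter_upwards [hτ.eventually hC, hB] with s h1 h2 p
  have h3 : ‖B s‖ ≤ |M| := h2.trans (le_abs_self M)
  calc _ ≤ _ := norm_iteratedFDeriv_comp_affine_le (ha.1 _) _ _ i p
    _ ≤ (C * wt (τ s) (z s + B s p)) * |M| ^ i := by
        gcongr
        · exact (norm_nonneg _).trans (h1 _)
        · exact h1 _
    _ = _ := by ring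

theorem Sym.comp_affine {wt : V → ℝ} {a : V → F} (ha : Sym wt a) (z : V) (B : W →L[ℝ] V) :
    Sym (fun p => wt (z + B p)) (fun p => a (z + B p)) :=
  ((ha.bdd (⊤ : Filter Unit)).comp_affine (l' := (⊤ : Filter Unit)) tendsto_id (fun _ => z)
    (fun _ => B) (Eventually.of_forall fun _ => le_rfl)).sym

theorem Sym.continuous {wt : V → ℝ} {a : V → F} (h : Sym wt a) : Continuous a := h.1.continuous

theorem Sym.bound {wt : V → ℝ} {a : V → F} (h : Sym wt a) : ∃ C, 0 ≤ C ∧ ∀ p, ‖a p‖ ≤ C * wt p := by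
  obtain ⟨C, h0, hC⟩ := h.2 0
  exact ⟨C, h0, fun p => by simpa using hC p⟩

/-! ### Pointwise convergence to zero -/

theorem Null.tendsto {l : Filter T} {a : T → V → F} (h : Null l a) (p : V) :
    Tendsto (fun t => a t p) l (𝓝 0) := by
  have := (h 0 p).norm
  simp only [norm_iteratedFDeriv_zero, norm_zero] at this
  exact tendsto_zero_iff_norm_tendsto_zero.2 this

theorem Null.add {l : Filter T} {a b : T → V → F} (ha : Null l a) (hb : Null l b)
    (ha' : ∀ t, ContDiff ℝ ∞ (a t)) (hb' : ∀ t, ContDiff ℝ ∞ (b t)) :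
    Null l (fun t p => a t p + b t p) := by
  intro i p
  have h := (ha i p).add (hb i p)
  rw [add_zero] at h
  refine h.congr fun t => ?_
  exact (iteratedFDeriv_add_apply (𝕜 := ℝ) (i := i) (x := p)
    ((ha' t).contDiffAt.of_le (by exact_mod_cast le_top))
    ((hb' t).contDiffAt.of_le (by exact_mod_cast le_top))).symm

theorem Null.mul {l : Filter T} {a b : T → V → ℂ} (ha : Null l a)
    (ha' : ∀ t, ContDiff ℝ ∞ (a t)) (hb' : ∀ t, ContDiff ℝ ∞ (b t))
    (hb : ∀ i p, ∃ C : ℝ, ∀ᶠ t in l, ‖iteratedFDeriv ℝ i (b t) p‖ ≤ C) :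
    Null l (fun t p => a t p * b t p) := by
  intro i p
  choose B hB using hb
  rw [tendsto_zero_iff_norm_tendsto_zero]
  have h2 : ∀ᶠ t in l, ∀ k ∈ Finset.range (i + 1),
      ‖iteratedFDeriv ℝ (i - k) (b t) p‖ ≤ B (i - k) p := by
    rw [Finset.eventually_all]
    exact fun k _ => hB _ _
  have h3 : Tendsto (fun t => ∑ k ∈ Finset.range (i + 1),
      (i.choose k : ℝ) * ‖iteratedFDeriv ℝ k (a t) p‖ * B (i - k) p) l (𝓝 0) := by
    have : Tendsto (fun t => ∑ k ∈ Finset.range (i + 1),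
      (i.choose k : ℝ) * ‖iteratedFDeriv ℝ k (a t) p‖ * B (i - k) p) l
      (𝓝 (∑ k ∈ Finset.range (i + 1), (i.choose k : ℝ) * ‖(0 : V [×k]→L[ℝ] ℂ)‖ * B (i - k) p)) :=
      tendsto_finsetSum _ fun k _ => ((ha k p).norm.const_mul _).mul_const _
    simpa using this
  refine squeeze_zero' (Eventually.of_forall fun _ => norm_nonneg _) ?_ h3
  filter_upwards [h2] with t h
  refine (norm_iteratedFDeriv_mul_le (ha' t) (hb' t) p (n := i)
    (by exact_mod_cast le_top)).trans ?_
  refine Finset.sum_le_sum fun k hk => ?_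
  gcongr
  exact h k hk

theorem Null.mul_bdd {l : Filter T} {wt : T → V → ℝ} {a b : T → V → ℂ} (ha : Null l a)
    (ha' : ∀ t, ContDiff ℝ ∞ (a t)) (hb : Bdd l wt b)
    (hwt : ∀ p, ∃ C : ℝ, ∀ᶠ t in l, wt t p ≤ C) :
    Null l (fun t p => a t p * b t p) := by
  refine ha.mul ha' hb.1 fun i p => ?_
  obtain ⟨C, h0, hC⟩ := hb.2 i
  obtain ⟨D, hD⟩ := hwt p
  refine ⟨C * D, ?_⟩
  filter_upwards [hC, hD] with t h1 h2
  exact (h1 p).trans (mul_le_mul_of_nonneg_left h2 h0)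

theorem Null.mul_const {l : Filter T} {a : T → V → ℂ} {b : V → ℂ} (ha : Null l a)
    (ha' : ∀ t, ContDiff ℝ ∞ (a t)) (hb : ContDiff ℝ ∞ b) :
    Null l (fun t p => a t p * b p) :=
  ha.mul ha' (fun _ => hb) fun _ _ => ⟨_, Eventually.of_forall fun _ => le_rfl⟩

theorem Null.fderiv_apply {l : Filter T} {a : T → V → F} (ha : Null l a)
    (ha' : ∀ t, ContDiff ℝ ∞ (a t)) (v : V) : Null l (fun t p => fderiv ℝ (a t) p v) := by
  intro i p
  rw [tendsto_zero_iff_norm_tendsto_zero]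
  have h := (ha (i + 1) p).norm.const_mul ‖v‖
  rw [norm_zero, mul_zero] at h
  exact squeeze_zero (fun _ => norm_nonneg _)
    (fun t => norm_iteratedFDeriv_fderiv_apply_le (ha' t) i v p) h

/-- Order zero is continuity of `f`; by the chain rule a derivative of order `i > 0` carries a
factor `‖B t‖ ^ i`, which vanishes in the limit. This serves both for cut-offs `χ(εp)` and for `F(Z
+ ΘX)` as `Θ → 0`. -/
theorem null_comp_affine_sub_const {l : Filter T} {f : V → ℂ} (hf : ContDiff ℝ ∞ f) {z : T → V}
    {z₀ : V} (hz : Tendsto z l (𝓝 z₀)) {B : T → W →L[ℝ] V} (hB : Tendsto B l (𝓝 0)) :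
    Null l (fun t p => f (z t + B t p) - f z₀) := by
  intro i p
  have hBp : Tendsto (fun t => z t + B t p) l (𝓝 z₀) := by
    have h := hz.add (((ContinuousLinearMap.apply ℝ V p).continuous.tendsto 0).comp hB)
    simpa using h
  rw [tendsto_zero_iff_norm_tendsto_zero]
  rcases i with _ | i
  · simp only [norm_iteratedFDeriv_zero]
    rw [← tendsto_iff_norm_sub_tendsto_zero]
    exact (hf.continuous.tendsto _).comp hBp
  · have h1 : Tendsto (fun t => ‖iteratedFDeriv ℝ (i + 1) f (z t + B t p)‖ * ‖B t‖ ^ (i + 1)) l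
        (𝓝 0) := by
      have h2 := (((hf.continuous_iteratedFDeriv (m := i + 1)
        (by exact_mod_cast le_top)).tendsto z₀).comp hBp).norm
      have h3 := h2.mul (hB.norm.pow (i + 1))
      simpa using h3
    refine squeeze_zero (fun _ => norm_nonneg _) (fun t => ?_) h1
    have h2 : iteratedFDeriv ℝ (i + 1) (fun p => f (z t + B t p) - f z₀) p =
        iteratedFDeriv ℝ (i + 1) (fun p => f (z t + B t p)) p := by
      have := iteratedFDeriv_sub_apply (𝕜 := ℝ) (i := i + 1) (x := p)
        (f := fun p => f (z t + B t p)) (g := fun _ => f z₀)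
        ((contDiff_comp_affine hf _ _).contDiffAt.of_le (by exact_mod_cast le_top))
        contDiffAt_const
      rw [iteratedFDeriv_const_of_ne (by simp), Pi.zero_apply, sub_zero] at this
      exact this
    rw [h2]
    exact norm_iteratedFDeriv_comp_affine_le hf _ _ _ _

theorem null_comp_translate_sub {l : Filter T} {f : V → ℂ} (hf : ContDiff ℝ ∞ f) {z : T → V}
    {z₀ : V} (hz : Tendsto z l (𝓝 z₀)) (B : W →L[ℝ] V) :
    Null l (fun t p => f (z t + B p) - f (z₀ + B p)) := by
  intro i p
  have h1 : Tendsto (fun t => ‖iteratedFDeriv ℝ i f (z t + B p) - iteratedFDeriv ℝ i f (z₀ + B p)‖ *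
      ‖B‖ ^ i) l (𝓝 0) := by
    have h2 := ((hf.continuous_iteratedFDeriv (m := i) (by exact_mod_cast le_top)).tendsto
      (z₀ + B p)).comp (hz.add_const (B p))
    rw [tendsto_iff_norm_sub_tendsto_zero] at h2
    simpa using h2.mul_const (‖B‖ ^ i)
  rw [tendsto_zero_iff_norm_tendsto_zero]
  refine squeeze_zero (fun _ => norm_nonneg _) (fun t => ?_) h1
  have h2 := iteratedFDeriv_sub_apply (𝕜 := ℝ) (i := i) (x := p)
        (f := fun p => f (z t + B p)) (g := fun p => f (z₀ + B p))
        ((contDiff_comp_affine hf _ _).contDiffAt.of_le (by exact_mod_cast le_top))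
        ((contDiff_comp_affine hf _ _).contDiffAt.of_le (by exact_mod_cast le_top))
  rw [iteratedFDeriv_comp_affine hf, iteratedFDeriv_comp_affine hf] at h2
  change ‖iteratedFDeriv ℝ i ((fun p => f (z t + B p)) - fun p => f (z₀ + B p)) p‖ ≤ _
  rw [h2]
  have h3 := (iteratedFDeriv ℝ i f (z t + B p) -
    iteratedFDeriv ℝ i f (z₀ + B p)).norm_compContinuousLinearMap_le fun _ : Fin i => B
  rw [Finset.prod_const, Finset.card_univ, Fintype.card_fin] at h3
  exact h3

/-- The higher derivatives are controlled by those of the partial derivatives. -/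
theorem norm_iteratedFDeriv_succ_le_sum {ι : Type*} [Fintype ι] [FiniteDimensional ℝ V]
    (b : Module.Basis ι ℝ V) {f : V → F} (hf : ContDiff ℝ ∞ f) (i : ℕ) (p : V) :
    ‖iteratedFDeriv ℝ (i + 1) f p‖ ≤
      ∑ j, ‖(b.coord j).toContinuousLinearMap‖ *
        ‖iteratedFDeriv ℝ i (fun q => fderiv ℝ f q (b j)) p‖ := by
  -- The derivative is the sum of the partial derivatives tensored with the dual basis, so bounds on
  -- partial derivatives suffice in the inductions below.
  have e : fderiv ℝ f = fun q => ∑ j, ContinuousLinearMap.smulRightL ℝ V F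
      (b.coord j).toContinuousLinearMap (fderiv ℝ f q (b j)) := by
    funext q
    ext v
    have h := congrArg (fderiv ℝ f q) (b.sum_repr v)
    rw [map_sum] at h
    simp only [map_smul] at h
    simp [← h]
  rw [← norm_iteratedFDeriv_fderiv, congrArg (fun g => iteratedFDeriv ℝ i g p) e,
    iteratedFDeriv_sum]
  · rw [Finset.sum_apply]
    refine (norm_sum_le _ _).trans (Finset.sum_le_sum fun j _ => ?_)
    refine (ContinuousLinearMap.norm_iteratedFDeriv_comp_left (𝕜 := ℝ) (n := i) (N := ∞) _
      (f := fun q => fderiv ℝ f q (b j)) (x := p)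
      (contDiff_fderiv_apply hf _).contDiffAt (by exact_mod_cast le_top)).trans ?_
    gcongr
    refine ContinuousLinearMap.opNorm_le_bound _ (norm_nonneg _) fun c => ?_
    simp
  · exact fun j _ => (ContinuousLinearMap.contDiff _).comp
      ((contDiff_fderiv_apply hf _).of_le (by exact_mod_cast le_top))

end Amplitudes

end

section

/-! ### Finite sums, linear forms and Schwartz cut-offs as amplitudes. -/

section MoreAmplitudes

variable {V F T : Type*} [NormedAddCommGroup V] [NormedSpace ℝ V]
  [NormedAddCommGroup F] [NormedSpace ℝ F]

theorem Bdd.zero (l : Filter T) (wt : T → V → ℝ) : Bdd l wt (fun _ _ => (0 : F)) :=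
  ⟨fun _ => contDiff_const, fun i => ⟨0, le_rfl, Eventually.of_forall fun t p => by
    simp⟩⟩

theorem Bdd.sum {ι : Type*} (s : Finset ι) {l : Filter T} {wt : T → V → ℝ} {a : ι → T → V → F}
    (h : ∀ j, Bdd l wt (a j)) : Bdd l wt (fun t p => ∑ j ∈ s, a j t p) := by
  classical
  induction s using Finset.induction_on with
  | empty => simpa using Bdd.zero l wt
  | insert j s hj ih =>
    simp_rw [Finset.sum_insert hj]
    exact (h j).add ih

theorem Null.sum {ι : Type*} (s : Finset ι) {l : Filter T} {a : ι → T → V → F}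
    (h : ∀ j, Null l (a j)) (h' : ∀ j t, ContDiff ℝ ∞ (a j t)) :
    Null l (fun t p => ∑ j ∈ s, a j t p) := by
  intro i p
  have h1 : Tendsto (fun t => ∑ j ∈ s, iteratedFDeriv ℝ i (a j t) p) l
      (𝓝 (∑ j ∈ s, (0 : V [×i]→L[ℝ] F))) := tendsto_finsetSum _ fun j _ => h j i p
  rw [Finset.sum_const_zero] at h1
  refine h1.congr fun t => ?_
  rw [iteratedFDeriv_sum fun j _ => (h' j t).of_le (by exact_mod_cast le_top), Finset.sum_apply]

theorem sym_clm (A : V →L[ℝ] F) : Sym (fun p => 1 + ‖p‖) (fun p => A p) := by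
  refine ⟨A.contDiff, fun i => ⟨‖A‖, norm_nonneg _, fun p => ?_⟩⟩
  rcases i with _ | _ | i
  · rw [norm_iteratedFDeriv_zero]
    refine (A.le_opNorm p).trans ?_
    gcongr
    linarith
  · rw [norm_iteratedFDeriv_one, A.fderiv]
    nlinarith [norm_nonneg A, norm_nonneg p]
  · have e : fderiv ℝ (fun p => A p) = fun _ => A := by
      funext q
      exact A.fderiv
    rw [← norm_iteratedFDeriv_fderiv, e, iteratedFDeriv_const_of_ne (by simp)]
    simp only [Pi.zero_apply, norm_zero]
    positivity

theorem sym_const (c : F) : Sym (fun _ : V => (1 : ℝ)) (fun _ => c) := by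
  refine ⟨contDiff_const, fun i => ⟨‖c‖, norm_nonneg _, fun p => ?_⟩⟩
  rcases i with _ | i
  · simp
  · rw [iteratedFDeriv_const_of_ne (by simp)]
    simp

theorem sym_schwartz (χ : 𝓢(V, ℂ)) (s : ℝ) : Sym (fun p => (1 + ‖p‖) ^ s) χ := by
  obtain ⟨k, hk⟩ := exists_nat_ge (-s)
  refine ⟨χ.smooth _, fun i => ?_⟩
  set C := 2 ^ k * ((Finset.Iic (k, i)).sup fun m => SchwartzMap.seminorm ℝ m.1 m.2) χ
  refine ⟨C, by positivity, fun p => ?_⟩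
  have h := χ.one_add_le_sup_seminorm_apply (𝕜 := ℝ) (m := (k, i)) le_rfl le_rfl p
  have h1 : (1 : ℝ) ≤ 1 + ‖p‖ := by linarith [norm_nonneg p]
  have h2 : ((1 + ‖p‖) ^ k)⁻¹ ≤ (1 + ‖p‖) ^ s := by
    rw [← Real.rpow_natCast, ← Real.rpow_neg (by positivity)]
    exact Real.rpow_le_rpow_of_exponent_le h1 (by linarith)
  have h3 : 0 < (1 + ‖p‖) ^ k := by positivity
  calc _ = ((1 + ‖p‖) ^ k)⁻¹ * ((1 + ‖p‖) ^ k * ‖iteratedFDeriv ℝ i χ p‖) := by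
        field_simp
    _ ≤ (1 + ‖p‖) ^ s * C := by gcongr
    _ = _ := by ring

theorem sym_of_growth_le {a : V → F} {m m' : ℝ} (h : Sym (fun p => (1 + ‖p‖) ^ m) a)
    (hm : m ≤ m') : Sym (fun p => (1 + ‖p‖) ^ m') a := by
  refine h.mono 1 (fun p => ?_) zero_le_one
  rw [one_mul]
  exact Real.rpow_le_rpow_of_exponent_le (by linarith [norm_nonneg p]) hm

/-- A cut-off function with `χ(0) = 1`. -/
theorem exists_schwartz_cutoff [FiniteDimensional ℝ V] : ∃ χ : 𝓢(V, ℂ), χ 0 = 1 := by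
  let f : ContDiffBump (0 : V) := ⟨1, 2, one_pos, one_lt_two⟩
  have h1 : HasCompactSupport (fun p => ((f p : ℝ) : ℂ)) :=
    f.hasCompactSupport.comp_left (g := fun x : ℝ => (x : ℂ)) (by simp)
  have h2 : ContDiff ℝ ∞ (fun p => ((f p : ℝ) : ℂ)) := Complex.ofRealCLM.contDiff.comp f.contDiff
  refine ⟨h1.toSchwartzMap h2, ?_⟩
  have h3 : f 0 = 1 := f.one_of_mem_closedBall (by simp [f])
  simp [h3]

/-- An exponent of decay which ensures integrability. -/
def decay (V : Type*) [NormedAddCommGroup V] [NormedSpace ℝ V] : ℝ := Module.finrank ℝ V + 1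

/-- Here `k` will count applications of `Phase.L`, each of which lowers the order by one. -/
theorem exists_order (V : Type*) [NormedAddCommGroup V] [NormedSpace ℝ V] (m : ℝ) :
    ∃ k : ℕ, m - k ≤ -decay V := by
  obtain ⟨k, hk⟩ := exists_nat_ge (m + decay V)
  exact ⟨k, by linarith⟩

theorem one_add_norm_smul_rpow_le {ε : ℝ} (hε : 0 < ε) (s : ℝ)
    (hs : s ≤ 0) : ∃ C : ℝ, 0 ≤ C ∧ ∀ p : V, (1 + ‖ε • p‖) ^ s ≤ C * (1 + ‖p‖) ^ s := by
  refine ⟨(min 1 ε) ^ s, by positivity, fun p => ?_⟩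
  have hm : 0 < min 1 ε := lt_min one_pos hε
  rw [← Real.mul_rpow hm.le (by positivity)]
  refine Real.rpow_le_rpow_of_nonpos (by positivity) ?_ hs
  rw [norm_smul, Real.norm_of_nonneg hε.le]
  nlinarith [min_le_left 1 ε, min_le_right 1 ε, norm_nonneg p]

theorem sym_cutoff (χ : 𝓢(V, ℂ)) {ε : ℝ} (hε : 0 < ε) (s : ℝ) :
    Sym (fun p => (1 + ‖p‖) ^ s) (fun p => χ (ε • p)) := by
  -- The scaling estimate needs a nonpositive exponent, hence `min s 0`.
  obtain ⟨C, h0, hC⟩ := one_add_norm_smul_rpow_le (V := V) hε (min s 0) (min_le_right _ _)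
  have h1 := (sym_schwartz χ (min s 0)).comp_affine 0 (ε • ContinuousLinearMap.id ℝ V)
  have e1 : ∀ p : V, 0 + (ε • ContinuousLinearMap.id ℝ V) p = ε • p := fun p => by simp
  simp only [e1] at h1
  exact sym_of_growth_le (h1.mono C hC h0) (min_le_left _ _)

/-- For fixed `ε` the cut-off has every order of decay, but with constants depending on `ε`. Order
zero is what holds uniformly: each derivative only brings a factor `ε < 1`. -/
theorem bdd_cutoff (χ : 𝓢(V, ℂ)) :
    Bdd (𝓝[>] (0 : ℝ)) (fun _ _ => 1) (fun ε p => χ (ε • p)) := by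
  have h0 : Sym (fun _ : V => (1 : ℝ)) χ := by simpa using sym_schwartz χ 0
  have h1 := (h0.bdd (𝓝[>] (0 : ℝ))).comp_affine tendsto_id (fun _ => 0)
    (fun ε => ε • ContinuousLinearMap.id ℝ V) (M := 1) (by
      filter_upwards [Ioo_mem_nhdsGT (zero_lt_one (α := ℝ))] with ε hε
      refine ContinuousLinearMap.opNorm_le_bound _ zero_le_one fun p => ?_
      rw [smul_apply, ContinuousLinearMap.id_apply, norm_smul,
        Real.norm_of_nonneg hε.1.le]
      exact mul_le_mul_of_nonneg_right hε.2.le (norm_nonneg _))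
  simpa using h1

theorem null_cutoff (χ : 𝓢(V, ℂ)) (hχ : χ 0 = 1) :
    Null (𝓝[>] (0 : ℝ)) (fun ε p => χ (ε • p) - 1) := by
  have h1 := null_comp_affine_sub_const (W := V) (l := 𝓝[>] (0 : ℝ)) (χ.smooth _)
    (z := fun _ => 0) (z₀ := 0) tendsto_const_nhds
    (B := fun ε : ℝ => ε • ContinuousLinearMap.id ℝ V) (by
      have : Tendsto (fun ε : ℝ => ε • ContinuousLinearMap.id ℝ V) (𝓝 0)
        (𝓝 ((0 : ℝ) • ContinuousLinearMap.id ℝ V)) := tendsto_id.smul_const _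
      rw [zero_smul] at this
      exact this.mono_left nhdsWithin_le_nhds)
  simpa [hχ] using h1

theorem sym_cutoff_mul {m : ℝ} {a : V → ℂ}
    (h : Sym (fun p => (1 + ‖p‖) ^ m) a) (χ : 𝓢(V, ℂ)) {ε : ℝ} (hε : 0 < ε) (s : ℝ) :
    Sym (fun p => (1 + ‖p‖) ^ s) (fun p => χ (ε • p) * a p) := by
  have h1 := (sym_cutoff χ hε (s - m)).mul h
  have e1 : ∀ p : V, (1 + ‖p‖) ^ (s - m) * (1 + ‖p‖) ^ m = (1 + ‖p‖) ^ s := fun p => by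
    rw [← Real.rpow_add (by positivity), sub_add_cancel]
  simpa only [e1] using h1

end MoreAmplitudes

/-! ### Quadratic phases and the regularizing operator -/

/-- A nondegenerate phase function: along the vectors `b j` its derivatives are linear forms
without common zeros. -/
structure Phase (V : Type*) [NormedAddCommGroup V] [NormedSpace ℝ V] where
  /-- the phase function -/
  φ : V → ℝ
  /-- the index set of the directions -/
  J : Type
  [fintypeJ : Fintype J]
  /-- the directions -/
  b : J → V
  /-- the directional derivatives of the phase function -/
  ℓ : J → V →L[ℝ] ℝ
  /-- the constant of nondegeneracy -/
  c : ℝ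
  contDiff : ContDiff ℝ ∞ φ
  fderiv_eq : ∀ j p, fderiv ℝ φ p (b j) = ℓ j p
  c_pos : 0 < c
  coercive : ∀ p, c * ‖p‖ ^ 2 ≤ ∑ j, (ℓ j p) ^ 2

attribute [instance] Phase.fintypeJ

namespace Phase

variable {V T : Type*} [NormedAddCommGroup V] [NormedSpace ℝ V] (P : Phase V)

/-- The function `1 / (1 + ∑ j, (∂_j φ)²)`. -/
def r (p : V) : ℝ := (1 + ∑ j, (P.ℓ j p) ^ 2)⁻¹

theorem den_pos (p : V) : 0 < 1 + ∑ j, (P.ℓ j p) ^ 2 := by positivity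

theorem contDiff_r : ContDiff ℝ ∞ P.r := by
  unfold r
  refine ContDiff.inv ?_ fun p => (P.den_pos p).ne'
  exact contDiff_const.add (ContDiff.sum fun j _ => (P.ℓ j).contDiff.pow 2)

theorem r_nonneg (p : V) : 0 ≤ P.r p := (inv_pos.2 (P.den_pos p)).le

/-- The constant comes from `(1 + ‖p‖)² ≤ 2 (1 + ‖p‖²)` and, by coercivity, `1 + ‖p‖² ≤ (1 + 1/c) (1
+ ∑ ℓ_j²)`. -/
theorem r_le (p : V) : P.r p ≤ 2 * (1 + 1 / P.c) * ((1 + ‖p‖) ^ 2)⁻¹ := by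
  have h1 := P.coercive p
  have hc := P.c_pos
  have h2 : ‖p‖ ^ 2 ≤ 1 / P.c * ∑ j, (P.ℓ j p) ^ 2 := by
    rw [div_mul_eq_mul_div, one_mul, le_div_iff₀ hc]
    linarith
  have h3 : 0 ≤ ∑ j, (P.ℓ j p) ^ 2 := by positivity
  have h4 : 0 < 1 / P.c := by positivity
  unfold r
  rw [← div_eq_mul_inv, inv_eq_one_div, div_le_div_iff₀ (P.den_pos p) (by positivity), one_mul]
  nlinarith [sq_nonneg (‖p‖ - 1)]

theorem fderiv_r (p : V) : fderiv ℝ P.r p =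
    (-(P.r p * P.r p)) • (∑ j, (2 : ℝ) • (P.ℓ j).smulRight (P.ℓ j)) p := by
  have h1 : HasFDerivAt (fun p => 1 + ∑ j, (P.ℓ j p) ^ 2)
      ((∑ j, (2 : ℝ) • (P.ℓ j).smulRight (P.ℓ j)) p) p := by
    have h2 := (HasFDerivAt.fun_sum (u := Finset.univ) fun j _ =>
      ((P.ℓ j).hasFDerivAt (x := p)).pow 2).const_add (1 : ℝ)
    refine h2.congr_fderiv ?_
    ext v
    simp
    exact Finset.sum_congr rfl fun j _ => by ring
  have h3 := (hasDerivAt_inv (P.den_pos p).ne').comp_hasFDerivAt p h1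
  rw [show P.r = Inv.inv ∘ fun p => 1 + ∑ j, (P.ℓ j p) ^ 2 from rfl, h3.fderiv]
  congr 1
  simp only [Function.comp_apply]
  rw [← mul_inv, sq]

/-- Induction on the order, from `r' = -r² · (linear form)`: the weights combine to `(1 + ‖p‖)^(-4)
(1 + ‖p‖)`, which is below `(1 + ‖p‖)^(-2)`. -/
theorem sym_r : Sym (fun p => ((1 + ‖p‖) ^ 2)⁻¹) P.r := by
  refine ⟨P.contDiff_r, fun i => ?_⟩
  induction i using Nat.strong_induction_on with
  | _ i ih =>
  rcases i with _ | i
  · have := P.c_pos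
    refine ⟨2 * (1 + 1 / P.c), by positivity, fun p => ?_⟩
    rw [norm_iteratedFDeriv_zero, Real.norm_of_nonneg (P.r_nonneg p)]
    exact P.r_le p
  · choose! C hC0 hC using ih
    obtain ⟨D, hD⟩ : ∃ D : ℕ → ℝ, ∀ k, 0 ≤ D k ∧ ∀ p : V,
        ‖iteratedFDeriv ℝ k (fun p => (∑ j, (2 : ℝ) • (P.ℓ j).smulRight (P.ℓ j)) p) p‖ ≤
          D k * (1 + ‖p‖) := by
      have := (sym_clm (∑ j, (2 : ℝ) • (P.ℓ j).smulRight (P.ℓ j))).2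
      choose D h0 hD using this
      exact ⟨D, fun k => ⟨h0 k, hD k⟩⟩
    -- The Leibniz constant for the derivatives of `r²` of order at most `i`.
    let E : ℕ → ℝ := fun k => ∑ l ∈ Finset.range (k + 1), (k.choose l : ℝ) * C l * C (k - l)
    have hE0 : ∀ k ≤ i, 0 ≤ E k := fun k hk => Finset.sum_nonneg fun l hl => by
      have h1 := hC0 l (by simp at hl; omega)
      have h2 := hC0 (k - l) (by omega)
      positivity
    have hE : ∀ k ≤ i, ∀ p, ‖iteratedFDeriv ℝ k (fun p => -(P.r p * P.r p)) p‖ ≤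
        E k * (((1 + ‖p‖) ^ 2)⁻¹ * ((1 + ‖p‖) ^ 2)⁻¹) := by
      intro k hk p
      have e : (fun p => -(P.r p * P.r p)) = -(fun p => P.r p * P.r p) := rfl
      rw [e, iteratedFDeriv_neg, Pi.neg_apply, norm_neg]
      refine (norm_iteratedFDeriv_mul_le P.contDiff_r P.contDiff_r p (n := k)
        (by exact_mod_cast le_top)).trans ?_
      rw [Finset.sum_mul]
      refine Finset.sum_le_sum fun l hl => ?_
      have h1 := hC l (by simp at hl; omega) p
      have h2 := hC (k - l) (by omega) p
      calc _ = (k.choose l : ℝ) * (‖iteratedFDeriv ℝ l P.r p‖ * ‖iteratedFDeriv ℝ (k - l) P.r p‖) :=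
            by ring
        _ ≤ (k.choose l : ℝ) * ((C l * ((1 + ‖p‖) ^ 2)⁻¹) * (C (k - l) * ((1 + ‖p‖) ^ 2)⁻¹)) := by
            gcongr
            exact (norm_nonneg _).trans h1
        _ = _ := by ring
    refine ⟨∑ k ∈ Finset.range (i + 1), (i.choose k : ℝ) * E k * D (i - k),
      Finset.sum_nonneg fun k hk => by
        have := hE0 k (by simp at hk; omega); have := (hD (i - k)).1; positivity, fun p => ?_⟩
    rw [← norm_iteratedFDeriv_fderiv, show fderiv ℝ P.r = _ from funext P.fderiv_r]
    refine (norm_iteratedFDeriv_smul_le (N := ∞) (P.contDiff_r.mul P.contDiff_r).neg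
      (ContinuousLinearMap.contDiff _) p (n := i) (by exact_mod_cast le_top)).trans ?_
    rw [Finset.sum_mul]
    refine Finset.sum_le_sum fun k hk => ?_
    have hk' : k ≤ i := by simp at hk; omega
    have h1 := hE k hk' p
    have h2 := (hD (i - k)).2 p
    have h3 : ((1 + ‖p‖) ^ 2)⁻¹ * (1 + ‖p‖) ≤ 1 := by
      have : 0 < 1 + ‖p‖ := by positivity
      rw [inv_mul_le_iff₀ (by positivity)]
      nlinarith [norm_nonneg p]
    have h4 := hE0 k hk'
    have h5 := (hD (i - k)).1
    calc _ ≤ (i.choose k : ℝ) * (E k * (((1 + ‖p‖) ^ 2)⁻¹ * ((1 + ‖p‖) ^ 2)⁻¹)) *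
          (D (i - k) * (1 + ‖p‖)) := by gcongr
      _ = (i.choose k : ℝ) * E k * D (i - k) * (((1 + ‖p‖) ^ 2)⁻¹) *
          (((1 + ‖p‖) ^ 2)⁻¹ * (1 + ‖p‖)) := by ring
      _ ≤ (i.choose k : ℝ) * E k * D (i - k) * (((1 + ‖p‖) ^ 2)⁻¹) * 1 := by gcongr
      _ = _ := mul_one _

theorem sym_coeff_r : Sym (fun p => (1 + ‖p‖) ^ (-1 : ℝ)) (fun p => (P.r p : ℂ)) := by
  refine (P.sym_r.clm_comp Complex.ofRealCLM).mono 1 (fun p => ?_) zero_le_one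
  have h1 : (1 : ℝ) ≤ 1 + ‖p‖ := by linarith [norm_nonneg p]
  rw [Real.rpow_neg_one, one_mul]
  exact inv_anti₀ (by positivity) (by nlinarith)

/-- The linear form has order `1` and `r` has order `-2`; the resulting order `-1` is the gain of
one application of `L`. -/
theorem sym_coeff_w (j : P.J) :
    Sym (fun p => (1 + ‖p‖) ^ (-1 : ℝ)) (fun p => (P.ℓ j p : ℂ) * (P.r p : ℂ)) := by
  refine (((sym_clm (P.ℓ j)).clm_comp Complex.ofRealCLM).mul
    (P.sym_r.clm_comp Complex.ofRealCLM)).mono 1 (fun p => ?_) zero_le_one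
  have h1 : (0 : ℝ) < 1 + ‖p‖ := by positivity
  rw [Real.rpow_neg_one, one_mul]
  apply le_of_eq
  field_simp

/-- The first order operator whose transpose leaves `exp(i φ)` invariant. -/
def L (a : V → ℂ) (p : V) : ℂ :=
  (P.r p : ℂ) * a p +
    Complex.I * ∑ j, fderiv ℝ (fun q => (P.ℓ j q : ℂ) * (P.r q : ℂ) * a q) p (P.b j)

/-- The gain comes only from the coefficients `r` and `ℓ_j r`. The derivatives of `a` need not decay
any faster than `a`, so no positive type `ρ` is required. -/
theorem bdd_L {l : Filter T} {wt : T → V → ℝ} {a : T → V → ℂ} (h : Bdd l wt a) :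
    Bdd l (fun t p => wt t p * (1 + ‖p‖) ^ (-1 : ℝ)) (fun t => P.L (a t)) := by
  have h1 := (P.sym_coeff_r.bdd l).mul h
  have h2 := fun j => (((P.sym_coeff_w j).bdd l).mul h).fderiv_apply (P.b j)
  simp_rw [mul_comm (wt _ _)]
  exact h1.add ((Bdd.sum Finset.univ h2).const_mul Complex.I)

theorem null_L {l : Filter T} {a : T → V → ℂ} (h : Null l a) (ha : ∀ t, ContDiff ℝ ∞ (a t)) :
    Null l (fun t => P.L (a t)) := by
  have h1 := h.mul_const ha P.sym_coeff_r.1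
  have h3 := fun j => (h.mul_const ha (P.sym_coeff_w j).1).fderiv_apply
    (fun t => (ha t).mul (P.sym_coeff_w j).1) (P.b j)
  have h4 := Null.sum Finset.univ h3
    fun j t => contDiff_fderiv_apply ((ha t).mul (P.sym_coeff_w j).1) _
  have h4' : ∀ t, ContDiff ℝ ∞ (fun p => ∑ j,
      fderiv ℝ (fun q => a t q * ((P.ℓ j q : ℂ) * (P.r q : ℂ))) p (P.b j)) := fun t =>
    ContDiff.sum fun j _ => contDiff_fderiv_apply ((ha t).mul (P.sym_coeff_w j).1) _
  have h5 := h4.mul_const h4' (contDiff_const (c := Complex.I))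
  have h6 := h1.add h5 (fun t => (ha t).mul P.sym_coeff_r.1)
    (fun t => (h4' t).mul contDiff_const)
  have e : (fun t => P.L (a t)) = fun t p => a t p * (P.r p : ℂ) + (∑ j,
      fderiv ℝ (fun q => a t q * ((P.ℓ j q : ℂ) * (P.r q : ℂ))) p (P.b j)) * Complex.I := by
    funext t p
    simp only [L]
    rw [mul_comm, mul_comm Complex.I]
    simp_rw [mul_comm _ (a t _)]
  rw [e]
  exact h6

theorem contDiff_L {a : V → ℂ} (ha : ContDiff ℝ ∞ a) : ContDiff ℝ ∞ (P.L a) :=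
  (P.sym_coeff_r.1.mul ha).add (contDiff_const.mul
    (ContDiff.sum fun j _ => contDiff_fderiv_apply ((P.sym_coeff_w j).1.mul ha) _))

theorem L_sub {a b : V → ℂ} (ha : ContDiff ℝ ∞ a) (hb : ContDiff ℝ ∞ b) :
    P.L (fun p => a p - b p) = fun p => P.L a p - P.L b p := by
  funext p
  have h : ∀ j, fderiv ℝ (fun q => (P.ℓ j q : ℂ) * (P.r q : ℂ) * (a q - b q)) p =
      fderiv ℝ (fun q => (P.ℓ j q : ℂ) * (P.r q : ℂ) * a q) p -
      fderiv ℝ (fun q => (P.ℓ j q : ℂ) * (P.r q : ℂ) * b q) p := by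
    intro j
    have h1 := (((P.sym_coeff_w j).1.mul ha).differentiable (by simp)) p
    have h2 := (((P.sym_coeff_w j).1.mul hb).differentiable (by simp)) p
    rw [← fderiv_sub h1 h2]
    congr 1
    funext q
    simp [mul_sub]
  simp only [L, h, sub_apply, Finset.sum_sub_distrib]
  ring

theorem contDiff_L_iterate {a : V → ℂ} (ha : ContDiff ℝ ∞ a) (k : ℕ) :
    ContDiff ℝ ∞ (P.L^[k] a) := by
  induction k with
  | zero => exact ha
  | succ k ih => rw [Function.iterate_succ_apply']; exact P.contDiff_L ih

theorem L_iterate_sub {a b : V → ℂ} (ha : ContDiff ℝ ∞ a) (hb : ContDiff ℝ ∞ b) (k : ℕ) :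
    P.L^[k] (fun p => a p - b p) = fun p => P.L^[k] a p - P.L^[k] b p := by
  induction k with
  | zero => rfl
  | succ k ih =>
    simp only [Function.iterate_succ_apply', ih]
    exact P.L_sub (P.contDiff_L_iterate ha k) (P.contDiff_L_iterate hb k)

theorem bdd_L_iterate {l : Filter T} {wt : T → V → ℝ} {a : T → V → ℂ} (h : Bdd l wt a) (k : ℕ) :
    Bdd l (fun t p => wt t p * (1 + ‖p‖) ^ (-(k : ℝ))) (fun t => P.L^[k] (a t)) := by
  induction k with
  | zero => simpa using h
  | succ k ih =>
    simp only [Function.iterate_succ_apply']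
    have h1 := P.bdd_L ih
    have e : ∀ p : V, (1 + ‖p‖) ^ (-((k + 1 : ℕ) : ℝ)) =
        (1 + ‖p‖) ^ (-(k : ℝ)) * (1 + ‖p‖) ^ (-1 : ℝ) := fun p => by
      rw [← Real.rpow_add (by positivity)]
      congr 1
      push_cast
      ring
    simpa only [e, mul_assoc] using h1

theorem null_L_iterate {l : Filter T} {a : T → V → ℂ} (h : Null l a)
    (ha : ∀ t, ContDiff ℝ ∞ (a t)) (k : ℕ) : Null l (fun t => P.L^[k] (a t)) := by
  induction k with
  | zero => simpa using h
  | succ k ih =>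
    simp only [Function.iterate_succ_apply']
    exact P.null_L ih fun t => P.contDiff_L_iterate (ha t) k

/-- The oscillating factor `exp(i φ)`. -/
def e (p : V) : ℂ := Complex.exp (Complex.I * P.φ p)

theorem norm_e (p : V) : ‖P.e p‖ = 1 := by
  rw [e, mul_comm]
  exact Complex.norm_exp_ofReal_mul_I _

theorem contDiff_e : ContDiff ℝ ∞ P.e :=
  (contDiff_const.mul (Complex.ofRealCLM.contDiff.comp P.contDiff)).cexp

theorem fderiv_e (j : P.J) (p : V) : fderiv ℝ P.e p (P.b j) = Complex.I * P.ℓ j p * P.e p := by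
  have h1 : HasFDerivAt P.φ (fderiv ℝ P.φ p) p :=
    ((P.contDiff.differentiable (by simp)) p).hasFDerivAt
  have h2 := ((Complex.ofRealCLM.hasFDerivAt.comp p h1).const_mul Complex.I).cexp
  have h3 : fderiv ℝ P.e p = _ := h2.fderiv
  rw [h3]
  simp [e, P.fderiv_eq]
  ring

theorem bdd_L_iterate_decay {l : Filter T} {κ : T → ℝ} {m : ℝ} {a : T → V → ℂ}
    (h : Bdd l (fun t p => κ t * (1 + ‖p‖) ^ m) a) (hκ : ∀ t, 0 ≤ κ t) {k : ℕ}
    (hk : m - k ≤ -decay V) :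
    Bdd l (fun t p => κ t * (1 + ‖p‖) ^ (-decay V)) (fun t => P.L^[k] (a t)) := by
  refine (P.bdd_L_iterate h k).mono 1 (Eventually.of_forall fun t p => ?_) zero_le_one
  rw [one_mul, mul_assoc, ← Real.rpow_add (by positivity)]
  exact mul_le_mul_of_nonneg_left (Real.rpow_le_rpow_of_exponent_le
    (by linarith [norm_nonneg p]) (by linarith)) (hκ t)

theorem sym_L_iterate_decay {m : ℝ} {a : V → ℂ} (h : Sym (fun p => (1 + ‖p‖) ^ m) a) {k : ℕ}
    (hk : m - k ≤ -decay V) : Sym (fun p => (1 + ‖p‖) ^ (-decay V)) (P.L^[k] a) := by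
  have := (P.bdd_L_iterate_decay (κ := fun _ => 1) (by simpa using h.bdd (⊤ : Filter Unit))
    (fun _ => zero_le_one) hk)
  simp only [one_mul] at this
  exact this.sym

end Phase

end

section

/-! ### Oscillatory integrals -/

section Osc

variable {V T : Type*} [NormedAddCommGroup V] [NormedSpace ℝ V] [MeasureSpace V]

/-- The oscillatory integral of the amplitude `a` with the phase `φ` exists and has value `c`. -/
def HasOsc (φ : V → ℝ) (a : V → ℂ) (c : ℂ) : Prop :=
  ∀ χ : 𝓢(V, ℂ), χ 0 = 1 →
    (∀ ε : ℝ, 0 < ε → Integrable (fun p => χ (ε • p) * a p * Complex.exp (Complex.I * φ p))) ∧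
      Tendsto (fun ε : ℝ => ∫ p, χ (ε • p) * a p * Complex.exp (Complex.I * φ p))
        (𝓝[>] 0) (𝓝 c)

theorem HasOsc.const_mul {φ : V → ℝ} {a : V → ℂ} {c : ℂ} (h : HasOsc φ a c) (k : ℂ) :
    HasOsc φ (fun p => k * a p) (k * c) := by
  intro χ hχ
  obtain ⟨h1, h2⟩ := h χ hχ
  have e : ∀ (ε : ℝ) (p : V), χ (ε • p) * (k * a p) * Complex.exp (Complex.I * φ p) =
      k * (χ (ε • p) * a p * Complex.exp (Complex.I * φ p)) := fun _ _ => by ring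
  refine ⟨fun ε hε => ?_, ?_⟩
  · simp_rw [e]
    exact (h1 ε hε).const_mul k
  · simp_rw [e, integral_const_mul]
    exact h2.const_mul k

theorem HasOsc.add {φ : V → ℝ} {a b : V → ℂ} {c d : ℂ} (ha : HasOsc φ a c) (hb : HasOsc φ b d) :
    HasOsc φ (fun p => a p + b p) (c + d) := by
  intro χ hχ
  obtain ⟨h1, h2⟩ := ha χ hχ
  obtain ⟨h3, h4⟩ := hb χ hχ
  have e : ∀ (ε : ℝ) (p : V), χ (ε • p) * (a p + b p) * Complex.exp (Complex.I * φ p) =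
      χ (ε • p) * a p * Complex.exp (Complex.I * φ p) +
      χ (ε • p) * b p * Complex.exp (Complex.I * φ p) := fun _ _ => by ring
  refine ⟨fun ε hε => ?_, (h2.add h4).congr' ?_⟩
  · simp_rw [e]
    exact (h1 ε hε).add (h3 ε hε)
  · filter_upwards [self_mem_nhdsWithin] with ε hε
    simp_rw [e]
    exact (integral_add (h1 ε hε) (h3 ε hε)).symm

theorem HasOsc.sub {φ : V → ℝ} {a b : V → ℂ} {c d : ℂ} (ha : HasOsc φ a c) (hb : HasOsc φ b d) :
    HasOsc φ (fun p => a p - b p) (c - d) := by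
  have := ha.add (hb.const_mul (-1))
  simpa [sub_eq_add_neg] using this

variable [FiniteDimensional ℝ V]

theorem HasOsc.unique {φ : V → ℝ} {a : V → ℂ} {c d : ℂ} (h : HasOsc φ a c)
    (h' : HasOsc φ a d) : c = d := by
  obtain ⟨χ, hχ⟩ := exists_schwartz_cutoff (V := V)
  exact tendsto_nhds_unique (h χ hχ).2 (h' χ hχ).2

open Classical in
/-- The value of the oscillatory integral. -/
def osc (φ : V → ℝ) (a : V → ℂ) : ℂ := if h : ∃ c, HasOsc φ a c then h.choose else 0

theorem HasOsc.osc_eq {φ : V → ℝ} {a : V → ℂ} {c : ℂ} (h : HasOsc φ a c) : osc φ a = c := by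
  have h' : ∃ c, HasOsc φ a c := ⟨c, h⟩
  rw [osc, dif_pos h']
  exact h'.choose_spec.unique h

variable [BorelSpace V] [(volume : Measure V).IsAddHaarMeasure]

variable (V) in
theorem integrable_decay : Integrable (fun p : V => (1 + ‖p‖) ^ (-decay V)) :=
  integrable_one_add_norm (by unfold decay; linarith)

namespace Phase

variable (P : Phase V)

theorem integrable_mul_e {a : V → ℂ} (h : Sym (fun p => (1 + ‖p‖) ^ (-decay V)) a) :
    Integrable (fun p => a p * P.e p) := by
  obtain ⟨C, h0, hC⟩ := h.bound
  refine ((integrable_decay V).const_mul C).mono'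
    (h.continuous.mul P.contDiff_e.continuous).aestronglyMeasurable (ae_of_all _ fun p => ?_)
  rw [norm_mul, norm_e, mul_one]
  exact hC p

/-- Since `∂_j e = i ℓ_j e` and `r (1 + ∑ ℓ_j²) = 1`, the operator `r (1 - i ∑ ℓ_j ∂_j)` fixes `e`;
`L` is its transpose. -/
theorem integral_mul_e_eq_integral_L {a : V → ℂ} (h : Sym (fun p => (1 + ‖p‖) ^ (-decay V)) a) :
    ∫ p, a p * P.e p = ∫ p, P.L a p * P.e p := by
  have hw : ∀ j, Sym (fun p => (1 + ‖p‖) ^ (-decay V))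
      (fun q => (P.ℓ j q : ℂ) * (P.r q : ℂ) * a q) := fun j => by
    refine ((P.sym_coeff_w j).mul h).mono 1 (fun p => ?_) zero_le_one
    rw [one_mul]
    refine mul_le_of_le_one_left (by positivity) ?_
    exact Real.rpow_le_one_of_one_le_of_nonpos (by linarith [norm_nonneg p]) (by norm_num)
  -- Integration by parts also needs integrability of the term in which the derivative falls on `e`.
  -- This produces `ℓ_j² r`, a coefficient of order `0`.
  have hwl : ∀ j, Sym (fun p => (1 + ‖p‖) ^ (-decay V))
      (fun q => (P.ℓ j q : ℂ) * (P.r q : ℂ) * a q * P.ℓ j q) := fun j => by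
    have h1 := ((P.sym_coeff_w j).mul ((sym_clm (P.ℓ j)).clm_comp Complex.ofRealCLM)).mul h
    have e1 : ∀ p : V, (1 + ‖p‖) ^ (-1 : ℝ) * (1 + ‖p‖) * (1 + ‖p‖) ^ (-decay V) =
        (1 + ‖p‖) ^ (-decay V) := fun p => by
      have : 0 < 1 + ‖p‖ := by positivity
      rw [Real.rpow_neg_one, inv_mul_cancel₀ this.ne', one_mul]
    simp only [e1] at h1
    convert h1 using 2
    simp only [Complex.ofRealCLM_apply]
    ring
  have hr : Sym (fun p => (1 + ‖p‖) ^ (-decay V)) (fun q => (P.r q : ℂ) * a q) := by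
    refine (P.sym_coeff_r.mul h).mono 1 (fun p => ?_) zero_le_one
    rw [one_mul]
    refine mul_le_of_le_one_left (by positivity) ?_
    exact Real.rpow_le_one_of_one_le_of_nonpos (by linarith [norm_nonneg p]) (by norm_num)
  have ibp : ∀ j, ∫ p, fderiv ℝ (fun q => (P.ℓ j q : ℂ) * (P.r q : ℂ) * a q) p (P.b j) * P.e p =
      -(Complex.I * ∫ p, (P.ℓ j p : ℂ) * (P.r p : ℂ) * a p * P.ℓ j p * P.e p) := by
    intro j
    have e1 : ∀ p, (P.ℓ j p : ℂ) * (P.r p : ℂ) * a p * fderiv ℝ P.e p (P.b j) =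
        Complex.I * ((P.ℓ j p : ℂ) * (P.r p : ℂ) * a p * P.ℓ j p * P.e p) := fun p => by
      rw [fderiv_e]
      ring
    have h1 := integral_mul_fderiv_eq_neg_fderiv_mul_of_integrable (μ := (volume : Measure V))
      (f := fun q => (P.ℓ j q : ℂ) * (P.r q : ℂ) * a q) (g := P.e) (v := P.b j)
      (P.integrable_mul_e ((hw j).fderiv_apply _))
      (by simp_rw [e1]; exact (P.integrable_mul_e (hwl j)).const_mul _)
      (P.integrable_mul_e (hw j))
      (fun x _ => ((hw j).1.differentiable (by simp)) x)
      (fun x _ => (P.contDiff_e.differentiable (by simp)) x)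
    simp_rw [e1, integral_const_mul] at h1
    rw [h1, neg_neg]
  have e2 : ∀ p, P.L a p * P.e p = (P.r p : ℂ) * a p * P.e p + Complex.I *
      ∑ j, fderiv ℝ (fun q => (P.ℓ j q : ℂ) * (P.r q : ℂ) * a q) p (P.b j) * P.e p := fun p => by
    rw [L, add_mul, mul_assoc Complex.I, Finset.sum_mul]
  have e3 : ∀ p, a p * P.e p = (P.r p : ℂ) * a p * P.e p +
      ∑ j, (P.ℓ j p : ℂ) * (P.r p : ℂ) * a p * P.ℓ j p * P.e p := fun p => by
    have h1 : (P.r p : ℂ) * (1 + ∑ j, (P.ℓ j p : ℂ) ^ 2) = 1 := by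
      have := inv_mul_cancel₀ (P.den_pos p).ne'
      rw [r]
      exact_mod_cast this
    calc a p * P.e p = ((P.r p : ℂ) * (1 + ∑ j, (P.ℓ j p : ℂ) ^ 2)) * a p * P.e p := by
          rw [h1, one_mul]
      _ = (P.r p : ℂ) * a p * P.e p + ∑ j, (P.ℓ j p : ℂ) ^ 2 * ((P.r p : ℂ) * a p * P.e p) := by
          rw [← Finset.sum_mul]
          ring
      _ = _ := by
          congr 1
          exact Finset.sum_congr rfl fun j _ => by ring
  simp_rw [e2]
  rw [integral_add (P.integrable_mul_e hr) ((integrable_finsetSum _ fun j _ =>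
    P.integrable_mul_e ((hw j).fderiv_apply _)).const_mul _), integral_const_mul,
    integral_finsetSum _ fun j _ => P.integrable_mul_e ((hw j).fderiv_apply _)]
  simp_rw [ibp, e3]
  rw [integral_add (P.integrable_mul_e hr) (integrable_finsetSum _ fun j _ =>
    P.integrable_mul_e (hwl j)), integral_finsetSum _ fun j _ => P.integrable_mul_e (hwl j)]
  rw [Finset.sum_neg_distrib, ← Finset.mul_sum, mul_neg, ← mul_assoc, Complex.I_mul_I]
  ring

/-- The regularized integral. -/
def regInt (k : ℕ) (a : V → ℂ) : ℂ := ∫ p, P.L^[k] a p * P.e p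

/-- The scalar `κ` records the dependence on the parameter. It will be `‖u‖²` for a Taylor remainder
and a power of `1 + ‖v‖` for a parameter `v`. -/
theorem regInt_norm_le {l : Filter T} {κ : T → ℝ} {m : ℝ} {a : T → V → ℂ}
    (h : Bdd l (fun t p => κ t * (1 + ‖p‖) ^ m) a) (hκ : ∀ t, 0 ≤ κ t) {k : ℕ}
    (hk : m - k ≤ -decay V) : ∃ C, 0 ≤ C ∧ ∀ᶠ t in l, ‖P.regInt k (a t)‖ ≤ C * κ t := by
  obtain ⟨C, h0, hC⟩ := (P.bdd_L_iterate_decay h hκ hk).2 0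
  refine ⟨C * ∫ p : V, (1 + ‖p‖) ^ (-decay V), mul_nonneg h0 (integral_nonneg fun p => by
    positivity), ?_⟩
  filter_upwards [hC] with t ht
  have h1 : ∫ p : V, C * (κ t * (1 + ‖p‖) ^ (-decay V)) =
      C * (∫ p : V, (1 + ‖p‖) ^ (-decay V)) * κ t := by
    rw [integral_const_mul, integral_const_mul]
    ring
  rw [← h1]
  refine norm_integral_le_of_norm_le (((integrable_decay V).const_mul _).const_mul _)
    (ae_of_all _ fun p => ?_)
  rw [norm_mul, norm_e, mul_one]
  simpa using ht p

/-- Uniform symbol bounds give an integrable majorant after `k` applications of `L`, and `L`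
preserves pointwise convergence of all derivatives, so dominated convergence applies. -/
theorem regInt_tendsto_zero {l : Filter T} [l.IsCountablyGenerated] {m : ℝ} {a : T → V → ℂ}
    (h : Bdd l (fun _ p => (1 + ‖p‖) ^ m) a) (hn : Null l a) {k : ℕ} (hk : m - k ≤ -decay V) :
    Tendsto (fun t => P.regInt k (a t)) l (𝓝 0) := by
  have hb := P.bdd_L_iterate_decay (κ := fun _ => 1) (by simpa using h)
    (fun _ => zero_le_one) hk
  simp only [one_mul] at hb
  obtain ⟨C, h0, hC⟩ := hb.2 0
  rw [← integral_zero V ℂ]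
  refine tendsto_integral_filter_of_dominated_convergence (fun p => C * (1 + ‖p‖) ^ (-decay V))
    (Eventually.of_forall fun t =>
      ((hb.1 t).continuous.mul P.contDiff_e.continuous).aestronglyMeasurable) ?_
    ((integrable_decay V).const_mul C) (ae_of_all _ fun p => ?_)
  · filter_upwards [hC] with t ht
    refine ae_of_all _ fun p => ?_
    rw [norm_mul, norm_e, mul_one]
    simpa using ht p
  · simpa using ((P.null_L_iterate hn h.1 k).tendsto p).mul_const (P.e p)

theorem regInt_sub {m : ℝ} {a b : V → ℂ} (ha : Sym (fun p => (1 + ‖p‖) ^ m) a)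
    (hb : Sym (fun p => (1 + ‖p‖) ^ m) b) {k : ℕ} (hk : m - k ≤ -decay V) :
    P.regInt k (fun p => a p - b p) = P.regInt k a - P.regInt k b := by
  rw [regInt, regInt, regInt, P.L_iterate_sub ha.1 hb.1]
  simp only [sub_mul]
  exact integral_sub (P.integrable_mul_e (P.sym_L_iterate_decay ha hk))
    (P.integrable_mul_e (P.sym_L_iterate_decay hb hk))

/-- For integrable amplitudes the regularization changes nothing; this identifies the cut-off
integrals with regularized ones. -/
theorem regInt_eq_integral {a : V → ℂ} (h : Sym (fun p => (1 + ‖p‖) ^ (-decay V)) a) (k : ℕ) :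
    P.regInt k a = ∫ p, a p * P.e p := by
  induction k with
  | zero => rfl
  | succ k ih =>
    rw [← ih, regInt, regInt]
    simp only [Function.iterate_succ_apply']
    exact (P.integral_mul_e_eq_integral_L (P.sym_L_iterate_decay h
      (by linarith [Nat.cast_nonneg (α := ℝ) k]))).symm

/-- The error is the regularized integral of `(χ(ε·) - 1) a`. This family is bounded in the class of
`a`, and all its derivatives tend to zero pointwise, whatever the choice of `χ`. -/
theorem hasOsc_regInt {m : ℝ} {a : V → ℂ} (h : Sym (fun p => (1 + ‖p‖) ^ m) a) {k : ℕ}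
    (hk : m - k ≤ -decay V) : HasOsc P.φ a (P.regInt k a) := by
  intro χ hχ
  have h1 : ∀ ε : ℝ, 0 < ε → Sym (fun p => (1 + ‖p‖) ^ (-decay V)) (fun p => χ (ε • p) * a p) :=
    fun ε hε => sym_cutoff_mul h χ hε _
  refine ⟨fun ε hε => P.integrable_mul_e (h1 ε hε), ?_⟩
  have hs : ∀ t : ℝ, ContDiff ℝ ∞ (fun p => χ (t • p) - 1) := fun t =>
    ((bdd_cutoff χ).1 t).sub contDiff_const
  have hb : Bdd (𝓝[>] (0 : ℝ)) (fun _ p => (1 + ‖p‖) ^ m)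
      (fun ε p => (χ (ε • p) - 1) * a p) := by
    have := ((bdd_cutoff χ).sub ((sym_const (V := V) (1 : ℂ)).bdd (𝓝[>] (0 : ℝ)))).mul
      (h.bdd (𝓝[>] (0 : ℝ)))
    simpa only [one_mul] using this
  have h2 := P.regInt_tendsto_zero hb ((null_cutoff χ hχ).mul_const hs h.1) hk
  rw [tendsto_iff_norm_sub_tendsto_zero]
  rw [tendsto_zero_iff_norm_tendsto_zero] at h2
  refine h2.congr' ?_
  filter_upwards [self_mem_nhdsWithin] with ε hε
  congr 1
  have e1 : (fun p => (χ (ε • p) - 1) * a p) = fun p => χ (ε • p) * a p - a p := by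
    funext p
    ring
  rw [e1, P.regInt_sub (sym_cutoff_mul h χ hε m) h hk, P.regInt_eq_integral (h1 ε hε)]
  rfl

theorem osc_eq_regInt {m : ℝ} {a : V → ℂ} (h : Sym (fun p => (1 + ‖p‖) ^ m) a) {k : ℕ}
    (hk : m - k ≤ -decay V) : osc P.φ a = P.regInt k a :=
  (P.hasOsc_regInt h hk).osc_eq

theorem hasOsc {m : ℝ} {a : V → ℂ} (h : Sym (fun p => (1 + ‖p‖) ^ m) a) :
    HasOsc P.φ a (osc P.φ a) := by
  obtain ⟨k, hk⟩ := exists_order V m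
  rw [P.osc_eq_regInt h hk]
  exact P.hasOsc_regInt h hk

theorem osc_eq_integral {a : V → ℂ} (h : Sym (fun p => (1 + ‖p‖) ^ (-decay V)) a) :
    osc P.φ a = ∫ p, a p * P.e p :=
  P.osc_eq_regInt (k := 0) h (by simp)

theorem osc_norm_le {l : Filter T} {κ : T → ℝ} {m : ℝ} {a : T → V → ℂ}
    (h : Bdd l (fun t p => κ t * (1 + ‖p‖) ^ m) a) (hκ : ∀ t, 0 ≤ κ t)
    (h' : ∀ t, Sym (fun p => (1 + ‖p‖) ^ m) (a t)) :
    ∃ C, 0 ≤ C ∧ ∀ᶠ t in l, ‖osc P.φ (a t)‖ ≤ C * κ t := by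
  obtain ⟨k, hk⟩ := exists_order V m
  simp_rw [P.osc_eq_regInt (h' _) hk]
  exact P.regInt_norm_le h hκ hk

theorem osc_tendsto_zero {l : Filter T} [l.IsCountablyGenerated] {m : ℝ} {a : T → V → ℂ}
    (h : Bdd l (fun _ p => (1 + ‖p‖) ^ m) a) (hn : Null l a)
    (h' : ∀ t, Sym (fun p => (1 + ‖p‖) ^ m) (a t)) :
    Tendsto (fun t => osc P.φ (a t)) l (𝓝 0) := by
  obtain ⟨k, hk⟩ := exists_order V m
  simp_rw [P.osc_eq_regInt (h' _) hk]
  exact P.regInt_tendsto_zero h hn hk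

theorem osc_const_mul {m : ℝ} {a : V → ℂ} (h : Sym (fun p => (1 + ‖p‖) ^ m) a) (k : ℂ) :
    osc P.φ (fun p => k * a p) = k * osc P.φ a :=
  ((P.hasOsc h).const_mul k).osc_eq

theorem osc_add {m : ℝ} {a b : V → ℂ} (ha : Sym (fun p => (1 + ‖p‖) ^ m) a)
    (hb : Sym (fun p => (1 + ‖p‖) ^ m) b) :
    osc P.φ (fun p => a p + b p) = osc P.φ a + osc P.φ b :=
  ((P.hasOsc ha).add (P.hasOsc hb)).osc_eq

theorem osc_sub {m : ℝ} {a b : V → ℂ} (ha : Sym (fun p => (1 + ‖p‖) ^ m) a)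
    (hb : Sym (fun p => (1 + ‖p‖) ^ m) b) :
    osc P.φ (fun p => a p - b p) = osc P.φ a - osc P.φ b :=
  ((P.hasOsc ha).sub (P.hasOsc hb)).osc_eq

end Phase

end Osc

end

section

/-! ### Oscillatory integrals depending on parameters -/

section Taylor

/-- The derivative of the remainder of `a` is the remainder of `fderiv ℝ a`, which reduces order `i
+ 1` to order `i` with values in a new space; this is why `F` is quantified inside the induction.
Order zero is the mean value inequality applied twice. -/
theorem norm_taylor_remainder_le {W : Type} [NormedAddCommGroup W] [NormedSpace ℝ W] (i : ℕ) :
    ∀ {F : Type} [NormedAddCommGroup F] [NormedSpace ℝ F] {a : W → F} (_ : ContDiff ℝ ∞ a)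
      (w u : W) {M : ℝ}
      (_ : ∀ x ∈ segment ℝ w (w + u), ‖iteratedFDeriv ℝ (i + 2) a x‖ ≤ M),
      ‖iteratedFDeriv ℝ i (fun w => a (w + u) - a w - fderiv ℝ a w u) w‖ ≤ M * ‖u‖ ^ 2 := by
  induction i with
  | zero =>
    intro F _ _ a ha w u M hM
    have hw : w ∈ segment ℝ w (w + u) := left_mem_segment ℝ _ _
    have hwu : w + u ∈ segment ℝ w (w + u) := right_mem_segment ℝ _ _
    have hda : ContDiff ℝ ∞ (fderiv ℝ a) := ha.fderiv_right (by simp)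
    have h1 : ∀ x ∈ segment ℝ w (w + u), ‖fderiv ℝ a x - fderiv ℝ a w‖ ≤ M * ‖u‖ := by
      intro x hx
      have h2 := (convex_segment w (w + u)).norm_image_sub_le_of_norm_fderiv_le (𝕜 := ℝ)
        (f := fderiv ℝ a) (C := M) (fun x _ => (hda.differentiable (by simp)) x)
        (fun y hy => by
          rw [← norm_iteratedFDeriv_one, norm_iteratedFDeriv_fderiv]
          exact hM y hy) hw hx
      refine h2.trans ?_
      have hM0 : 0 ≤ M := (norm_nonneg _).trans (hM w hw)
      gcongr
      rw [segment_eq_image'] at hx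
      obtain ⟨θ, hθ, rfl⟩ := hx
      rw [add_sub_cancel_left, add_sub_cancel_left, norm_smul, Real.norm_of_nonneg hθ.1]
      exact mul_le_of_le_one_left (norm_nonneg _) hθ.2
    have h3 := (convex_segment w (w + u)).norm_image_sub_le_of_norm_hasFDerivWithin_le'
      (f := a) (f' := fderiv ℝ a) (φ := fderiv ℝ a w) (C := M * ‖u‖)
      (fun x _ => ((ha.differentiable (by simp)) x).hasFDerivAt.hasFDerivWithinAt) h1 hw hwu
    rw [add_sub_cancel_left] at h3
    rw [norm_iteratedFDeriv_zero]
    calc _ ≤ _ := h3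
      _ = _ := by ring
  | succ i ih =>
    intro F _ _ a ha w u M hM
    have hda : ContDiff ℝ ∞ (fderiv ℝ a) := ha.fderiv_right (by simp)
    have e : fderiv ℝ (fun w => a (w + u) - a w - fderiv ℝ a w u) =
        fun w => fderiv ℝ a (w + u) - fderiv ℝ a w - fderiv ℝ (fderiv ℝ a) w u := by
      funext x
      have hd := ha.differentiable (by simp)
      have h1 : HasFDerivAt (fun w => a (w + u)) (fderiv ℝ a (x + u)) x :=
        (hasFDerivAt_comp_add_right u).2 (hd (x + u)).hasFDerivAt
      have h2 := ((hda.differentiable (by simp)) x).hasFDerivAt.clm_apply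
        (hasFDerivAt_const u x)
      have h3 := ((h1.sub (hd x).hasFDerivAt).sub h2).fderiv
      refine Eq.trans h3 ?_
      congr 1
      ext v
      -- Differentiating `w ↦ a'(w) u` along `v` puts the arguments of `a''` in the opposite order
      -- to the one in the remainder of `a'`.
      have hs : IsSymmSndFDerivAt ℝ a x :=
        (ha.contDiffAt (x := x)).isSymmSndFDerivAt
          (by simpa using WithTop.coe_le_coe.2 (le_top : (2 : ℕ∞) ≤ ⊤))
      simpa using hs v u
    rw [← norm_iteratedFDeriv_fderiv, e]
    refine ih hda w u fun x hx => ?_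
    rw [norm_iteratedFDeriv_fderiv]
    exact hM x hx

end Taylor

/-! ### Differentiation under the oscillatory integral. -/

section Partial

variable {V₁ V₂ : Type} {T : Type*} [NormedAddCommGroup V₁] [NormedSpace ℝ V₁]
  [NormedAddCommGroup V₂] [NormedSpace ℝ V₂]

/-- The weight `(1 + |v|)^s (1 + |p|)^m` on a product space. -/
def prodWeight (s m : ℝ) (w : V₁ × V₂) : ℝ := (1 + ‖w.1‖) ^ s * (1 + ‖w.2‖) ^ m

/-- The first variable becomes part of the parameter. The filter `comap Prod.fst l` puts no
condition on it, so the bounds stay uniform in that variable. -/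
theorem Bdd.slice {F : Type*} [NormedAddCommGroup F] [NormedSpace ℝ F] {l : Filter T}
    {wt : T → V₁ × V₂ → ℝ} {a : T → V₁ × V₂ → F} (h : Bdd l wt a) :
    Bdd (comap Prod.fst l) (fun (t : T × V₁) p => wt t.1 (t.2, p))
      (fun (t : T × V₁) p => a t.1 (t.2, p)) := by
  have := h.comp_affine (l' := comap Prod.fst l) (τ := (Prod.fst : T × V₁ → T)) tendsto_comap (fun t => (t.2, (0 : V₂)))
    (fun _ => ContinuousLinearMap.inr ℝ V₁ V₂) (M := 1)
    (Eventually.of_forall fun _ => ContinuousLinearMap.norm_inr_le_one ℝ V₁ V₂)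
  simpa using this

theorem Sym.slice {s m : ℝ} {a : V₁ × V₂ → ℂ} (h : Sym (prodWeight s m) a) (v : V₁) :
    Sym (fun p => (1 + ‖p‖) ^ m) (fun p => a (v, p)) := by
  have h1 := (h.comp_affine (v, 0) (ContinuousLinearMap.inr ℝ V₁ V₂)).mono
    (wt' := fun p => (1 + ‖p‖) ^ m) ((1 + ‖v‖) ^ s) (fun p => by simp [prodWeight]) (by positivity)
  simpa using h1

theorem Null.slice {l : Filter T} {a : T → V₁ × V₂ → ℂ} (h : Null l a)
    (ha : ∀ t, ContDiff ℝ ∞ (a t)) (v : V₁) : Null l (fun t p => a t (v, p)) := by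
  intro i p
  have e : ∀ t, (fun p => a t (v, p)) =
      fun p => a t ((v, 0) + ContinuousLinearMap.inr ℝ V₁ V₂ p) := fun t => by
    funext q
    simp
  have e2 : (v, (0 : V₂)) + ContinuousLinearMap.inr ℝ V₁ V₂ p = (v, p) := by simp
  have h1 := (h i (v, p)).norm.mul_const (‖ContinuousLinearMap.inr ℝ V₁ V₂‖ ^ i)
  rw [norm_zero, zero_mul] at h1
  rw [tendsto_zero_iff_norm_tendsto_zero]
  refine squeeze_zero (fun _ => norm_nonneg _) (fun t => ?_) h1
  refine (congrArg (fun f => ‖iteratedFDeriv ℝ i f p‖) (e t)).le.trans ?_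
  refine (norm_iteratedFDeriv_comp_affine_le (ha t) _ _ i p).trans ?_
  rw [e2]

theorem one_add_norm_rpow_le {E : Type*} [NormedAddCommGroup E] (s : ℝ) (v u : E) (hu : ‖u‖ ≤ 1) :
    (1 + ‖v + u‖) ^ s ≤ (2 + ‖v‖) ^ |s| := by
  have h1 : (1 : ℝ) ≤ 1 + ‖v + u‖ := by linarith [norm_nonneg (v + u)]
  have h2 : 1 + ‖v + u‖ ≤ 2 + ‖v‖ := by linarith [norm_add_le v u]
  exact (Real.rpow_le_rpow_of_exponent_le h1 (le_abs_self s)).trans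
    (Real.rpow_le_rpow (by positivity) h2 (abs_nonneg s))

/-- Taylor's formula on the whole product, in the direction `(u, 0)`. For `‖u‖ ≤ 1` the weight in
the first variable is bounded along the segment by `(2 + ‖v‖) ^ |s|`. -/
theorem bdd_slice_remainder {s m : ℝ} {a : V₁ × V₂ → ℂ} (h : Sym (prodWeight s m) a) (v : V₁) :
    Bdd (𝓝 (0 : V₁)) (fun u p => ‖u‖ ^ 2 * (1 + ‖p‖) ^ m)
      (fun u p => a (v + u, p) - a (v, p) - fderiv ℝ a (v, p) (u, 0)) := by
  have e : ∀ u : V₁, (fun p : V₂ => a (v + u, p) - a (v, p) - fderiv ℝ a (v, p) (u, 0)) =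
      fun p => (fun w => a (w + (u, 0)) - a w - fderiv ℝ a w (u, 0))
        ((v, 0) + ContinuousLinearMap.inr ℝ V₁ V₂ p) := fun u => by
    funext p
    simp
  have hs : ∀ u : V₁, ContDiff ℝ ∞ (fun w => a (w + (u, (0 : V₂))) - a w - fderiv ℝ a w (u, 0)) :=
    fun u => ((h.1.comp (contDiff_id.add contDiff_const)).sub h.1).sub
      (contDiff_fderiv_apply h.1 _)
  refine ⟨fun u => ?_, fun i => ?_⟩
  · exact (congrArg (ContDiff ℝ ∞) (e u)).mpr (contDiff_comp_affine (hs u) _ _)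
  · obtain ⟨C, h0, hC⟩ := h.2 (i + 2)
    refine ⟨C * (2 + ‖v‖) ^ |s|, by positivity, ?_⟩
    filter_upwards [Metric.closedBall_mem_nhds (0 : V₁) one_pos] with u hu p
    rw [mem_closedBall_zero_iff] at hu
    refine (congrArg (fun f => ‖iteratedFDeriv ℝ i f p‖) (e u)).le.trans ?_
    refine (norm_iteratedFDeriv_comp_affine_le (hs u) _ _ i p).trans ?_
    have h1 : (v, (0 : V₂)) + ContinuousLinearMap.inr ℝ V₁ V₂ p = (v, p) := by simp
    have h2 : ‖ContinuousLinearMap.inr ℝ V₁ V₂‖ ^ i ≤ 1 :=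
      pow_le_one₀ (norm_nonneg _) (ContinuousLinearMap.norm_inr_le_one ℝ V₁ V₂)
    rw [h1]
    refine (mul_le_of_le_one_right (norm_nonneg _) h2).trans ?_
    refine (norm_taylor_remainder_le i h.1 (v, p) (u, 0)
      (M := C * ((2 + ‖v‖) ^ |s| * (1 + ‖p‖) ^ m)) fun x hx => ?_).trans ?_
    · refine (hC x).trans ?_
      rw [segment_eq_image'] at hx
      obtain ⟨θ, hθ, rfl⟩ := hx
      have h3 : ‖θ • u‖ ≤ 1 := by
        rw [norm_smul, Real.norm_of_nonneg hθ.1]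
        exact mul_le_one₀ hθ.2 (norm_nonneg _) hu
      have h4 := one_add_norm_rpow_le s v (θ • u) h3
      have h6 : (v, p) + θ • ((v, p) + (u, 0) - (v, p)) = (v + θ • u, p) := by simp
      simp only [h6, prodWeight]
      gcongr
    · have h5 : ‖((u, 0) : V₁ × V₂)‖ = ‖u‖ := by simp
      rw [h5]
      apply le_of_eq
      ring

variable [MeasureSpace V₂] [FiniteDimensional ℝ V₂] [BorelSpace V₂]
  [(volume : Measure V₂).IsAddHaarMeasure] (P : Phase V₂)

/-- The oscillatory integral over the second variable. -/
def partialOsc (φ : V₂ → ℝ) (a : V₁ × V₂ → ℂ) (v : V₁) : ℂ := osc φ (fun p => a (v, p))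

/-- By linearity of `osc`, the error of the candidate derivative is the oscillatory integral of the
Taylor remainder, an amplitude with constants of size `‖u‖²`. -/
theorem hasFDerivAt_partialOsc [FiniteDimensional ℝ V₁] {s m : ℝ} {a : V₁ × V₂ → ℂ}
    (h : Sym (prodWeight s m) a) (v : V₁) :
    ∃ D : V₁ →L[ℝ] ℂ, HasFDerivAt (partialOsc P.φ a) D v ∧
      ∀ u, D u = partialOsc P.φ (fun w => fderiv ℝ a w (u, 0)) v := by
  have hsl : ∀ u : V₁, Sym (fun p => (1 + ‖p‖) ^ m) (fun p => fderiv ℝ a (v, p) (u, 0)) :=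
    fun u => (h.fderiv_apply (u, 0)).slice v
  let D₀ : V₁ →ₗ[ℝ] ℂ :=
    { toFun := fun u => partialOsc P.φ (fun w => fderiv ℝ a w (u, 0)) v
      map_add' := fun x y => by
        have h1 := P.osc_add (hsl x) (hsl y)
        simp only [partialOsc]
        rw [← h1]
        congr 1
        funext p
        rw [← map_add]
        simp
      map_smul' := fun c x => by
        have h1 := P.osc_const_mul (hsl x) (c : ℂ)
        simp only [partialOsc, RingHom.id_apply, Complex.real_smul]
        rw [← h1]
        congr 1
        funext p
        rw [← Complex.real_smul, ← map_smul]
        simp }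
  refine ⟨D₀.toContinuousLinearMap, ?_, fun u => rfl⟩
  rw [hasFDerivAt_iff_isLittleO_nhds_zero]
  have hR := bdd_slice_remainder h v
  have hRs : ∀ u : V₁, Sym (fun p => (1 + ‖p‖) ^ m)
      (fun p => a (v + u, p) - a (v, p) - fderiv ℝ a (v, p) (u, 0)) := fun u =>
    ((h.slice (v + u)).sub (h.slice v)).sub (hsl u)
  obtain ⟨C, -, hC⟩ := P.osc_norm_le hR (fun u => by positivity) hRs
  have e : ∀ u, osc P.φ (fun p => a (v + u, p) - a (v, p) - fderiv ℝ a (v, p) (u, 0)) =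
      partialOsc P.φ a (v + u) - partialOsc P.φ a v - D₀.toContinuousLinearMap u := fun u => by
    rw [P.osc_sub ((h.slice (v + u)).sub (h.slice v)) (hsl u),
      P.osc_sub (h.slice (v + u)) (h.slice v)]
    rfl
  have h2 : (fun u => partialOsc P.φ a (v + u) - partialOsc P.φ a v -
      D₀.toContinuousLinearMap u) =O[𝓝 0] fun u => ‖u‖ ^ 2 := by
    refine Asymptotics.IsBigO.of_bound C ?_
    filter_upwards [hC] with u hu
    rw [← e, Real.norm_of_nonneg (by positivity)]
    exact hu
  refine h2.trans_isLittleO ?_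
  exact Asymptotics.isLittleO_norm_pow_id one_lt_two

theorem fderiv_partialOsc_apply [FiniteDimensional ℝ V₁] {s m : ℝ} {a : V₁ × V₂ → ℂ}
    (h : Sym (prodWeight s m) a) (u v : V₁) :
    fderiv ℝ (partialOsc P.φ a) v u = partialOsc P.φ (fun w => fderiv ℝ a w (u, 0)) v := by
  obtain ⟨D, hD, hDu⟩ := hasFDerivAt_partialOsc P h v
  rw [hD.fderiv, hDu]

/-- Directional derivatives are again partial oscillatory integrals of amplitudes in the same class,
so the induction generalizes over `a`. -/
theorem contDiff_partialOsc [FiniteDimensional ℝ V₁] {s m : ℝ} {a : V₁ × V₂ → ℂ}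
    (h : Sym (prodWeight s m) a) : ContDiff ℝ ∞ (partialOsc P.φ a) := by
  rw [contDiff_infty]
  intro n
  induction n generalizing a with
  | zero =>
    rw [Nat.cast_zero, contDiff_zero]
    refine continuous_iff_continuousAt.2 fun v => ?_
    obtain ⟨D, hD, -⟩ := hasFDerivAt_partialOsc P h v
    exact hD.continuousAt
  | succ n ih =>
    have h1 : ((n + 1 : ℕ) : ℕ∞ω) = (n : ℕ∞ω) + 1 := by push_cast; rfl
    rw [h1, contDiff_succ_iff_fderiv_apply]
    refine ⟨fun v => ?_, by simp, fun y => ?_⟩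
    · obtain ⟨D, hD, -⟩ := hasFDerivAt_partialOsc P h v
      exact hD.differentiableAt
    · simp_rw [fderiv_partialOsc_apply P h]
      exact ih (h.fderiv_apply _)

theorem bdd_partialOsc [FiniteDimensional ℝ V₁] {l : Filter T} {s m : ℝ} {a : T → V₁ × V₂ → ℂ}
    (h : Bdd l (fun _ => prodWeight s m) a) (h' : ∀ t, Sym (prodWeight s m) (a t)) :
    Bdd l (fun _ v => (1 + ‖v‖) ^ s) (fun t => partialOsc P.φ (a t)) := by
  refine ⟨fun t => contDiff_partialOsc P (h' t), fun i => ?_⟩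
  induction i generalizing a with
  | zero =>
    -- Treating `v` as a parameter with `κ = (1 + ‖v‖) ^ s` gives one constant for all `v`.
    obtain ⟨C, h0, hC⟩ := P.osc_norm_le (κ := fun t : T × V₁ => (1 + ‖t.2‖) ^ s) h.slice
      (fun _ => by positivity) (fun t => (h' t.1).slice t.2)
    refine ⟨C, h0, ?_⟩
    rw [eventually_comap] at hC
    filter_upwards [hC] with t ht v
    rw [norm_iteratedFDeriv_zero]
    exact ht (t, v) rfl
  | succ i ih =>
    let b := Module.finBasis ℝ V₁
    have h1 := fun j => ih (h.fderiv_apply (b j, (0 : V₂))) (fun t => (h' t).fderiv_apply _)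
    choose C hC0 hC using h1
    refine ⟨∑ j, ‖(b.coord j).toContinuousLinearMap‖ * C j,
      Finset.sum_nonneg fun j _ => mul_nonneg (norm_nonneg _) (hC0 j), ?_⟩
    filter_upwards [eventually_all.2 hC] with t ht v
    refine (norm_iteratedFDeriv_succ_le_sum b (contDiff_partialOsc P (h' t)) i v).trans ?_
    rw [Finset.sum_mul]
    refine Finset.sum_le_sum fun j _ => ?_
    simp_rw [fderiv_partialOsc_apply P (h' t)]
    rw [mul_assoc]
    exact mul_le_mul_of_nonneg_left (ht j v) (norm_nonneg _)

theorem sym_partialOsc [FiniteDimensional ℝ V₁] {s m : ℝ} {a : V₁ × V₂ → ℂ}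
    (h : Sym (prodWeight s m) a) : Sym (fun v => (1 + ‖v‖) ^ s) (partialOsc P.φ a) :=
  (bdd_partialOsc P (h.bdd (⊤ : Filter Unit)) fun _ => h).sym

theorem null_partialOsc [FiniteDimensional ℝ V₁] {l : Filter T} [l.IsCountablyGenerated] {s m : ℝ}
    {a : T → V₁ × V₂ → ℂ} (h : Bdd l (fun _ => prodWeight s m) a)
    (h' : ∀ t, Sym (prodWeight s m) (a t)) (hn : Null l a) :
    Null l (fun t => partialOsc P.φ (a t)) := by
  intro i
  induction i generalizing a with
  | zero =>
    intro v
    have h1 : Bdd l (fun _ p => (1 + ‖p‖) ^ m) (fun t p => a t (v, p)) := by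
      have h2 := (h.comp_affine tendsto_id (fun _ => (v, (0 : V₂)))
        (fun _ => ContinuousLinearMap.inr ℝ V₁ V₂) (M := 1)
        (Eventually.of_forall fun _ => ContinuousLinearMap.norm_inr_le_one ℝ V₁ V₂)).mono
        (wt' := fun _ p => (1 + ‖p‖) ^ m) ((1 + ‖v‖) ^ s)
        (Eventually.of_forall fun t p => by simp [prodWeight]) (by positivity)
      simpa using h2
    have h3 := P.osc_tendsto_zero h1 (hn.slice h.1 v) fun t => (h' t).slice v
    rw [tendsto_zero_iff_norm_tendsto_zero] at h3 ⊢
    simpa [partialOsc] using h3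
  | succ i ih =>
    intro v
    let b := Module.finBasis ℝ V₁
    have h1 := fun j => ih (h.fderiv_apply (b j, (0 : V₂))) (fun t => (h' t).fderiv_apply _)
      (hn.fderiv_apply h.1 _) v
    have h2 : Tendsto (fun t => ∑ j, ‖(b.coord j).toContinuousLinearMap‖ * ‖iteratedFDeriv ℝ i
        (partialOsc P.φ fun w => fderiv ℝ (a t) w (b j, 0)) v‖) l (𝓝 0) := by
      have := tendsto_finsetSum Finset.univ fun j _ =>
        (h1 j).norm.const_mul ‖(b.coord j).toContinuousLinearMap‖
      simpa using this
    rw [tendsto_zero_iff_norm_tendsto_zero]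
    refine squeeze_zero (fun _ => norm_nonneg _) (fun t => ?_) h2
    refine (norm_iteratedFDeriv_succ_le_sum b (contDiff_partialOsc P (h' t)) i v).trans
      (le_of_eq ?_)
    simp_rw [fderiv_partialOsc_apply P (h' t)]

end Partial

end

section

/-! ### Fubini's theorem and linear changes of variables -/

instance isAddHaarMeasure_volume_prod {V₁ V₂ : Type*} [NormedAddCommGroup V₁] [NormedSpace ℝ V₁]
    [FiniteDimensional ℝ V₁] [MeasureSpace V₁] [BorelSpace V₁]
    [(volume : Measure V₁).IsAddHaarMeasure] [NormedAddCommGroup V₂] [NormedSpace ℝ V₂]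
    [FiniteDimensional ℝ V₂] [MeasureSpace V₂] [BorelSpace V₂]
    [(volume : Measure V₂).IsAddHaarMeasure] :
    (volume : Measure (V₁ × V₂)).IsAddHaarMeasure :=
  inferInstanceAs (((volume : Measure V₁).prod (volume : Measure V₂)).IsAddHaarMeasure)

theorem one_add_norm_fst_rpow_le {E E' : Type*} [NormedAddCommGroup E] [NormedAddCommGroup E']
    (s : ℝ) (w : E × E') :
    (1 + ‖w.1‖) ^ s ≤ (1 + ‖w‖) ^ |s| :=
  (Real.rpow_le_rpow_of_exponent_le (by linarith [norm_nonneg w.1]) (le_abs_self s)).trans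
    (Real.rpow_le_rpow (by positivity) (by linarith [norm_fst_le w]) (abs_nonneg s))

theorem one_add_norm_snd_rpow_le {E E' : Type*} [NormedAddCommGroup E] [NormedAddCommGroup E']
    (s : ℝ) (w : E × E') :
    (1 + ‖w.2‖) ^ s ≤ (1 + ‖w‖) ^ |s| :=
  (Real.rpow_le_rpow_of_exponent_le (by linarith [norm_nonneg w.2]) (le_abs_self s)).trans
    (Real.rpow_le_rpow (by positivity) (by linarith [norm_snd_le w]) (abs_nonneg s))

section ProdPhase

variable {V₁ V₂ : Type} [NormedAddCommGroup V₁] [NormedSpace ℝ V₁]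
  [NormedAddCommGroup V₂] [NormedSpace ℝ V₂]

/-- The sum of two phases, on the product space. -/
def Phase.prod (P₁ : Phase V₁) (P₂ : Phase V₂) : Phase (V₁ × V₂) where
  φ w := P₁.φ w.1 + P₂.φ w.2
  J := P₁.J ⊕ P₂.J
  b := Sum.elim (fun j => (P₁.b j, 0)) (fun j => (0, P₂.b j))
  ℓ := Sum.elim (fun j => (P₁.ℓ j).comp (ContinuousLinearMap.fst ℝ V₁ V₂))
    (fun j => (P₂.ℓ j).comp (ContinuousLinearMap.snd ℝ V₁ V₂))
  c := min P₁.c P₂.c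
  contDiff := (P₁.contDiff.comp contDiff_fst).add (P₂.contDiff.comp contDiff_snd)
  fderiv_eq := by
    intro j p
    have h1 := ((P₁.contDiff.differentiable (by simp)) p.1).hasFDerivAt.comp p
      (hasFDerivAt_fst (𝕜 := ℝ))
    have h2 := ((P₂.contDiff.differentiable (by simp)) p.2).hasFDerivAt.comp p
      (hasFDerivAt_snd (𝕜 := ℝ))
    have h3 : fderiv ℝ (fun w : V₁ × V₂ => P₁.φ w.1 + P₂.φ w.2) p = _ := (h1.add h2).fderiv
    rw [h3]
    rcases j with j | j
    · simp [P₁.fderiv_eq]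
    · simp [P₂.fderiv_eq]
  c_pos := lt_min P₁.c_pos P₂.c_pos
  coercive := by
    intro p
    have h1 := P₁.coercive p.1
    have h2 := P₂.coercive p.2
    rw [Fintype.sum_sum_type]
    simp only [Sum.elim_inl, Sum.elim_inr, ContinuousLinearMap.comp_apply,
      ContinuousLinearMap.coe_fst', ContinuousLinearMap.coe_snd']
    have h3 : 0 ≤ ∑ j, (P₁.ℓ j p.1) ^ 2 := by positivity
    have h4 : 0 ≤ ∑ j, (P₂.ℓ j p.2) ^ 2 := by positivity
    rcases max_choice ‖p.1‖ ‖p.2‖ with h | h <;> rw [Prod.norm_def, h]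
    · nlinarith [mul_le_mul_of_nonneg_right (min_le_left P₁.c P₂.c) (sq_nonneg ‖p.1‖)]
    · nlinarith [mul_le_mul_of_nonneg_right (min_le_right P₁.c P₂.c) (sq_nonneg ‖p.2‖)]

theorem Sym.of_prodWeight {s m : ℝ} {a : V₁ × V₂ → ℂ} (h : Sym (prodWeight s m) a) :
    Sym (fun w => (1 + ‖w‖) ^ (|s| + |m|)) a := by
  refine h.mono 1 (fun w => ?_) zero_le_one
  rw [one_mul, Real.rpow_add (by positivity)]
  exact mul_le_mul (one_add_norm_fst_rpow_le s w) (one_add_norm_snd_rpow_le m w) (by positivity)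
    (by positivity)

theorem sym_prodWeight_of_decay {s m : ℝ} (hs : 0 ≤ s) (hm : 0 ≤ m) {a : V₁ × V₂ → ℂ}
    (h : Sym (fun w => (1 + ‖w‖) ^ (-(s + m))) a) : Sym (prodWeight (-s) (-m)) a := by
  refine h.mono 1 (fun w => ?_) zero_le_one
  rw [one_mul, neg_add, Real.rpow_add (by positivity)]
  refine mul_le_mul ?_ ?_ (by positivity) (by positivity)
  · exact Real.rpow_le_rpow_of_nonpos (by positivity) (by linarith [norm_fst_le w])
      (by linarith)
  · exact Real.rpow_le_rpow_of_nonpos (by positivity) (by linarith [norm_snd_le w])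
      (by linarith)

end ProdPhase

theorem decay_nonneg (V : Type*) [NormedAddCommGroup V] [NormedSpace ℝ V] : 0 ≤ decay V := by
  unfold decay
  positivity

theorem sym_cutoff_one {V : Type*} [NormedAddCommGroup V] [NormedSpace ℝ V] (χ : 𝓢(V, ℂ))
    (ε : ℝ) : Sym (fun _ : V => (1 : ℝ)) (fun p => χ (ε • p)) := by
  have h0 : Sym (fun _ : V => (1 : ℝ)) χ := by simpa using sym_schwartz χ 0
  simpa using h0.comp_affine 0 (ε • ContinuousLinearMap.id ℝ V)

section Fubini

variable {V₁ V₂ : Type} [NormedAddCommGroup V₁] [NormedSpace ℝ V₁]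
  [FiniteDimensional ℝ V₁] [MeasureSpace V₁] [BorelSpace V₁]
  [(volume : Measure V₁).IsAddHaarMeasure] [NormedAddCommGroup V₂] [NormedSpace ℝ V₂]
  [FiniteDimensional ℝ V₂] [MeasureSpace V₂] [BorelSpace V₂]
  [(volume : Measure V₂).IsAddHaarMeasure]

theorem osc_prod_of_decay (P₁ : Phase V₁) (P₂ : Phase V₂) {a : V₁ × V₂ → ℂ}
    (h : Sym (prodWeight (-decay V₁) (-decay V₂)) a) :
    osc P₁.φ (partialOsc P₂.φ a) = ∫ w, a w * (P₁.prod P₂).e w := by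
  have he : ∀ w, (P₁.prod P₂).e w = P₁.e w.1 * P₂.e w.2 := fun w => by
    simp only [Phase.e, Phase.prod]
    rw [← Complex.exp_add]
    push_cast
    ring_nf
  obtain ⟨C, h0, hC⟩ := h.bound
  have hi : Integrable (fun w => a w * (P₁.prod P₂).e w) := by
    have h1 := ((integrable_decay V₁).mul_prod (integrable_decay V₂)).const_mul C
    refine Integrable.mono' h1
      (h.continuous.mul (P₁.prod P₂).contDiff_e.continuous).aestronglyMeasurable
      (ae_of_all _ fun w => ?_)
    rw [norm_mul, Phase.norm_e, mul_one]
    exact hC w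
  rw [P₁.osc_eq_integral (sym_partialOsc P₂ h), Measure.volume_eq_prod, integral_prod _ hi]
  refine integral_congr_ae (ae_of_all _ fun v => ?_)
  simp only [partialOsc]
  rw [P₂.osc_eq_integral (h.slice v), ← integral_mul_const]
  refine integral_congr_ae (ae_of_all _ fun p => ?_)
  simp only [he]
  ring

/-- Fubini's theorem for oscillatory integrals. -/
theorem osc_prod (P₁ : Phase V₁) (P₂ : Phase V₂) {s m : ℝ} {a : V₁ × V₂ → ℂ}
    (h : Sym (prodWeight s m) a) :
    osc (P₁.prod P₂).φ a = osc P₁.φ (partialOsc P₂.φ a) := by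
  obtain ⟨χ, hχ⟩ := exists_schwartz_cutoff (V := V₁ × V₂)
  have hs : ∀ ε : ℝ, Sym (prodWeight s m) (fun w => χ (ε • w) * a w) := fun ε => by
    simpa only [one_mul] using (sym_cutoff_one χ ε).mul h
  have hd : ∀ ε : ℝ, Sym (prodWeight s m) (fun w => (χ (ε • w) - 1) * a w) := fun ε => by
    simpa only [one_mul] using ((sym_cutoff_one χ ε).sub (sym_const (1 : ℂ))).mul h
  have hb : Bdd (𝓝[>] (0 : ℝ)) (fun _ => prodWeight s m)
      (fun ε w => (χ (ε • w) - 1) * a w) := by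
    have := ((bdd_cutoff χ).sub ((sym_const (V := V₁ × V₂) (1 : ℂ)).bdd (𝓝[>] (0 : ℝ)))).mul
      (h.bdd (𝓝[>] (0 : ℝ)))
    simpa only [one_mul] using this
  have hn : Null (𝓝[>] (0 : ℝ)) (fun ε w => (χ (ε • w) - 1) * a w) :=
    (null_cutoff χ hχ).mul_const
      (fun ε => ((sym_cutoff_one χ ε).sub (sym_const (1 : ℂ))).1) h.1
  -- The iterated integral is continuous along the cut-offs, as is the integral over the product.
  -- For each `ε > 0` the two agree by the classical theorem.
  have h1 := P₁.osc_tendsto_zero (bdd_partialOsc P₂ hb hd) (null_partialOsc P₂ hb hd hn)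
    fun ε => sym_partialOsc P₂ (hd ε)
  have e1 : ∀ ε : ℝ, osc P₁.φ (partialOsc P₂.φ (fun w => (χ (ε • w) - 1) * a w)) =
      osc P₁.φ (partialOsc P₂.φ (fun w => χ (ε • w) * a w)) - osc P₁.φ (partialOsc P₂.φ a) := by
    intro ε
    rw [← P₁.osc_sub (sym_partialOsc P₂ (hs ε)) (sym_partialOsc P₂ h)]
    congr 1
    funext v
    simp only [partialOsc]
    rw [← P₂.osc_sub ((hs ε).slice v) (h.slice v)]
    congr 1
    funext p
    ring
  simp_rw [e1] at h1
  have h2 : Tendsto (fun ε : ℝ => osc P₁.φ (partialOsc P₂.φ (fun w => χ (ε • w) * a w)))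
      (𝓝[>] 0) (𝓝 (osc P₁.φ (partialOsc P₂.φ a))) := by
    rw [tendsto_iff_norm_sub_tendsto_zero]
    exact tendsto_zero_iff_norm_tendsto_zero.1 h1
  have h3 := ((P₁.prod P₂).hasOsc h.of_prodWeight χ hχ).2
  refine tendsto_nhds_unique h3 (h2.congr' ?_)
  filter_upwards [self_mem_nhdsWithin] with ε hε
  refine osc_prod_of_decay P₁ P₂ (sym_prodWeight_of_decay (decay_nonneg V₁) (decay_nonneg V₂) ?_)
  exact sym_cutoff_mul h.of_prodWeight χ hε _

end Fubini

/-! ### Linear changes of variables. -/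

section ChangeOfVariables

variable {V : Type*} [NormedAddCommGroup V] [NormedSpace ℝ V] [FiniteDimensional ℝ V]
  [MeasureSpace V] [BorelSpace V] [(volume : Measure V).IsAddHaarMeasure]

/-- A linear change of variables multiplies oscillatory integrals by a constant. -/
theorem exists_hasOsc_comp (A : V ≃L[ℝ] V) : ∃ κ : ℂ, ∀ {φ : V → ℝ} {a : V → ℂ} {c : ℂ},
    HasOsc φ a c → HasOsc (fun p => φ (A p)) (fun p => a (A p)) (κ * c) := by
  set f : V →ₗ[ℝ] V := (A.toLinearEquiv : V →ₗ[ℝ] V) with hf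
  have hdet : LinearMap.det f ≠ 0 := A.toLinearEquiv.isUnit_det'.ne_zero
  set κ := |(LinearMap.det f)⁻¹|
  have hmap : Measure.map A (volume : Measure V) = ENNReal.ofReal κ • volume :=
    Measure.map_linearMap_addHaar_eq_smul_addHaar volume hdet
  have hint : ∀ {g : V → ℂ}, Integrable g → Integrable (fun p => g (A p)) := by
    intro g hg
    have h1 : Integrable g (Measure.map A volume) := by
      rw [hmap]
      exact hg.smul_measure ENNReal.ofReal_ne_top
    exact (integrable_map_equiv A.toHomeomorph.toMeasurableEquiv g).1 h1
  have hval : ∀ g : V → ℂ, ∫ p, g (A p) = (κ : ℂ) * ∫ p, g p := by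
    intro g
    have h1 : ∫ p, g p ∂(Measure.map A volume) = ∫ p, g (A p) :=
      integral_map_equiv A.toHomeomorph.toMeasurableEquiv g
    rw [← h1, hmap, integral_smul_measure, ENNReal.toReal_ofReal (abs_nonneg _),
      Complex.real_smul]
  refine ⟨κ, fun {φ a c} h χ hχ => ?_⟩
  -- The cut-off is transported to `χ ∘ A⁻¹`, again with value `1` at the origin; this is where
  -- independence of the cut-off is used.
  let χ' : 𝓢(V, ℂ) := SchwartzMap.compCLMOfContinuousLinearEquiv ℂ A.symm χ
  have hχ' : ∀ p, χ' p = χ (A.symm p) := fun p => rfl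
  obtain ⟨h1, h2⟩ := h χ' (by rw [hχ', map_zero, hχ])
  have e : ∀ (ε : ℝ) p, χ (ε • p) * a (A p) * Complex.exp (Complex.I * φ (A p)) =
      (fun q => χ' (ε • q) * a q * Complex.exp (Complex.I * φ q)) (A p) := fun ε p => by
    simp [hχ']
  refine ⟨fun ε hε => ?_, ?_⟩
  · exact (hint (h1 ε hε)).congr (ae_of_all _ fun p => (e ε p).symm)
  · refine (h2.const_mul (κ : ℂ)).congr fun ε => ?_
    rw [← hval]
    exact integral_congr_ae (ae_of_all _ fun p => (e ε p).symm)

end ChangeOfVariables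

end

section

/-! ### The amplitudes of the deformed product -/

section Translates

variable {E V : Type} {T : Type*} [NormedAddCommGroup E] [NormedSpace ℝ E]
  [NormedAddCommGroup V] [NormedSpace ℝ V]

theorem Bdd.mono_filter {l l' : Filter T} {wt : T → V → ℝ} {a : T → V → ℂ} (h : Bdd l wt a)
    (hl : l' ≤ l) : Bdd l' wt a :=
  ⟨h.1, fun i => by
    obtain ⟨C, h0, hC⟩ := h.2 i
    exact ⟨C, h0, hl hC⟩⟩

/-- Peetre's inequality `(1 + ‖v + Bp‖)^m ≤ (1 + ‖Bp‖)^|m| (1 + ‖v‖)^m`. The point variable keeps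
the exact order `m`, even when negative, and the integration variable absorbs the loss. -/
theorem bdd_comp_add {f : E → ℂ} {m : ℝ} (h : Sym (fun y => (1 + ‖y‖) ^ m) f) {l : Filter T}
    {B : T → V →L[ℝ] E} {M : ℝ} (hB : ∀ᶠ t in l, ‖B t‖ ≤ M) :
    Bdd l (fun _ => prodWeight m |m|) (fun t (w : E × V) => f (w.1 + B t w.2)) := by
  have h1 := (h.bdd l).comp_affine (l' := l) tendsto_id (fun _ => 0)
    (fun t => ContinuousLinearMap.fst ℝ E V + (B t).comp (ContinuousLinearMap.snd ℝ E V))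
    (M := 1 + M) (by
      filter_upwards [hB] with t ht
      refine (norm_add_le _ _).trans (add_le_add (ContinuousLinearMap.norm_fst_le ℝ E V) ?_)
      refine (ContinuousLinearMap.opNorm_comp_le _ _).trans ?_
      calc _ ≤ ‖B t‖ * 1 := by
            gcongr
            exact ContinuousLinearMap.norm_snd_le ℝ E V
        _ ≤ M := by rwa [mul_one])
  have h2 := h1.mono (wt' := fun _ => prodWeight m |m|) ((1 + |M|) ^ |m|) (by
    filter_upwards [hB] with t ht w
    have h3 := rpow_peetre m (-(B t w.2)) (w.1 + B t w.2)
    rw [neg_add_cancel_comm_assoc, norm_neg] at h3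
    have h4 : 1 + ‖B t w.2‖ ≤ (1 + |M|) * (1 + ‖w.2‖) := by
      have h5 := (B t).le_opNorm w.2
      have h6 : ‖B t‖ * ‖w.2‖ ≤ |M| * ‖w.2‖ := by
        gcongr
        exact ht.trans (le_abs_self M)
      nlinarith [norm_nonneg w.2, abs_nonneg M]
    have h7 := Real.rpow_le_rpow (by positivity) h4 (abs_nonneg m)
    rw [Real.mul_rpow (by positivity) (by positivity)] at h7
    simp only [zero_add, add_apply, ContinuousLinearMap.comp_apply,
      ContinuousLinearMap.coe_fst', ContinuousLinearMap.coe_snd', prodWeight]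
    calc _ ≤ _ := h3
      _ ≤ ((1 + |M|) ^ |m| * (1 + ‖w.2‖) ^ |m|) * (1 + ‖w.1‖) ^ m := by gcongr
      _ = _ := by ring) (by positivity)
  simpa using h2

theorem sym_comp_add {f : E → ℂ} {m : ℝ} (h : Sym (fun y => (1 + ‖y‖) ^ m) f) (B : V →L[ℝ] E) :
    Sym (prodWeight m |m|) (fun w : E × V => f (w.1 + B w.2)) :=
  (bdd_comp_add (l := (⊤ : Filter Unit)) h (B := fun _ => B)
    (Eventually.of_forall fun _ => le_rfl)).sym

theorem sym_translate {f : E → ℂ} {m : ℝ} (h : Sym (fun y => (1 + ‖y‖) ^ m) f) (z : E)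
    (B : V →L[ℝ] E) : Sym (fun p => (1 + ‖p‖) ^ |m|) (fun p => f (z + B p)) :=
  (sym_comp_add h B).slice z

theorem sym_prodWeight_mul {s s' m m' : ℝ} {a b : E × V → ℂ} (ha : Sym (prodWeight s m) a)
    (hb : Sym (prodWeight s' m') b) :
    Sym (prodWeight (s + s') (m + m')) (fun w => a w * b w) := by
  have h := ha.mul hb
  have e : ∀ w : E × V, prodWeight s m w * prodWeight s' m' w =
      prodWeight (s + s') (m + m') w := fun w => by
    simp only [prodWeight]
    rw [Real.rpow_add (by positivity), Real.rpow_add (by positivity)]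
    ring
  simpa only [e] using h

theorem sym_rpow_mul {m m' : ℝ} {a b : V → ℂ} (ha : Sym (fun p => (1 + ‖p‖) ^ m) a)
    (hb : Sym (fun p => (1 + ‖p‖) ^ m') b) :
    Sym (fun p => (1 + ‖p‖) ^ (m + m')) (fun p => a p * b p) := by
  have h := ha.mul hb
  have e : ∀ p : V, (1 + ‖p‖) ^ m * (1 + ‖p‖) ^ m' = (1 + ‖p‖) ^ (m + m') := fun p => by
    rw [Real.rpow_add (by positivity)]
  simpa only [e] using h

theorem sym_prodWeight_of_growth {m : ℝ} (hm : 0 ≤ m) {a : E × V → ℂ}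
    (h : Sym (fun w => (1 + ‖w‖) ^ m) a) : Sym (prodWeight m m) a := by
  refine h.mono 1 (fun w => ?_) zero_le_one
  rw [one_mul, prodWeight, ← Real.mul_rpow (by positivity) (by positivity)]
  refine Real.rpow_le_rpow (by positivity) ?_ hm
  rcases max_choice ‖w.1‖ ‖w.2‖ with h | h <;> rw [Prod.norm_def, h] <;>
    nlinarith [norm_nonneg w.1, norm_nonneg w.2]

end Translates

/-! ### The Minkowski phase, and the deformed product as an oscillatory integral. -/

variable {d : ℕ}

theorem mdot_comm (X Y : Emb d) : mdot X Y = mdot Y X :=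
  Finset.sum_congr rfl fun μ _ => by ring

theorem mdot_add_left (X X' Y : Emb d) : mdot (X + X') Y = mdot X Y + mdot X' Y := by
  simp only [mdot, ← Finset.sum_add_distrib]
  exact Finset.sum_congr rfl fun μ _ => by simp; ring

theorem mdot_sub_right (X Y Y' : Emb d) : mdot X (Y - Y') = mdot X Y - mdot X Y' := by
  simp only [mdot, ← Finset.sum_sub_distrib]
  exact Finset.sum_congr rfl fun μ _ => by simp; ring

theorem eta_sq (μ : Fin (d + 1)) : eta μ ^ 2 = 1 := by
  unfold eta
  split_ifs <;> norm_num

/-- The phase `X · Y` of the deformed product. -/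
def minkowskiPhase (d : ℕ) : Phase (Emb d × Emb d) where
  φ w := mdot w.1 w.2
  J := Fin (d + 1) ⊕ Fin (d + 1)
  b := Sum.elim (fun μ => (EuclideanSpace.single μ 1, 0)) (fun μ => (0, EuclideanSpace.single μ 1))
  ℓ := Sum.elim
    (fun μ => eta μ • (EuclideanSpace.proj μ).comp (ContinuousLinearMap.snd ℝ (Emb d) (Emb d)))
    (fun μ => eta μ • (EuclideanSpace.proj μ).comp (ContinuousLinearMap.fst ℝ (Emb d) (Emb d)))
  c := 1
  contDiff := by
    unfold mdot
    fun_prop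
  fderiv_eq := by
    intro j p
    have h1 : ∀ μ, HasFDerivAt (fun w : Emb d × Emb d => eta μ * w.1 μ * w.2 μ) _ p := fun μ =>
      (((EuclideanSpace.proj (𝕜 := ℝ) μ).comp
        (ContinuousLinearMap.fst ℝ (Emb d) (Emb d))).hasFDerivAt.const_mul (eta μ)).mul
      ((EuclideanSpace.proj (𝕜 := ℝ) μ).comp
        (ContinuousLinearMap.snd ℝ (Emb d) (Emb d))).hasFDerivAt
    have h2 : fderiv ℝ (fun w : Emb d × Emb d => mdot w.1 w.2) p = _ :=
      (HasFDerivAt.fun_sum (u := Finset.univ) fun μ _ => h1 μ).fderiv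
    rw [h2]
    rcases j with j | j
    · simp [mul_comm]
    · simp
  c_pos := one_pos
  coercive := by
    intro p
    rw [Fintype.sum_sum_type]
    simp only [Sum.elim_inl, Sum.elim_inr, smul_apply, ContinuousLinearMap.comp_apply,
      ContinuousLinearMap.coe_fst', ContinuousLinearMap.coe_snd', PiLp.proj_apply,
      smul_eq_mul, mul_pow, eta_sq, one_mul]
    have h1 := EuclideanSpace.real_norm_sq_eq p.1
    have h2 := EuclideanSpace.real_norm_sq_eq p.2
    rw [← h1, ← h2]
    rcases max_choice ‖p.1‖ ‖p.2‖ with h | h <;> rw [Prod.norm_def, h] <;>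
      nlinarith [sq_nonneg ‖p.1‖, sq_nonneg ‖p.2‖]

/-- The action of a deformation matrix as a continuous linear map. -/
def actL (Θ : Matrix (Fin (d + 1)) (Fin (d + 1)) ℝ) : Emb d →L[ℝ] Emb d :=
  LinearMap.toContinuousLinearMap
    { toFun := act Θ
      map_add' := fun X Y => by
        ext μ
        simp only [act, PiLp.add_apply, ← Finset.sum_add_distrib]
        exact Finset.sum_congr rfl fun ν _ => by ring
      map_smul' := fun c X => by
        ext μ
        simp only [act, PiLp.smul_apply, smul_eq_mul, RingHom.id_apply, Finset.mul_sum]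
        exact Finset.sum_congr rfl fun ν _ => by ring }

@[simp]
theorem actL_apply (Θ : Matrix (Fin (d + 1)) (Fin (d + 1)) ℝ) (X : Emb d) :
    actL Θ X = act Θ X := rfl

theorem tendsto_actL_zero :
    Tendsto (actL (d := d)) (𝓝 0) (𝓝 0) := by
  let A : Matrix (Fin (d + 1)) (Fin (d + 1)) ℝ →ₗ[ℝ] (Emb d →L[ℝ] Emb d) :=
    { toFun := actL
      map_add' := fun Θ Θ' => by
        ext X μ
        simp only [add_apply, actL_apply, act, PiLp.add_apply, Matrix.add_apply,
          ← Finset.sum_add_distrib]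
        exact Finset.sum_congr rfl fun ν _ => by ring
      map_smul' := fun c Θ => by
        ext X μ
        simp only [smul_apply, actL_apply, act, PiLp.smul_apply, Matrix.smul_apply, smul_eq_mul,
          RingHom.id_apply, Finset.mul_sum]
        exact Finset.sum_congr rfl fun ν _ => by ring }
  have h : Continuous A := A.continuous_of_finiteDimensional
  have h2 := h.tendsto 0
  rwa [map_zero] at h2

/-- The amplitude of the deformed product, as a function of the point and of the integration
variables. -/
def amplitude (Θ : Matrix (Fin (d + 1)) (Fin (d + 1)) ℝ) (F G : Emb d → ℂ)
    (w : Emb d × (Emb d × Emb d)) : ℂ :=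
  F (w.1 + act Θ w.2.1) * G (w.1 + w.2.2)

/-- The order `m + m'` in the point variable passes to the product itself; the growth in the
integration variables disappears in the regularization. -/
theorem sym_amplitude (Θ : Matrix (Fin (d + 1)) (Fin (d + 1)) ℝ) {F G : Emb d → ℂ} {m m' : ℝ}
    (hF : Sym (fun y => (1 + ‖y‖) ^ m) F) (hG : Sym (fun y => (1 + ‖y‖) ^ m') G) :
    Sym (prodWeight (m + m') (|m| + |m'|)) (amplitude Θ F G) :=
  sym_prodWeight_mul
    (sym_comp_add hF ((actL Θ).comp (ContinuousLinearMap.fst ℝ (Emb d) (Emb d))))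
    (sym_comp_add hG (ContinuousLinearMap.snd ℝ (Emb d) (Emb d)))

theorem HasProd.unique {Θ : Matrix (Fin (d + 1)) (Fin (d + 1)) ℝ} {F G : Emb d → ℂ} {Z : Emb d}
    {c c' : ℂ} (h : HasProd Θ F G Z c) (h' : HasProd Θ F G Z c') : c = c' := by
  obtain ⟨χ, hχ⟩ := exists_schwartz_cutoff (V := Emb d × Emb d)
  exact tendsto_nhds_unique (h χ hχ).2 (h' χ hχ).2

theorem HasProd.dprod_eq {Θ : Matrix (Fin (d + 1)) (Fin (d + 1)) ℝ} {F G : Emb d → ℂ} {Z : Emb d}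
    {c : ℂ} (h : HasProd Θ F G Z c) : dprod Θ F G Z = c := by
  have h' : ∃ c, HasProd Θ F G Z c := ⟨c, h⟩
  rw [dprod, dif_pos h']
  exact h'.choose_spec.unique h

theorem hasProd_of_hasOsc {Θ : Matrix (Fin (d + 1)) (Fin (d + 1)) ℝ} {F G : Emb d → ℂ} {Z : Emb d}
    {c : ℂ} (h : HasOsc (minkowskiPhase d).φ (fun p => amplitude Θ F G (Z, p)) c) :
    HasProd Θ F G Z (((2 * Real.pi : ℂ) ^ (d + 1))⁻¹ * c) := by
  intro χ hχ
  obtain ⟨h1, h2⟩ := h χ hχ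
  have e : ∀ ε p, integrand Θ F G χ Z ε p = χ (ε • p) * amplitude Θ F G (Z, p) *
      Complex.exp (Complex.I * ((minkowskiPhase d).φ p : ℂ)) := fun ε p => by
    simp only [integrand, amplitude, minkowskiPhase, Prod.smul_def]
    ring
  refine ⟨fun ε hε => (h1 ε hε).congr (ae_of_all _ fun p => (e ε p).symm), ?_⟩
  simp_rw [e]
  exact h2.const_mul _

/-- The normalization `(2π)^(-n)` of the deformed product. -/
def normalization (d : ℕ) : ℂ := ((2 * Real.pi : ℂ) ^ (d + 1))⁻¹

theorem two_pi_pow_ne_zero (d : ℕ) : (2 * Real.pi : ℂ) ^ (d + 1) ≠ 0 :=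
  pow_ne_zero _ (by simp [Real.pi_ne_zero])

section

variable {F G : Emb d → ℂ} {m m' : ℝ} (Θ : Matrix (Fin (d + 1)) (Fin (d + 1)) ℝ)

theorem hasProd_normalization_mul (hF : Sym (fun y => (1 + ‖y‖) ^ m) F)
    (hG : Sym (fun y => (1 + ‖y‖) ^ m') G) (Z : Emb d) :
    HasProd Θ F G Z
      (normalization d * partialOsc (minkowskiPhase d).φ (amplitude Θ F G) Z) :=
  hasProd_of_hasOsc ((minkowskiPhase d).hasOsc ((sym_amplitude Θ hF hG).slice Z))

theorem dprod_eq_partialOsc (hF : Sym (fun y => (1 + ‖y‖) ^ m) F)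
    (hG : Sym (fun y => (1 + ‖y‖) ^ m') G) :
    dprod Θ F G = fun Z =>
      normalization d * partialOsc (minkowskiPhase d).φ (amplitude Θ F G) Z :=
  funext fun Z => (hasProd_normalization_mul Θ hF hG Z).dprod_eq

theorem sym_dprod (hF : Sym (fun y => (1 + ‖y‖) ^ m) F) (hG : Sym (fun y => (1 + ‖y‖) ^ m') G) :
    Sym (fun y => (1 + ‖y‖) ^ (m + m')) (dprod Θ F G) := by
  rw [dprod_eq_partialOsc Θ hF hG]
  exact (sym_partialOsc _ (sym_amplitude Θ hF hG)).const_mul _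

/-- The point enters the amplitude only through translations of `F` and `G`, so the ordinary product
rule under the integral becomes a Leibniz rule for the deformed product. -/
theorem fderiv_dprod_apply (hF : Sym (fun y => (1 + ‖y‖) ^ m) F)
    (hG : Sym (fun y => (1 + ‖y‖) ^ m') G) (u Z : Emb d) :
    fderiv ℝ (dprod Θ F G) Z u = dprod Θ (fun y => fderiv ℝ F y u) G Z +
      dprod Θ F (fun y => fderiv ℝ G y u) Z := by
  have hA := sym_amplitude Θ hF hG
  rw [dprod_eq_partialOsc Θ hF hG, dprod_eq_partialOsc Θ (hF.fderiv_apply u) hG,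
    dprod_eq_partialOsc Θ hF (hG.fderiv_apply u)]
  obtain ⟨D, hD, -⟩ := hasFDerivAt_partialOsc (minkowskiPhase d) hA Z
  rw [(hD.const_mul _).fderiv, smul_apply, ← hD.fderiv, fderiv_partialOsc_apply _ hA, smul_eq_mul,
    ← mul_add]
  congr 1
  simp only [partialOsc]
  rw [← (minkowskiPhase d).osc_add ((sym_amplitude Θ (hF.fderiv_apply u) hG).slice Z)
    ((sym_amplitude Θ hF (hG.fderiv_apply u)).slice Z)]
  congr 1
  funext p
  have h1 : HasFDerivAt (fun w : Emb d × (Emb d × Emb d) => F (w.1 + act Θ w.2.1)) _ (Z, p) :=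
    ((hF.1.differentiable (by simp)) (Z + act Θ p.1)).hasFDerivAt.comp (Z, p)
      (ContinuousLinearMap.fst ℝ (Emb d) (Emb d × Emb d) + (actL Θ).comp
        ((ContinuousLinearMap.fst ℝ (Emb d) (Emb d)).comp
          (ContinuousLinearMap.snd ℝ (Emb d) (Emb d × Emb d)))).hasFDerivAt
  have h2 : HasFDerivAt (fun w : Emb d × (Emb d × Emb d) => G (w.1 + w.2.2)) _ (Z, p) :=
    ((hG.1.differentiable (by simp)) (Z + p.2)).hasFDerivAt.comp (Z, p)
      (ContinuousLinearMap.fst ℝ (Emb d) (Emb d × Emb d) +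
        ((ContinuousLinearMap.snd ℝ (Emb d) (Emb d)).comp
          (ContinuousLinearMap.snd ℝ (Emb d) (Emb d × Emb d)))).hasFDerivAt
  have h3 : fderiv ℝ (amplitude Θ F G) (Z, p) = _ := (h1.mul h2).fderiv
  have h0 : act Θ 0 = 0 := map_zero (actL Θ)
  rw [h3]
  simp [amplitude, h0]
  ring

end

end

section

/-! ### The unit of the deformed product -/

open FourierTransform

variable {d : ℕ}

/-- The reflection of time, which relates the Minkowski product to the Euclidean inner product. -/
def timeReflection (d : ℕ) : Emb d ≃ₗᵢ[ℝ] Emb d :=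
  LinearIsometryEquiv.piLpCongrRight 2
    (fun μ => if μ = 0 then LinearIsometryEquiv.neg ℝ else LinearIsometryEquiv.refl ℝ ℝ)

theorem timeReflection_apply (X : Emb d) (μ : Fin (d + 1)) :
    timeReflection d X μ = eta μ * X μ := by
  simp only [timeReflection, LinearIsometryEquiv.piLpCongrRight_apply, eta]
  split_ifs <;> simp

theorem inner_timeReflection (X Y : Emb d) : inner ℝ X (timeReflection d Y) = mdot X Y := by
  rw [PiLp.inner_apply, mdot]
  refine Finset.sum_congr rfl fun μ _ => ?_
  rw [timeReflection_apply]
  simp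
  ring

theorem mdot_smul_comm (c : ℝ) (X Y : Emb d) : mdot (c • X) Y = mdot X (c • Y) := by
  simp only [mdot]
  exact Finset.sum_congr rfl fun μ _ => by simp; ring

/-- The Fourier transform with respect to the Minkowski product. -/
theorem exists_minkowski_fourier (χ : 𝓢(Emb d, ℂ)) : ∃ ψ : 𝓢(Emb d, ℂ),
    (∀ k, ψ k = ∫ X, χ X * Complex.exp (Complex.I * mdot X k)) ∧
      ∫ k, ψ k = (2 * Real.pi : ℂ) ^ (d + 1) * χ 0 := by
  -- This scaling, with the time reflection, turns `exp(-2πi⟨X, k⟩)` into `exp(i X · k)`.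
  set c : ℝ := -(2 * Real.pi)⁻¹ with hc
  have hπ := Real.pi_pos
  have hc0 : c ≠ 0 := by
    rw [hc]
    exact neg_ne_zero.2 (by positivity)
  let A : Emb d ≃L[ℝ] Emb d := (timeReflection d).toContinuousLinearEquiv.trans
    (ContinuousLinearEquiv.smulLeft (Units.mk0 c hc0))
  have hA : ∀ k, A k = c • timeReflection d k := fun k => rfl
  refine ⟨SchwartzMap.compCLMOfContinuousLinearEquiv ℂ A (𝓕 χ), fun k => ?_, ?_⟩
  · change (𝓕 χ) (A k) = _
    rw [SchwartzMap.fourier_coe, Real.fourier_eq']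
    refine integral_congr_ae (ae_of_all _ fun X => ?_)
    simp only [hA, inner_smul_right, inner_timeReflection, smul_eq_mul]
    rw [mul_comm]
    congr 2
    rw [mul_comm]
    congr 2
    rw [hc]
    field_simp
  · change ∫ k, (𝓕 χ) (A k) = _
    simp_rw [hA]
    have h1 := (timeReflection d).measurePreserving.integral_comp'
      (f := (timeReflection d).toMeasurableEquiv) (fun y => (𝓕 χ) (c • y))
    refine Eq.trans h1 ?_
    rw [Measure.integral_comp_smul]
    have h2 : ∫ y, (𝓕 χ) y = χ 0 := by
      have h3 : (𝓕⁻ (𝓕 χ) : 𝓢(Emb d, ℂ)) 0 = χ 0 := by rw [fourierInv_fourier_eq]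
      rw [SchwartzMap.fourierInv_coe, Real.fourierInv_eq'] at h3
      simpa using h3
    -- The Jacobian of the scaling by `c` is the source of the factor `(2π)^n`.
    have h4 : |(c ^ Module.finrank ℝ (Emb d))⁻¹| = (2 * Real.pi) ^ (d + 1) := by
      rw [finrank_euclideanSpace, Fintype.card_fin, abs_inv, abs_pow, hc, abs_neg, abs_inv,
        abs_of_pos (by positivity), inv_pow, inv_inv]
    rw [h2, h4, Complex.real_smul]
    push_cast
    rfl

/-- Integrating `χ(εX)` over `X` gives `ε^(-n) ψ(Y/ε)`; the substitution `Y = εk` then cancels the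
power of `ε`. -/
theorem osc_cutoff_snd (χ : 𝓢(Emb d, ℂ)) {ψ : 𝓢(Emb d, ℂ)}
    (hψ : ∀ k, ψ k = ∫ X, χ X * Complex.exp (Complex.I * mdot X k)) {b : Emb d → ℂ} {m : ℝ}
    (hb : Sym (fun y => (1 + ‖y‖) ^ m) b) {ε : ℝ} (hε : 0 < ε) :
    osc (minkowskiPhase d).φ (fun p => χ (ε • p.1) * (χ (ε • p.2) * b p.2)) =
      ∫ k, χ (ε • ε • k) * b (ε • k) * ψ k := by
  have hD := decay_nonneg (Emb d × Emb d)
  set D := decay (Emb d × Emb d)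
  have hs : Sym (fun p => (1 + ‖p‖) ^ (-decay (Emb d × Emb d)))
      (fun p : Emb d × Emb d => χ (ε • p.1) * (χ (ε • p.2) * b p.2)) := by
    have h1 := (sym_cutoff χ hε (-D)).comp_affine 0 (ContinuousLinearMap.fst ℝ (Emb d) (Emb d))
    have h2 := (sym_cutoff_mul hb χ hε (-D)).comp_affine 0
      (ContinuousLinearMap.snd ℝ (Emb d) (Emb d))
    have h3 := (h1.mul h2).mono (wt' := fun p => (1 + ‖p‖) ^ (-D)) 1 (fun p => by
      simp only [zero_add, ContinuousLinearMap.coe_fst', ContinuousLinearMap.coe_snd', one_mul]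
      rw [← Real.mul_rpow (by positivity) (by positivity)]
      refine Real.rpow_le_rpow_of_nonpos (by positivity) ?_ (by linarith)
      rcases max_choice ‖p.1‖ ‖p.2‖ with h | h <;> rw [Prod.norm_def, h] <;>
        nlinarith [norm_nonneg p.1, norm_nonneg p.2]) zero_le_one
    simpa using h3
  have hi := (minkowskiPhase d).integrable_mul_e hs
  rw [(minkowskiPhase d).osc_eq_integral hs, Measure.volume_eq_prod] at *
  rw [integral_prod_symm _ hi]
  have h1 : ∀ Y : Emb d, ∫ X, χ (ε • X) * (χ (ε • Y) * b Y) * (minkowskiPhase d).e (X, Y) =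
      (|(ε ^ (d + 1))⁻¹| : ℝ) • (fun k => χ (ε • ε • k) * b (ε • k) * ψ k) (ε⁻¹ • Y) := by
    intro Y
    obtain ⟨g, hg⟩ : ∃ g : Emb d → ℂ,
        g = fun x => χ x * Complex.exp (Complex.I * mdot x (ε⁻¹ • Y)) := ⟨_, rfl⟩
    have h2 : ∀ X : Emb d, χ (ε • X) * (χ (ε • Y) * b Y) * (minkowskiPhase d).e (X, Y) =
        (χ (ε • Y) * b Y) * g (ε • X) := fun X => by
      simp only [hg, Phase.e, minkowskiPhase, mdot_smul_comm, smul_inv_smul₀ hε.ne']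
      ring
    simp_rw [h2]
    rw [integral_const_mul, Measure.integral_comp_smul, hg, ← hψ, finrank_euclideanSpace,
      Fintype.card_fin, smul_inv_smul₀ hε.ne', mul_smul_comm]
  simp_rw [h1]
  rw [integral_smul, Measure.integral_comp_smul volume
    (fun k => χ (ε • ε • k) * b (ε • k) * ψ k) ε⁻¹, smul_smul, finrank_euclideanSpace,
    Fintype.card_fin, ← abs_mul, ← mul_inv, ← mul_pow, mul_inv_cancel₀ hε.ne']
  simp

theorem tendsto_integral_cutoff (χ ψ : 𝓢(Emb d, ℂ)) {b : Emb d → ℂ} {m : ℝ}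
    (hb : Sym (fun y => (1 + ‖y‖) ^ m) b) :
    Tendsto (fun ε : ℝ => ∫ k, χ (ε • ε • k) * b (ε • k) * ψ k) (𝓝[>] 0)
      (𝓝 (χ 0 * b 0 * ∫ k, ψ k)) := by
  obtain ⟨A, hA0, hA⟩ : ∃ A, 0 ≤ A ∧ ∀ p, ‖χ p‖ ≤ A * (1 + ‖p‖) ^ (0 : ℝ) :=
    (sym_schwartz χ 0).bound
  obtain ⟨B, hB0, hB⟩ := hb.bound
  -- The extra exponent `-|m|` compensates the growth of `b (ε • k)`, uniformly for `ε < 1`.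
  obtain ⟨C, hC0, hC⟩ := (sym_schwartz ψ (-decay (Emb d) - |m|)).bound
  rw [← integral_const_mul]
  refine tendsto_integral_filter_of_dominated_convergence
    (fun k => A * B * C * (1 + ‖k‖) ^ (-decay (Emb d))) ?_ ?_
    ((integrable_decay (Emb d)).const_mul _) (ae_of_all _ fun k => ?_)
  · refine Eventually.of_forall fun ε => Continuous.aestronglyMeasurable ?_
    have h1 := χ.continuous
    have h2 := ψ.continuous
    have h3 := hb.continuous
    fun_prop
  · filter_upwards [Ioo_mem_nhdsGT (zero_lt_one (α := ℝ))] with ε hε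
    refine ae_of_all _ fun k => ?_
    rw [norm_mul, norm_mul]
    have h1 := hA (ε • ε • k)
    rw [Real.rpow_zero, mul_one] at h1
    have h2 : ‖b (ε • k)‖ ≤ B * (1 + ‖k‖) ^ |m| := by
      refine (hB _).trans (mul_le_mul_of_nonneg_left ?_ hB0)
      refine (Real.rpow_le_rpow_of_exponent_le (by linarith [norm_nonneg (ε • k)])
        (le_abs_self m)).trans (Real.rpow_le_rpow (by positivity) ?_ (abs_nonneg m))
      rw [norm_smul, Real.norm_of_nonneg hε.1.le]
      nlinarith [norm_nonneg k, hε.1, hε.2]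
    calc _ ≤ A * (B * (1 + ‖k‖) ^ |m|) * (C * (1 + ‖k‖) ^ (-decay (Emb d) - |m|)) := by
          gcongr
          exact hC k
      _ = A * B * C * ((1 + ‖k‖) ^ |m| * (1 + ‖k‖) ^ (-decay (Emb d) - |m|)) := by ring
      _ = _ := by
          rw [← Real.rpow_add (by positivity)]
          congr 2
          ring
  · have h0 : Tendsto (fun ε : ℝ => ε) (𝓝[>] 0) (𝓝 0) := nhdsWithin_le_nhds
    have h1 : Tendsto (fun ε : ℝ => ε • k) (𝓝[>] 0) (𝓝 0) := by
      simpa using h0.smul_const k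
    have h2 : Tendsto (fun ε : ℝ => ε • ε • k) (𝓝[>] 0) (𝓝 0) := by
      simpa using h0.smul h1
    exact (((χ.continuous.tendsto 0).comp h2).mul ((hb.continuous.tendsto 0).comp h1)).mul_const _

theorem sym_comp_snd {b : Emb d → ℂ} {m : ℝ} (hb : Sym (fun y => (1 + ‖y‖) ^ m) b) :
    Sym (fun p => (1 + ‖p‖) ^ |m|) (fun p : Emb d × Emb d => b p.2) := by
  simpa using sym_translate hb 0 (ContinuousLinearMap.snd ℝ (Emb d) (Emb d))

/-- Fourier inversion in the form `∬ b(Y) exp(i X · Y) = (2π)^n b(0)`. It is evaluated with a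
cut-off that is a product in `X` and `Y`; convergence along it follows from
`Phase.osc_tendsto_zero`. -/
theorem osc_comp_snd {b : Emb d → ℂ} {m : ℝ} (hb : Sym (fun y => (1 + ‖y‖) ^ m) b) :
    osc (minkowskiPhase d).φ (fun p => b p.2) = (2 * Real.pi : ℂ) ^ (d + 1) * b 0 := by
  obtain ⟨χ, hχ⟩ := exists_schwartz_cutoff (V := Emb d)
  obtain ⟨ψ, hψ, hψi⟩ := exists_minkowski_fourier χ
  have hb2 := sym_comp_snd hb
  have hlim : ∀ {B : Emb d × Emb d →L[ℝ] Emb d},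
      Tendsto (fun ε : ℝ => ε • B) (𝓝[>] 0) (𝓝 0) := fun {B} => by
    have h : Tendsto (fun ε : ℝ => ε) (𝓝[>] 0) (𝓝 0) := nhdsWithin_le_nhds
    have h' : Tendsto (fun ε : ℝ => ε • B) (𝓝[>] 0) (𝓝 ((0 : ℝ) • B)) := h.smul_const B
    exact (zero_smul ℝ B) ▸ h'
  have hsym : ∀ (ε : ℝ) (B : Emb d × Emb d →L[ℝ] Emb d),
      Sym (fun _ => (1 : ℝ)) (fun p => χ (ε • B p)) := fun ε B => by
    simpa using (sym_cutoff_one χ ε).comp_affine 0 B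
  have hbdd : ∀ B : Emb d × Emb d →L[ℝ] Emb d,
      Bdd (𝓝[>] (0 : ℝ)) (fun _ _ => (1 : ℝ)) (fun ε p => χ (ε • B p)) := fun B => by
    simpa using (bdd_cutoff χ).comp_affine tendsto_id (fun _ => 0) (fun _ => B)
      (Eventually.of_forall fun _ => le_rfl)
  have hnull : ∀ B : Emb d × Emb d →L[ℝ] Emb d,
      Null (𝓝[>] (0 : ℝ)) (fun ε p => χ (ε • B p) - 1) := fun B => by
    have := null_comp_affine_sub_const (χ.smooth _) (z := fun _ : ℝ => 0) (z₀ := 0)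
      tendsto_const_nhds (hlim (B := B))
    simpa [hχ] using this
  set B₁ := ContinuousLinearMap.fst ℝ (Emb d) (Emb d)
  set B₂ := ContinuousLinearMap.snd ℝ (Emb d) (Emb d)
  have hc : ∀ ε : ℝ, Sym (fun p => (1 + ‖p‖) ^ |m|)
      (fun p => χ (ε • B₁ p) * (χ (ε • B₂ p) * b p.2)) := fun ε => by
    simpa only [one_mul] using (hsym ε B₁).mul ((hsym ε B₂).mul hb2)
  have hcb : Bdd (𝓝[>] (0 : ℝ)) (fun _ p => (1 + ‖p‖) ^ |m|)
      (fun ε p => χ (ε • B₁ p) * (χ (ε • B₂ p) * b p.2)) := by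
    simpa only [one_mul] using (hbdd B₁).mul ((hbdd B₂).mul (hb2.bdd _))
  have hn : Null (𝓝[>] (0 : ℝ))
      (fun ε p => χ (ε • B₁ p) * (χ (ε • B₂ p) * b p.2) - b p.2) := by
    have hs1 : ∀ ε : ℝ, ContDiff ℝ ∞ (fun p => χ (ε • B₁ p) - 1) :=
      fun ε => (hsym ε B₁).1.sub contDiff_const
    have hs2 : ∀ ε : ℝ, ContDiff ℝ ∞ (fun p => χ (ε • B₂ p) - 1) :=
      fun ε => (hsym ε B₂).1.sub contDiff_const
    -- Telescoping: `χ₁ χ₂ b - b = (χ₁ - 1) χ₂ b + (χ₂ - 1) b`.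
    have h1 := (hnull B₁).mul_bdd hs1 ((hbdd B₂).mul (hb2.bdd _))
      fun p => ⟨_, Eventually.of_forall fun _ => le_rfl⟩
    have h2 := (hnull B₂).mul_const hs2 hb2.1
    have h3 := h1.add h2 (fun ε => (hs1 ε).mul ((hsym ε B₂).1.mul hb2.1))
      (fun ε => (hs2 ε).mul hb2.1)
    convert h3 using 3
    ring
  have h1 := (minkowskiPhase d).osc_tendsto_zero (hcb.sub (hb2.bdd _)) hn
    fun ε => (hc ε).sub hb2
  simp_rw [(minkowskiPhase d).osc_sub (hc _) hb2] at h1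
  have h2 : Tendsto (fun ε : ℝ => osc (minkowskiPhase d).φ
      (fun p => χ (ε • B₁ p) * (χ (ε • B₂ p) * b p.2))) (𝓝[>] 0)
      (𝓝 (osc (minkowskiPhase d).φ (fun p => b p.2))) := by
    rw [tendsto_iff_norm_sub_tendsto_zero]
    exact tendsto_zero_iff_norm_tendsto_zero.1 h1
  have h3 := tendsto_integral_cutoff χ ψ hb
  rw [hψi, hχ, mul_one, one_mul, mul_comm] at h3
  refine tendsto_nhds_unique h2 (h3.congr' ?_)
  filter_upwards [self_mem_nhdsWithin] with ε hε
  exact (osc_cutoff_snd χ hψ hb hε).symm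

theorem sym_rpow_of_one {V : Type*} [NormedAddCommGroup V] [NormedSpace ℝ V] {a : V → ℂ}
    (h : Sym (fun _ => (1 : ℝ)) a) : Sym (fun p => (1 + ‖p‖) ^ (0 : ℝ)) a := by
  simpa using h

theorem osc_minkowskiPhase_one :
    osc (minkowskiPhase d).φ (fun _ => 1) = (2 * Real.pi : ℂ) ^ (d + 1) := by
  have := osc_comp_snd (d := d) (sym_rpow_of_one (sym_const (1 : ℂ)))
  simpa using this

/-- The phase is symmetric, so exchanging the variables multiplies the integral by a constant, which
the amplitude `1` shows to be `1`. -/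
theorem osc_comp_fst {b : Emb d → ℂ} {m : ℝ} (hb : Sym (fun y => (1 + ‖y‖) ^ m) b) :
    osc (minkowskiPhase d).φ (fun p => b p.1) = (2 * Real.pi : ℂ) ^ (d + 1) * b 0 := by
  obtain ⟨κ, hκ⟩ := exists_hasOsc_comp (ContinuousLinearEquiv.prodComm ℝ (Emb d) (Emb d))
  have e : (fun p => (minkowskiPhase d).φ (ContinuousLinearEquiv.prodComm ℝ (Emb d) (Emb d) p)) =
      (minkowskiPhase d).φ := funext fun p => mdot_comm _ _
  have h1 := hκ ((minkowskiPhase d).hasOsc (sym_rpow_of_one (sym_const (1 : ℂ))))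
  have h2 := hκ ((minkowskiPhase d).hasOsc (sym_comp_snd hb))
  rw [e] at h1 h2
  have h3 := h1.osc_eq
  rw [osc_minkowskiPhase_one] at h3
  have h4 : κ = 1 := by
    have h5 := two_pi_pow_ne_zero d
    exact mul_right_cancel₀ h5 (by rw [one_mul]; exact h3.symm)
  rw [h4, one_mul, osc_comp_snd hb] at h2
  exact h2.osc_eq

section

variable (Θ : Matrix (Fin (d + 1)) (Fin (d + 1)) ℝ) {F : Emb d → ℂ} {m : ℝ}

theorem dprod_one_right (hF : Sym (fun y => (1 + ‖y‖) ^ m) F) :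
    dprod Θ F (fun _ => 1) = F := by
  rw [dprod_eq_partialOsc Θ hF (sym_rpow_of_one (sym_const (1 : ℂ)))]
  funext Z
  have h1 : Sym (fun y => (1 + ‖y‖) ^ |m|) (fun X => F (Z + act Θ X)) :=
    sym_translate hF Z (actL Θ)
  have h2 := osc_comp_fst h1
  have h0 : act Θ 0 = 0 := map_zero (actL Θ)
  simp only [partialOsc, amplitude, mul_one]
  rw [h2, normalization, inv_mul_cancel_left₀ (two_pi_pow_ne_zero d), h0, add_zero]

theorem dprod_one_left (hF : Sym (fun y => (1 + ‖y‖) ^ m) F) :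
    dprod Θ (fun _ => 1) F = F := by
  rw [dprod_eq_partialOsc Θ (sym_rpow_of_one (sym_const (1 : ℂ))) hF]
  funext Z
  have h1 : Sym (fun y => (1 + ‖y‖) ^ |m|) (fun Y => F (Z + Y)) :=
    sym_translate hF Z (ContinuousLinearMap.id ℝ (Emb d))
  have h2 := osc_comp_snd h1
  simp only [partialOsc, amplitude, one_mul]
  rw [h2, normalization, inv_mul_cancel_left₀ (two_pi_pow_ne_zero d), add_zero]

end

end

section

variable {d : ℕ}

/-! ### The domain is closed under the deformed product -/

/-- Symbols of order `m` and type `ρ` in one variable. -/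
def HasSymbolType (m ρ : ℝ) (F : Emb d → ℂ) : Prop :=
  ContDiff ℝ ∞ F ∧
    ∀ i : ℕ, ∃ C, 0 ≤ C ∧ ∀ y, ‖iteratedFDeriv ℝ i F y‖ ≤ C * (1 + ‖y‖) ^ (m - ρ * i)

theorem HasSymbolType.sym {m ρ : ℝ} {F : Emb d → ℂ} (h : HasSymbolType m ρ F) (hρ : 0 ≤ ρ) :
    Sym (fun y => (1 + ‖y‖) ^ m) F := by
  refine ⟨h.1, fun i => ?_⟩
  obtain ⟨C, h0, hC⟩ := h.2 i
  refine ⟨C, h0, fun y => (hC y).trans (mul_le_mul_of_nonneg_left ?_ h0)⟩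
  refine Real.rpow_le_rpow_of_exponent_le (by linarith [norm_nonneg y]) ?_
  have : 0 ≤ ρ * i := by positivity
  linarith

theorem HasSymbolType.of_le {m ρ ρ' : ℝ} {F : Emb d → ℂ} (h : HasSymbolType m ρ F) (hρ : ρ' ≤ ρ) :
    HasSymbolType m ρ' F := by
  refine ⟨h.1, fun i => ?_⟩
  obtain ⟨C, h0, hC⟩ := h.2 i
  refine ⟨C, h0, fun y => (hC y).trans (mul_le_mul_of_nonneg_left ?_ h0)⟩
  refine Real.rpow_le_rpow_of_exponent_le (by linarith [norm_nonneg y]) ?_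
  have : ρ' * i ≤ ρ * i := by gcongr
  linarith

theorem HasSymbolType.fderiv_apply {m ρ : ℝ} {F : Emb d → ℂ} (h : HasSymbolType m ρ F)
    (u : Emb d) : HasSymbolType (m - ρ) ρ (fun y => fderiv ℝ F y u) := by
  refine ⟨contDiff_fderiv_apply h.1 u, fun i => ?_⟩
  obtain ⟨C, h0, hC⟩ := h.2 (i + 1)
  refine ⟨‖u‖ * C, by positivity, fun y => ?_⟩
  have e : m - ρ * ((i + 1 : ℕ) : ℝ) = m - ρ - ρ * i := by
    push_cast
    ring
  rw [← e, mul_assoc]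
  exact (norm_iteratedFDeriv_fderiv_apply_le h.1 i u y).trans
    (mul_le_mul_of_nonneg_left (hC y) (norm_nonneg u))

theorem exists_hasSymbolType_of_mem_domain {Θ : Matrix (Fin (d + 1)) (Fin (d + 1)) ℝ}
    {F : Emb d → ℂ} (hF : F ∈ domain Θ) : ∃ m ρ, 0 < ρ ∧ ρ ≤ 1 ∧ HasSymbolType m ρ F := by
  obtain ⟨m, ρ, h0, h1, hs, hb⟩ := symbol_of_mem_domain hF
  refine ⟨m, ρ, h0, h1, hs, fun i => ?_⟩
  obtain ⟨C, hC⟩ := hb i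
  refine ⟨max C 0, le_max_right _ _, fun y => (hC y).trans ?_⟩
  exact mul_le_mul_of_nonneg_right (le_max_left _ _) (by positivity)

theorem exists_sym_of_mem_domain {Θ : Matrix (Fin (d + 1)) (Fin (d + 1)) ℝ}
    {F : Emb d → ℂ} (hF : F ∈ domain Θ) : ∃ m : ℝ, Sym (fun y => (1 + ‖y‖) ^ m) F := by
  obtain ⟨m, ρ, h0, -, h⟩ := exists_hasSymbolType_of_mem_domain hF
  exact ⟨m, h.sym h0.le⟩

/-- For `Θ = 0` the first factor is the constant `F Z`, and the condition is just the one-variable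
estimate translated by `Z`. `symbolPair_of_mem_domain` then carries it to any matrix. -/
theorem HasSymbolType.mem_domain {m ρ : ℝ} {F : Emb d → ℂ} (h : HasSymbolType m ρ F) (h0 : 0 < ρ)
    (h1 : ρ ≤ 1) (Θ : Matrix (Fin (d + 1)) (Fin (d + 1)) ℝ) : F ∈ domain Θ := by
  have a0 : ∀ x : Emb d, act 0 x = 0 := fun x => by
    ext i
    simp [act]
  have hF : F ∈ domain (0 : Matrix (Fin (d + 1)) (Fin (d + 1)) ℝ) := by
    refine ⟨m, ρ, 0, h0, h1, le_rfl, zero_lt_one, fun Z => ?_⟩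
    simp only [a0, add_zero]
    refine ⟨contDiff_const.mul (h.1.comp (contDiff_const.add contDiff_snd)), fun K _ i j => ?_⟩
    obtain ⟨C, hC0, hC⟩ := h.2 i
    refine ⟨‖F Z‖ * (C * (1 + ‖Z‖) ^ |m - ρ * i|), fun x _ y => ?_⟩
    rw [zero_mul, add_zero]
    rcases j with _ | j
    · rw [norm_iteratedFDeriv_zero, iteratedFDeriv_mul_shift h.1, norm_smul, mul_assoc]
      refine mul_le_mul_of_nonneg_left ?_ (norm_nonneg _)
      have hp := rpow_peetre (m - ρ * i) (-Z) (Z + y)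
      rw [neg_add_cancel_left, norm_neg] at hp
      rw [mul_assoc]
      exact (hC _).trans (mul_le_mul_of_nonneg_left hp hC0)
    · rw [iteratedFDeriv_const_of_ne (by simp), Pi.zero_apply, norm_zero]
      positivity
  exact symbolPair_of_mem_domain hF hF Θ

/-- Induction by the Leibniz rule: each derivative falls on one factor and lowers its order by `ρ`,
hence the quantification over `m`, `m'`, `F` and `G`. -/
theorem exists_iteratedFDeriv_dprod_le (Θ : Matrix (Fin (d + 1)) (Fin (d + 1)) ℝ) {ρ : ℝ}
    (hρ : 0 ≤ ρ) (i : ℕ) : ∀ {m m' : ℝ} {F G : Emb d → ℂ}, HasSymbolType m ρ F →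
      HasSymbolType m' ρ G → ∃ C, 0 ≤ C ∧ ∀ Z,
        ‖iteratedFDeriv ℝ i (dprod Θ F G) Z‖ ≤ C * (1 + ‖Z‖) ^ (m + m' - ρ * i) := by
  induction i with
  | zero =>
    intro m m' F G hF hG
    simpa using (sym_dprod Θ (hF.sym hρ) (hG.sym hρ)).2 0
  | succ i ih =>
    intro m m' F G hF hG
    let b := Module.finBasis ℝ (Emb d)
    choose A hA0 hA using fun j => ih (hF.fderiv_apply (b j)) hG
    choose B hB0 hB using fun j => ih hF (hG.fderiv_apply (b j))
    refine ⟨∑ j, ‖(b.coord j).toContinuousLinearMap‖ * (A j + B j),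
      Finset.sum_nonneg fun j _ => mul_nonneg (norm_nonneg _) (add_nonneg (hA0 j) (hB0 j)),
      fun Z => ?_⟩
    have hs := (sym_dprod Θ (hF.sym hρ) (hG.sym hρ)).1
    refine (norm_iteratedFDeriv_succ_le_sum b hs i Z).trans ?_
    rw [Finset.sum_mul]
    refine Finset.sum_le_sum fun j _ => ?_
    rw [mul_assoc]
    refine mul_le_mul_of_nonneg_left ?_ (norm_nonneg _)
    have hs1 := sym_dprod Θ ((hF.sym hρ).fderiv_apply (b j)) (hG.sym hρ)
    have hs2 := sym_dprod Θ (hF.sym hρ) ((hG.sym hρ).fderiv_apply (b j))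
    simp_rw [fderiv_dprod_apply Θ (hF.sym hρ) (hG.sym hρ)]
    have h1 := iteratedFDeriv_add_apply (𝕜 := ℝ) (i := i) (x := Z)
      (hs1.1.contDiffAt.of_le (by exact_mod_cast le_top))
      (hs2.1.contDiffAt.of_le (by exact_mod_cast le_top))
    have e1 : m - ρ + m' - ρ * i = m + m' - ρ * ((i + 1 : ℕ) : ℝ) := by
      push_cast
      ring
    have e2 : m + (m' - ρ) - ρ * i = m + m' - ρ * ((i + 1 : ℕ) : ℝ) := by
      push_cast
      ring
    have h2 := hA j Z
    have h3 := hB j Z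
    rw [e1] at h2
    rw [e2] at h3
    rw [add_mul]
    refine (congrArg norm h1).le.trans ((norm_add_le _ _).trans (add_le_add h2 h3))

theorem dprod_mem_domain {Θ : Matrix (Fin (d + 1)) (Fin (d + 1)) ℝ} {F G : Emb d → ℂ}
    (hF : F ∈ domain Θ) (hG : G ∈ domain Θ) : dprod Θ F G ∈ domain Θ := by
  obtain ⟨m, ρ, h0, h1, hF⟩ := exists_hasSymbolType_of_mem_domain hF
  obtain ⟨m', ρ', h0', -, hG⟩ := exists_hasSymbolType_of_mem_domain hG
  -- The factors may have different types; the smaller one is valid for both.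
  have hρ : 0 < min ρ ρ' := lt_min h0 h0'
  replace hF := hF.of_le (min_le_left ρ ρ')
  replace hG := hG.of_le (min_le_right ρ ρ')
  exact HasSymbolType.mem_domain
    ⟨(sym_dprod Θ (hF.sym hρ.le) (hG.sym hρ.le)).1,
      fun i => exists_iteratedFDeriv_dprod_le Θ hρ.le i hF hG⟩
    hρ ((min_le_left _ _).trans h1) Θ

theorem one_mem_domain (Θ : Matrix (Fin (d + 1)) (Fin (d + 1)) ℝ) :
    (fun _ : Emb d => (1 : ℂ)) ∈ domain Θ := by
  refine HasSymbolType.mem_domain (m := 0) (ρ := 1) ⟨contDiff_const, fun i => ?_⟩ one_pos le_rfl Θ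
  refine ⟨1, zero_le_one, fun y => ?_⟩
  rcases i with _ | i
  · simp
  · rw [iteratedFDeriv_const_of_ne (by simp), Pi.zero_apply, norm_zero]
    positivity

/-! ### Associativity -/

/-- The linear substitution which exchanges the two iterated products. -/
def assocEquiv (d : ℕ) :
    ((Emb d × Emb d) × (Emb d × Emb d)) ≃L[ℝ] ((Emb d × Emb d) × (Emb d × Emb d)) :=
  LinearEquiv.toContinuousLinearEquiv
    { toFun := fun w => ((w.1.1 + w.2.1, w.2.2), (w.1.1, w.1.2 - w.2.2))
      map_add' := fun w w' => by
        ext1 <;> ext1 <;> simp <;> abel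
      map_smul' := fun c w => by
        simp [smul_sub]
      invFun := fun w => ((w.2.1, w.1.2 + w.2.2), (w.1.1 - w.2.1, w.1.2))
      left_inv := fun w => by simp
      right_inv := fun w => by simp }

theorem assocEquiv_apply (w : (Emb d × Emb d) × (Emb d × Emb d)) :
    assocEquiv d w = ((w.1.1 + w.2.1, w.2.2), (w.1.1, w.1.2 - w.2.2)) := rfl

/-- This is `(x + x') · y' + x · (y - y') = x · y + x' · y'`. -/
theorem phase_comp_assocEquiv :
    (fun w => ((minkowskiPhase d).prod (minkowskiPhase d)).φ (assocEquiv d w)) =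
      ((minkowskiPhase d).prod (minkowskiPhase d)).φ := by
  funext w
  simp only [Phase.prod, minkowskiPhase, assocEquiv_apply, mdot_add_left, mdot_sub_right]
  ring

/-- The substitution preserves oscillatory integrals. -/
theorem osc_comp_assocEquiv {a : (Emb d × Emb d) × (Emb d × Emb d) → ℂ} {m : ℝ}
    (ha : Sym (fun w => (1 + ‖w‖) ^ m) a) :
    osc ((minkowskiPhase d).prod (minkowskiPhase d)).φ (fun w => a (assocEquiv d w)) =
      osc ((minkowskiPhase d).prod (minkowskiPhase d)).φ a := by
  set P := (minkowskiPhase d).prod (minkowskiPhase d) with hP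
  have h0 : (volume : Measure (Emb d × Emb d)).IsAddHaarMeasure := isAddHaarMeasure_volume_prod
  have h00 : (volume : Measure ((Emb d × Emb d) × (Emb d × Emb d))).IsAddHaarMeasure :=
    isAddHaarMeasure_volume_prod
  obtain ⟨κ, hκ⟩ := exists_hasOsc_comp (V := (Emb d × Emb d) × (Emb d × Emb d)) (assocEquiv d)
  have h1 := hκ (P.hasOsc (sym_rpow_of_one (sym_const (1 : ℂ))))
  have h2 := hκ (P.hasOsc ha)
  rw [phase_comp_assocEquiv] at h1 h2
  -- The Jacobian constant `κ` is found by testing on the amplitude `1`, whose integral must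
  -- therefore be nonzero.
  have h3 : osc P.φ (fun _ => 1) ≠ 0 := by
    have hs : Sym (prodWeight 0 0)
        (fun _ : (Emb d × Emb d) × (Emb d × Emb d) => (1 : ℂ)) :=
      (sym_const (1 : ℂ)).mono 1 (fun p => by simp [prodWeight]) zero_le_one
    have h4 := (minkowskiPhase d).osc_const_mul (sym_rpow_of_one (sym_const (1 : ℂ)))
      ((2 * Real.pi : ℂ) ^ (d + 1))
    rw [mul_one, osc_minkowskiPhase_one] at h4
    rw [hP, osc_prod _ _ hs]
    have h6 : partialOsc (minkowskiPhase d).φ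
        (fun _ : (Emb d × Emb d) × (Emb d × Emb d) => (1 : ℂ)) =
        fun _ => (2 * Real.pi : ℂ) ^ (d + 1) := funext fun _ => osc_minkowskiPhase_one
    rw [h6, h4]
    exact mul_ne_zero (two_pi_pow_ne_zero d) (two_pi_pow_ne_zero d)
  have h5 : κ = 1 := mul_right_cancel₀ h3 (by rw [one_mul]; exact h1.osc_eq.symm)
  rw [h5, one_mul] at h2
  exact h2.osc_eq

section

variable (Θ : Matrix (Fin (d + 1)) (Fin (d + 1)) ℝ) (F G K : Emb d → ℂ) (Z : Emb d)

/-- The amplitude of `(F × G) × K` on the product of two copies of the integration space. -/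
def amplitudeLeft (w : (Emb d × Emb d) × (Emb d × Emb d)) : ℂ :=
  F (Z + act Θ (w.1.1 + w.2.1)) * (G (Z + act Θ w.1.1 + w.2.2) * K (Z + w.1.2))

/-- The amplitude of `F × (G × K)` on the product of two copies of the integration space. -/
def amplitudeRight (w : (Emb d × Emb d) × (Emb d × Emb d)) : ℂ :=
  F (Z + act Θ w.1.1) * (G (Z + w.1.2 + act Θ w.2.1) * K (Z + w.1.2 + w.2.2))

theorem amplitudeRight_assocEquiv (w : (Emb d × Emb d) × (Emb d × Emb d)) :
    amplitudeRight Θ F G K Z (assocEquiv d w) = amplitudeLeft Θ F G K Z w := by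
  simp only [amplitudeRight, amplitudeLeft, assocEquiv_apply]
  congr 3
  · abel
  · abel

variable {F G K} {m m' m'' : ℝ}

theorem sym_amplitudeRight (hF : Sym (fun y => (1 + ‖y‖) ^ m) F)
    (hG : Sym (fun y => (1 + ‖y‖) ^ m') G)
    (hK : Sym (fun y => (1 + ‖y‖) ^ m'') K) :
    Sym (fun w => (1 + ‖w‖) ^ (|m| + (|m'| + |m''|))) (amplitudeRight Θ F G K Z) := by
  have h := sym_rpow_mul
    (sym_translate hF Z ((actL Θ).comp ((ContinuousLinearMap.fst ℝ (Emb d) (Emb d)).comp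
      (ContinuousLinearMap.fst ℝ (Emb d × Emb d) (Emb d × Emb d)))))
    (sym_rpow_mul
      (sym_translate hG Z ((ContinuousLinearMap.snd ℝ (Emb d) (Emb d)).comp
        (ContinuousLinearMap.fst ℝ (Emb d × Emb d) (Emb d × Emb d)) +
        (actL Θ).comp ((ContinuousLinearMap.fst ℝ (Emb d) (Emb d)).comp
          (ContinuousLinearMap.snd ℝ (Emb d × Emb d) (Emb d × Emb d)))))
      (sym_translate hK Z ((ContinuousLinearMap.snd ℝ (Emb d) (Emb d)).comp
        (ContinuousLinearMap.fst ℝ (Emb d × Emb d) (Emb d × Emb d)) +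
        (ContinuousLinearMap.snd ℝ (Emb d) (Emb d)).comp
          (ContinuousLinearMap.snd ℝ (Emb d × Emb d) (Emb d × Emb d)))))
  simp only [add_apply, ← add_assoc] at h
  exact (add_assoc |m| |m'| |m''|) ▸ h

theorem sym_amplitudeLeft (hF : Sym (fun y => (1 + ‖y‖) ^ m) F)
    (hG : Sym (fun y => (1 + ‖y‖) ^ m') G)
    (hK : Sym (fun y => (1 + ‖y‖) ^ m'') K) :
    Sym (fun w => (1 + ‖w‖) ^ (|m| + (|m'| + |m''|))) (amplitudeLeft Θ F G K Z) := by
  have h := (sym_amplitudeRight Θ Z hF hG hK).comp_affine 0 (assocEquiv d).toContinuousLinearMap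
  have hN : 0 ≤ |m| + (|m'| + |m''|) := by positivity
  set A := (assocEquiv d).toContinuousLinearMap with hA
  have h2 := h.mono (wt' := fun w => (1 + ‖w‖) ^ (|m| + (|m'| + |m''|)))
    ((1 + ‖A‖) ^ (|m| + (|m'| + |m''|))) (fun w => by
      rw [← Real.mul_rpow (by positivity) (by positivity), zero_add]
      refine Real.rpow_le_rpow (by positivity) ?_ hN
      have := A.le_opNorm w
      nlinarith [norm_nonneg w, norm_nonneg A]) (by positivity)
  have e : (fun w => amplitudeRight Θ F G K Z (0 + A w)) = amplitudeLeft Θ F G K Z := by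
    funext w
    rw [zero_add]
    exact amplitudeRight_assocEquiv Θ F G K Z w
  rwa [e] at h2

theorem sym_prodWeight_amplitudeLeft (hF : Sym (fun y => (1 + ‖y‖) ^ m) F)
    (hG : Sym (fun y => (1 + ‖y‖) ^ m') G)
    (hK : Sym (fun y => (1 + ‖y‖) ^ m'') K) :
    Sym (prodWeight (|m| + (|m'| + |m''|)) (|m| + (|m'| + |m''|))) (amplitudeLeft Θ F G K Z) :=
  sym_prodWeight_of_growth (by positivity) (sym_amplitudeLeft Θ Z hF hG hK)

theorem sym_prodWeight_amplitudeRight (hF : Sym (fun y => (1 + ‖y‖) ^ m) F)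
    (hG : Sym (fun y => (1 + ‖y‖) ^ m') G)
    (hK : Sym (fun y => (1 + ‖y‖) ^ m'') K) :
    Sym (prodWeight (|m| + (|m'| + |m''|)) (|m| + (|m'| + |m''|))) (amplitudeRight Θ F G K Z) :=
  sym_prodWeight_of_growth (by positivity) (sym_amplitudeRight Θ Z hF hG hK)

/-- The factor `K(Z + p.2)` is constant for the inner integration and moves under it; linearity of
`Θ` merges the two shifts of the argument of `F`. -/
theorem amplitude_dprod_left (hF : Sym (fun y => (1 + ‖y‖) ^ m) F)
    (hG : Sym (fun y => (1 + ‖y‖) ^ m') G) (K : Emb d → ℂ) (p : Emb d × Emb d) :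
    amplitude Θ (dprod Θ F G) K (Z, p) =
      normalization d * partialOsc (minkowskiPhase d).φ (amplitudeLeft Θ F G K Z) p := by
  have h1 := (minkowskiPhase d).osc_const_mul
    ((sym_amplitude Θ hF hG).slice (Z + act Θ p.1)) (K (Z + p.2))
  have h2 : (fun q => K (Z + p.2) * amplitude Θ F G (Z + act Θ p.1, q)) =
      fun q => amplitudeLeft Θ F G K Z (p, q) := by
    funext q
    simp only [amplitude, amplitudeLeft, ← actL_apply, map_add, add_assoc]
    ring
  rw [h2] at h1
  have h3 := congrFun (dprod_eq_partialOsc Θ hF hG) (Z + act Θ p.1)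
  unfold partialOsc at h3 ⊢
  rw [h1]
  unfold amplitude at h3 ⊢
  dsimp only at h3 ⊢
  rw [h3]
  ring

theorem amplitude_dprod_right (F : Emb d → ℂ)
    (hG : Sym (fun y => (1 + ‖y‖) ^ m') G)
    (hK : Sym (fun y => (1 + ‖y‖) ^ m'') K) (p : Emb d × Emb d) :
    amplitude Θ F (dprod Θ G K) (Z, p) =
      normalization d * partialOsc (minkowskiPhase d).φ (amplitudeRight Θ F G K Z) p := by
  have h1 := (minkowskiPhase d).osc_const_mul
    ((sym_amplitude Θ hG hK).slice (Z + p.2)) (F (Z + act Θ p.1))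
  have h2 : (fun q => F (Z + act Θ p.1) * amplitude Θ G K (Z + p.2, q)) =
      fun q => amplitudeRight Θ F G K Z (p, q) := by
    funext q
    simp only [amplitude, amplitudeRight]
  rw [h2] at h1
  have h3 := congrFun (dprod_eq_partialOsc Θ hG hK) (Z + p.2)
  unfold partialOsc at h3 ⊢
  rw [h1]
  unfold amplitude at h3 ⊢
  dsimp only at h3 ⊢
  rw [h3]
  ring

theorem dprod_dprod_left (hF : Sym (fun y => (1 + ‖y‖) ^ m) F)
    (hG : Sym (fun y => (1 + ‖y‖) ^ m') G)
    (hK : Sym (fun y => (1 + ‖y‖) ^ m'') K) : dprod Θ (dprod Θ F G) K Z = normalization d * (normalization d *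
    osc (minkowskiPhase d).φ (partialOsc (minkowskiPhase d).φ (amplitudeLeft Θ F G K Z))) := by
  have hs := sym_partialOsc (minkowskiPhase d) (sym_prodWeight_amplitudeLeft Θ Z hF hG hK)
  have h1 := congrFun (dprod_eq_partialOsc Θ (sym_dprod Θ hF hG) hK) Z
  have h2 := (minkowskiPhase d).osc_const_mul hs (normalization d)
  rw [h1, ← h2]
  have h3 := funext (amplitude_dprod_left Θ Z hF hG K)
  exact congrArg (fun f => normalization d * osc (minkowskiPhase d).φ f) h3

theorem dprod_dprod_right (hF : Sym (fun y => (1 + ‖y‖) ^ m) F)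
    (hG : Sym (fun y => (1 + ‖y‖) ^ m') G)
    (hK : Sym (fun y => (1 + ‖y‖) ^ m'') K) : dprod Θ F (dprod Θ G K) Z = normalization d * (normalization d *
    osc (minkowskiPhase d).φ (partialOsc (minkowskiPhase d).φ (amplitudeRight Θ F G K Z))) := by
  have hs := sym_partialOsc (minkowskiPhase d) (sym_prodWeight_amplitudeRight Θ Z hF hG hK)
  have h1 := congrFun (dprod_eq_partialOsc Θ hF (sym_dprod Θ hG hK)) Z
  have h2 := (minkowskiPhase d).osc_const_mul hs (normalization d)
  rw [h1, ← h2]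
  have h3 := funext (amplitude_dprod_right Θ Z F hG hK)
  exact congrArg (fun f => normalization d * osc (minkowskiPhase d).φ f) h3

/-- Fubini's theorem turns each iterated product into one integral over four copies of `ℝⁿ`, and
`assocEquiv` matches both the phases and the amplitudes. -/
theorem dprod_assoc (hF : Sym (fun y => (1 + ‖y‖) ^ m) F)
    (hG : Sym (fun y => (1 + ‖y‖) ^ m') G)
    (hK : Sym (fun y => (1 + ‖y‖) ^ m'') K) : dprod Θ (dprod Θ F G) K = dprod Θ F (dprod Θ G K) := by
  funext Z
  rw [dprod_dprod_left Θ Z hF hG hK, dprod_dprod_right Θ Z hF hG hK,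
    ← osc_prod _ _ (sym_prodWeight_amplitudeLeft Θ Z hF hG hK),
    ← osc_prod _ _ (sym_prodWeight_amplitudeRight Θ Z hF hG hK),
    ← osc_comp_assocEquiv (sym_amplitudeRight Θ Z hF hG hK)]
  simp_rw [amplitudeRight_assocEquiv]

end

/-! ### The limit of vanishing deformation -/

/-- The limit is taken jointly in the matrix and the point. The limiting amplitude `F(Z₀) G(Z₀ + Y)`
does not involve `X`, so `osc_comp_snd` evaluates it. -/
theorem tendsto_dprod_zero {F G : Emb d → ℂ} {m m' : ℝ} (hF : Sym (fun y => (1 + ‖y‖) ^ m) F)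
    (hG : Sym (fun y => (1 + ‖y‖) ^ m') G) (Z₀ : Emb d) :
    Tendsto (fun y : Matrix (Fin (d + 1)) (Fin (d + 1)) ℝ × Emb d => dprod y.1 F G y.2)
      (𝓝 0 ×ˢ 𝓝 Z₀) (𝓝 (F Z₀ * G Z₀)) := by
  let M := Matrix (Fin (d + 1)) (Fin (d + 1)) ℝ
  let P := minkowskiPhase d
  let fstL := ContinuousLinearMap.fst ℝ (Emb d) (Emb d)
  let sndL := ContinuousLinearMap.snd ℝ (Emb d) (Emb d)
  have : FirstCountableTopology M :=
    inferInstanceAs (FirstCountableTopology (Fin (d + 1) → Fin (d + 1) → ℝ))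
  set l : Filter (M × Emb d) := 𝓝 0 ×ˢ 𝓝 Z₀
  have hl1 : Tendsto (Prod.fst : M × Emb d → M) l (𝓝 0) := tendsto_fst
  have hl2 : Tendsto (Prod.snd : M × Emb d → Emb d) l (𝓝 Z₀) := tendsto_snd
  have hB : Tendsto (fun Θ : M => (actL Θ).comp fstL) (𝓝 0) (𝓝 0) := by
    have h := (((ContinuousLinearMap.compL ℝ (Emb d × Emb d) (Emb d) (Emb d)).flip
      fstL).continuous.tendsto 0).comp (tendsto_actL_zero (d := d))
    rwa [map_zero] at h
  have hBn : ∀ᶠ Θ : M in 𝓝 0, ‖(actL Θ).comp fstL‖ ≤ 1 := by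
    have h := hB.norm
    rw [norm_zero] at h
    filter_upwards [h.eventually (gt_mem_nhds zero_lt_one)] with Θ hΘ using hΘ.le
  -- Within distance `1` of `Z₀` the weight in the point variable is bounded by a constant.
  have hloc : ∀ (s : ℝ) {a : M → Emb d × (Emb d × Emb d) → ℂ},
      Bdd (𝓝 0) (fun _ => prodWeight s |s|) a →
        Bdd l (fun _ p => (1 + ‖p‖) ^ |s|) (fun y p => a y.1 (y.2, p)) := by
    intro s a ha
    refine (ha.slice.mono_filter (l' := l) hl1.le_comap).mono ((2 + ‖Z₀‖) ^ |s|) ?_ (by positivity)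
    have h1 : ∀ᶠ y : M × Emb d in l, ‖y.2 - Z₀‖ ≤ 1 := by
      have h2 : Tendsto (fun y : M × Emb d => ‖y.2 - Z₀‖) l (𝓝 0) :=
        tendsto_iff_norm_sub_tendsto_zero.1 hl2
      filter_upwards [h2.eventually (gt_mem_nhds zero_lt_one)] with y hy using hy.le
    filter_upwards [h1] with y hy p
    have h3 := one_add_norm_rpow_le s Z₀ (y.2 - Z₀) hy
    rw [add_sub_cancel] at h3
    exact mul_le_mul_of_nonneg_right h3 (by positivity)
  have hbF := hloc m (bdd_comp_add (V := Emb d × Emb d) hF hBn)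
  have hbG := hloc m' (bdd_comp_add (V := Emb d × Emb d) hG (l := 𝓝 (0 : M)) (B := fun _ => sndL)
    (Eventually.of_forall fun _ => le_rfl))
  have hb : Bdd l (fun _ p => (1 + ‖p‖) ^ (|m| + |m'|))
      (fun y p => amplitude y.1 F G (y.2, p)) := by
    have h := hbF.mul hbG
    have e : ∀ p : Emb d × Emb d, (1 + ‖p‖) ^ |m| * (1 + ‖p‖) ^ |m'| =
        (1 + ‖p‖) ^ (|m| + |m'|) := fun p => (Real.rpow_add (by positivity) _ _).symm
    simp_rw [e] at h
    exact h
  have hs : ∀ y : M × Emb d, Sym (fun p => (1 + ‖p‖) ^ (|m| + |m'|))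
      (fun p => amplitude y.1 F G (y.2, p)) := fun y => (sym_amplitude y.1 hF hG).slice y.2
  have hG₀ : Sym (fun p => (1 + ‖p‖) ^ |m'|) (fun p : Emb d × Emb d => G (Z₀ + p.2)) :=
    sym_translate hG Z₀ sndL
  have hs₀ : Sym (fun p => (1 + ‖p‖) ^ (|m| + |m'|))
      (fun p : Emb d × Emb d => F Z₀ * G (Z₀ + p.2)) :=
    sym_of_growth_le (hG₀.const_mul _) (by linarith [abs_nonneg m])
  have hn : Null l (fun y p => amplitude y.1 F G (y.2, p) - F Z₀ * G (Z₀ + p.2)) := by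
    have h1 := null_comp_affine_sub_const hF.1 hl2 (hB.comp hl1)
    have h2 := null_comp_translate_sub hG.1 hl2 sndL
    have c1 : ∀ y : M × Emb d,
        ContDiff ℝ ∞ (fun p => F (y.2 + (actL y.1).comp fstL p) - F Z₀) :=
      fun y => (contDiff_comp_affine hF.1 _ _).sub contDiff_const
    have c2 : ∀ y : M × Emb d, ContDiff ℝ ∞ (fun p => G (y.2 + sndL p) - G (Z₀ + sndL p)) :=
      fun y => (contDiff_comp_affine hG.1 _ _).sub (contDiff_comp_affine hG.1 _ _)
    -- Telescoping: first `F(Z + ΘX)` is replaced by `F(Z₀)`, then `G(Z + Y)` by `G(Z₀ + Y)`.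
    have h3 := (h1.mul_bdd c1 hbG fun p => ⟨_, Eventually.of_forall fun _ => le_rfl⟩).add
      (h2.mul_const c2 (contDiff_const (c := F Z₀)))
      (fun y => (c1 y).mul (hbG.1 y)) (fun y => (c2 y).mul contDiff_const)
    convert h3 using 3
    simp only [amplitude, Function.comp_apply, ContinuousLinearMap.comp_apply, actL_apply, fstL,
      sndL, ContinuousLinearMap.coe_fst', ContinuousLinearMap.coe_snd']
    ring
  have h1 := P.osc_tendsto_zero (hb.sub (hs₀.bdd _)) hn fun y => (hs y).sub hs₀
  simp_rw [P.osc_sub (hs _) hs₀] at h1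
  have h2 : Tendsto (fun y : M × Emb d => osc P.φ (fun p => amplitude y.1 F G (y.2, p))) l
      (𝓝 (osc P.φ (fun p => F Z₀ * G (Z₀ + p.2)))) := by
    rw [tendsto_iff_norm_sub_tendsto_zero]
    exact tendsto_zero_iff_norm_tendsto_zero.1 h1
  have h3 : Sym (fun y => (1 + ‖y‖) ^ |m'|) (fun Y => G (Z₀ + Y)) :=
    sym_translate hG Z₀ (ContinuousLinearMap.id ℝ (Emb d))
  have h4 : normalization d * osc P.φ (fun p => F Z₀ * G (Z₀ + p.2)) = F Z₀ * G Z₀ := by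
    rw [P.osc_const_mul hG₀, osc_comp_snd h3, normalization, mul_left_comm,
      inv_mul_cancel_left₀ (two_pi_pow_ne_zero d), add_zero]
  have h5 := h2.const_mul (normalization d)
  rw [h4] at h5
  refine h5.congr fun y => ?_
  rw [dprod_eq_partialOsc y.1 hF hG]
  rfl

theorem tendstoLocallyUniformly_dprod {F G : Emb d → ℂ} {m m' : ℝ}
    (hF : Sym (fun y => (1 + ‖y‖) ^ m) F) (hG : Sym (fun y => (1 + ‖y‖) ^ m') G)
    (s : Set (Matrix (Fin (d + 1)) (Fin (d + 1)) ℝ)) :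
    TendstoLocallyUniformly (fun Θ => dprod Θ F G) (fun Z => F Z * G Z) (𝓝[s] 0) := by
  rw [tendstoLocallyUniformly_iff_forall_tendsto]
  intro Z
  have h1 := (tendsto_dprod_zero hF hG Z).mono_left
    (Filter.prod_mono (nhdsWithin_le_nhds (s := s)) le_rfl)
  have h2 : Tendsto (fun y : Matrix (Fin (d + 1)) (Fin (d + 1)) ℝ × Emb d => F y.2 * G y.2)
      (𝓝[s] 0 ×ˢ 𝓝 Z) (𝓝 (F Z * G Z)) :=
    ((hF.continuous.mul hG.continuous).tendsto Z).comp tendsto_snd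
  exact (h2.prodMk_nhds h1).mono_right (nhds_le_uniformity _)

theorem continuous_embed_fst (H : ℝ) : Continuous fun z : Patch d => (embed H z).1 := by
  refine (PiLp.continuous_toLp 2 _).comp (continuous_pi fun μ => ?_)
  refine Fin.cases ?_ (fun a => ?_) μ
  · simp only [Fin.cons_zero]
    fun_prop
  · simp only [Fin.cons_succ]
    fun_prop

end

end DeSitterDeformation

end

/-! ### The theorem, on the embedding space and on the patch. -/

open DeSitterDeformation in
theorem proposition1 (d : ℕ) (H : ℝ) (hH : 0 < H)
    (Θ : Matrix (Fin (d + 1)) (Fin (d + 1)) ℝ) (hΘ : Θ.transpose = -Θ) :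
    -- the product is well defined on the domain and does not leave it
    (∀ f ∈ ExtFun.dom H Θ, ∀ g ∈ ExtFun.dom H Θ,
      ExtFun.ProdExists Θ f g ∧ ExtFun.prod Θ f g ∈ ExtFun.dom H Θ) ∧
    -- associativity
    (∀ f ∈ ExtFun.dom H Θ, ∀ g ∈ ExtFun.dom H Θ, ∀ h ∈ ExtFun.dom H Θ,
      ExtFun.prod Θ (ExtFun.prod Θ f g) h = ExtFun.prod Θ f (ExtFun.prod Θ g h)) ∧
    -- the limit of vanishing deformation matrix, on the embedding space and on the patch
    (∀ f ∈ ExtFun.dom H Θ, ∀ g ∈ ExtFun.dom H Θ,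
      (∀ Θ' : Matrix (Fin (d + 1)) (Fin (d + 1)) ℝ, Θ'.transpose = -Θ' →
        ExtFun.ProdExists Θ' f g) ∧
      TendstoLocallyUniformly (fun Θ' => (ExtFun.prod Θ' f g).extension)
        (fun Z => f.extension Z * g.extension Z)
        (𝓝[{Θ' : Matrix (Fin (d + 1)) (Fin (d + 1)) ℝ | Θ'.transpose = -Θ'}] 0) ∧
      TendstoLocallyUniformly (fun Θ' => (ExtFun.prod Θ' f g).toFun)
        (fun z => f.toFun z * g.toFun z)
        (𝓝[{Θ' : Matrix (Fin (d + 1)) (Fin (d + 1)) ℝ | Θ'.transpose = -Θ'}] 0)) ∧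
    -- the constant function `1` is a two-sided unit
    ((ExtFun.one : ExtFun d H) ∈ ExtFun.dom H Θ ∧
      ∀ f ∈ ExtFun.dom H Θ,
        ExtFun.prod Θ f ExtFun.one = f ∧ ExtFun.prod Θ ExtFun.one f = f) := by
  have hex : ∀ f ∈ ExtFun.dom H Θ, ∀ g ∈ ExtFun.dom H Θ,
      ∀ Θ' : Matrix (Fin (d + 1)) (Fin (d + 1)) ℝ, ExtFun.ProdExists Θ' f g := by
    intro f hf g hg Θ' Z
    obtain ⟨m, hf⟩ := exists_sym_of_mem_domain hf
    obtain ⟨m', hg⟩ := exists_sym_of_mem_domain hg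
    exact ⟨_, hasProd_normalization_mul Θ' hf hg Z⟩
  refine ⟨fun f hf g hg => ⟨hex f hf g hg Θ, dprod_mem_domain hf hg⟩, ?_, ?_,
    one_mem_domain Θ, ?_⟩
  · intro f hf g hg h hh
    obtain ⟨m, hf⟩ := exists_sym_of_mem_domain hf
    obtain ⟨m', hg⟩ := exists_sym_of_mem_domain hg
    obtain ⟨m'', hh⟩ := exists_sym_of_mem_domain hh
    exact congrArg ExtFun.ofExt (dprod_assoc Θ hf hg hh)
  · intro f hf g hg
    have hu := hex f hf g hg
    obtain ⟨m, hf⟩ := exists_sym_of_mem_domain hf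
    obtain ⟨m', hg⟩ := exists_sym_of_mem_domain hg
    have hl := tendstoLocallyUniformly_dprod hf hg
      {Θ' : Matrix (Fin (d + 1)) (Fin (d + 1)) ℝ | Θ'.transpose = -Θ'}
    refine ⟨fun Θ' _ => hu Θ', hl, ?_⟩
    -- Locally uniform convergence pulls back along the continuous embedding of the patch.
    have h1 := hl.comp _ (continuous_embed_fst H)
    have e : (fun z => f.toFun z * g.toFun z) =
        (fun Z => f.extension Z * g.extension Z) ∘ fun z => (embed H z).1 := by
      funext z
      simp only [Function.comp_apply, f.extension_embed, g.extension_embed]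
    rw [e]
    exact h1
  · intro f hf
    obtain ⟨m, hf⟩ := exists_sym_of_mem_domain hf
    -- An extended function is determined by its extension, so equality of extensions gives equality
    -- on the patch too.
    have e : ∀ F : Emb d → ℂ, F = f.extension → (ExtFun.ofExt F : ExtFun d H) = f := by
      rintro F rfl
      exact ExtFun.ext (funext f.extension_embed) rfl
    exact ⟨e _ (dprod_one_right Θ hf), e _ (dprod_one_left Θ hf)⟩
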